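/- Let $X_n=\{-1,1\}^n$, let $U_n$ be the uniform distribution on $X_n$, and for $h,f:X_n\to\{-1,1\}$ put $\mathrm{err}(h,f)=\Pr_{x\sim U_n}[h(x)\neq f(x)]$. A concept class is a family $C=(C_n)_{n\ge 0}$, where $C_n$ is a set of functions $X_n\to\{-1,1\}$. Say that $C$ is *efficiently agnostically learnable under the uniform distribution with $k$-local membership queries* if there are a randomized algorithm $L$, a deterministic algorithm $E$ and a polynomial $p$ such that for all $n$, all real $\epsilon,\delta>0$ and every target function $f:X_n\to\{-1,1\}$ (not necessarily in $C_n$), the following holds when $L$ is given $n$, $\lceil 1/\epsilon\rceil$ and $\lceil 1/\delta\rceil$ in unary. The algorithm $L$ may request random examples $(x,f(x))$ with $x\sim U_n$ independent, and may ask for the value $f(q)$ at points $q\in X_n$ of its choice, provided that in every run each such $q$ is within Hamming distance $k$ of some random example that $L$ has already received. In every run, $L$ halts after at most $p(n,1/\epsilon,1/\delta)$ steps and outputs the description of a hypothesis $h:X_n\to\{-1,1\}$, which $E$ evaluates from this description, $n$ and the point, at every point of $X_n$, in at most $p(n,1/\epsilon,1/\delta)$ steps. With probability at least $1-\delta$,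 $$\mathrm{err}(h,f)\le \mathrm{err}(c,f)+\epsilon\qquad\text{for all } c\in C_n .$$ Say that $C$ is *efficiently agnostically learnable under the uniform distribution from random examples alone* if the same holds with an algorithm $L$ that never asks for the value of $f$ at a point of its choice. **Theorem.** Let $k\ge 0$ be a constant. Every concept class that is efficiently agnostically learnable under the uniform distribution with $k$-local membership queries is efficiently agnostically learnable under the uniform distribution from random examples alone. -/

import Mathlib

namespace LocalQueries

/-! ### Instance space, targets and error -/

/-- The Boolean hypercube of dimension `n`. The two bit values (written `-1, 1` or `0, 1`) are the
two Booleans. -/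
abbrev Cube (n : ℕ) : Type := Fin n → Bool

/-- A concept class: for every dimension `n`, a set of Boolean functions on the `n`-cube. -/
abbrev ConceptClass : Type := ∀ n : ℕ, Set (Cube n → Bool)

/-- `err h f = Pr [h x ≠ f x]` for `x` uniform in the `n`-cube. -/
noncomputable def err {n : ℕ} (h f : Cube n → Bool) : ℝ :=
  ((Finset.univ.filter fun x : Cube n => h x ≠ f x).card : ℝ) / (Fintype.card (Cube n) : ℝ)

/-! ### Data: binary trees, as in the language WHILE -/

/-- The values that programs manipulate: binary trees (pairs built up from `nil`). -/
inductive Data : Type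
  | nil : Data
  | cons : Data → Data → Data

namespace Data

/-- First component (`nil` for `nil`). -/
def head : Data → Data
  | nil => nil
  | cons d _ => d

/-- Second component (`nil` for `nil`). -/
def tail : Data → Data
  | nil => nil
  | cons _ e => e

/-- The test for being a pair; `nil` counts as false, every pair as true. -/
def isPair : Data → Bool
  | nil => false
  | cons _ _ => true

/-- The code of a bit. -/
def ofBool : Bool → Data
  | false => nil
  | true => cons nil nil

/-- The code of a list. -/
def ofList : List Data → Data
  | [] => nil
  | d :: l => cons d (ofList l)

/-- The unary code of a natural number. -/
def ofNat (m : ℕ) : Data := ofList (List.replicate m nil)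

/-- The code of a point: the list of its bits. -/
def ofPoint {n : ℕ} (x : Cube n) : Data := ofList (List.ofFn fun i => ofBool (x i))

/-- The point coded by a tree (a left inverse of `ofPoint`; missing bits are read as `false`). -/
def toPoint (n : ℕ) (d : Data) : Cube n := fun i => isPair (head (tail^[(i : ℕ)] d))

end Data

/-! ### Programs -/

/-- Expressions; variables are numbered. -/
inductive Expr : Type
  | var : ℕ → Expr
  | nil : Expr
  | cons : Expr → Expr → Expr
  | head : Expr → Expr
  | tail : Expr → Expr

/-- The value of an expression in a store. -/
def Expr.eval (s : ℕ → Data) : Expr → Data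
  | .var v => s v
  | .nil => .nil
  | .cons e e' => .cons (e.eval s) (e'.eval s)
  | .head e => (e.eval s).head
  | .tail e => (e.eval s).tail

/-- Randomized programs with access to an example oracle and to a membership oracle. -/
inductive Prog : Type
  /-- `assign v e`: set variable `v` to the value of `e`. -/
  | assign : ℕ → Expr → Prog
  | seq : Prog → Prog → Prog
  /-- `cond e p q`: if the value of `e` is a pair then `p` else `q`. -/
  | cond : Expr → Prog → Prog → Prog
  /-- `loop e p`: while the value of `e` is a pair, do `p`. -/
  | loop : Expr → Prog → Prog
  /-- `flip v`: set variable `v` to a fair random bit. -/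
  | flip : ℕ → Prog
  /-- `draw v`: set variable `v` to a fresh labeled random example. -/
  | draw : ℕ → Prog
  /-- `query v`: replace the point coded by variable `v` by its label. -/
  | query : ℕ → Prog

/-- Programs that use neither coins nor oracles. -/
def Prog.Deterministic : Prog → Prop
  | .assign _ _ => True
  | .seq p q => p.Deterministic ∧ q.Deterministic
  | .cond _ p q => p.Deterministic ∧ q.Deterministic
  | .loop _ p => p.Deterministic
  | .flip _ => False
  | .draw _ => False
  | .query _ => False

/-- A configuration: the stack of programs still to be run, the store, and the list of the examples
received so far (a record that the program itself cannot read). -/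
structure Config (n : ℕ) : Type where
  todo : List Prog
  store : ℕ → Data
  sample : List (Cube n)

/-- One computation step with target function `f`. The example oracle draws a uniform point `x` and
returns the pair of `x` and `f x`; the membership oracle returns `f` at the point asked for.
A configuration with an empty stack has halted. -/
noncomputable def step {n : ℕ} (f : Cube n → Bool) (c : Config n) : PMF (Config n) :=
  match c.todo with
  | [] => PMF.pure c
  | .assign v e :: r => PMF.pure ⟨r, Function.update c.store v (e.eval c.store), c.sample⟩
  | .seq p q :: r => PMF.pure ⟨p :: q :: r, c.store, c.sample⟩
  | .cond e p q :: r =>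
      PMF.pure ⟨(if (e.eval c.store).isPair then p else q) :: r, c.store, c.sample⟩
  | .loop e p :: r =>
      PMF.pure ⟨if (e.eval c.store).isPair then p :: .loop e p :: r else r, c.store, c.sample⟩
  | .flip v :: r =>
      (PMF.uniformOfFintype Bool).bind fun b =>
        PMF.pure ⟨r, Function.update c.store v (Data.ofBool b), c.sample⟩
  | .draw v :: r =>
      (PMF.uniformOfFintype (Cube n)).bind fun x =>
        PMF.pure ⟨r, Function.update c.store v (.cons (Data.ofPoint x) (Data.ofBool (f x))),
          x :: c.sample⟩
  | .query v :: r =>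
      PMF.pure ⟨r, Function.update c.store v (Data.ofBool (f (Data.toPoint n (c.store v)))),
        c.sample⟩

/-- The distribution of the configuration after `t` steps. -/
noncomputable def runFor {n : ℕ} (f : Cube n → Bool) (c : Config n) : ℕ → PMF (Config n)
  | 0 => PMF.pure c
  | t + 1 => (runFor f c t).bind (step f)

/-- The initial configuration of `p`: variables `0, 1, …` hold the inputs, all others `nil`. -/
def start (n : ℕ) (p : Prog) (inputs : List Data) : Config n :=
  ⟨[p], fun v => inputs.getD v .nil, []⟩

/-! ### Efficient agnostic learning under the uniform distribution -/

/-- On the hypothesis code `d`, the dimension `n` and a point `x`, the deterministic program `E`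
returns `h x` in variable `0` after at most `T` steps, for all `x`. The target function of the run
is irrelevant, as `E` is deterministic. -/
def Evaluates {n : ℕ} (E : Prog) (d : Data) (T : ℕ) (h : Cube n → Bool) : Prop :=
  E.Deterministic ∧
    ∀ x : Cube n, ∀ c ∈ (runFor (fun _ : Cube n => false)
      (start n E [d, Data.ofNat n, Data.ofPoint x]) T).support,
        c.todo = [] ∧ (c.store 0).isPair = h x

/-- A rule that says which queries are permitted, given the examples received so far. -/
abbrev QueryRule : Type := ∀ n : ℕ, List (Cube n) → Cube n → Prop

/-- A query is `k`-local if some example received is at Hamming distance at most `k` from it. -/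
def kLocal (k : ℕ) : QueryRule := fun _ S q => ∃ x ∈ S, hammingDist x q ≤ k

/-- No membership queries at all. -/
def noQueries : QueryRule := fun _ _ _ => False

/-- The initial configuration of the learner `L`, given `n`, `⌈1/ε⌉` and `⌈1/δ⌉` in unary. -/
noncomputable def learnerStart (L : Prog) (n : ℕ) (ε δ : ℝ) : Config n :=
  start n L [Data.ofNat n, Data.ofNat ⌈1 / ε⌉₊, Data.ofNat ⌈1 / δ⌉₊]

/-- A time bound polynomial in `n`, `1/ε` and `1/δ`. -/
noncomputable def timeBound (K n : ℕ) (ε δ : ℝ) : ℕ := K * (n + ⌈1 / ε⌉₊ + ⌈1 / δ⌉₊ + 1) ^ K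

/-- `C` is efficiently agnostically learnable under the uniform distribution from random examples
and membership queries that obey `rule`: there are a learner `L`, a hypothesis evaluator `E` and a
polynomial time bound such that for all `n`, `ε`, `δ` and every target function `f` (not
necessarily in `C`)
* in every possible run, each query of `L` obeys `rule`,
* in every possible run, `L` halts within the time bound, with output (in variable `0`) the code of
  a hypothesis that `E` evaluates at each point within the time bound,
* with probability at least `1 - δ`, the error of this hypothesis exceeds that of no concept in `C`
  by more than `ε`. -/
def EfficientlyAgnosticallyLearnable (rule : QueryRule) (C : ConceptClass) : Prop :=
  ∃ (L E : Prog) (K : ℕ), ∀ (n : ℕ) (ε δ : ℝ), 0 < ε → 0 < δ → ∀ f : Cube n → Bool,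
    (∀ t : ℕ, ∀ c ∈ (runFor f (learnerStart L n ε δ) t).support, ∀ v r,
      c.todo = Prog.query v :: r → rule n c.sample (Data.toPoint n (c.store v))) ∧
    (∀ c ∈ (runFor f (learnerStart L n ε δ) (timeBound K n ε δ)).support,
      c.todo = [] ∧ ∃ h : Cube n → Bool, Evaluates E (c.store 0) (timeBound K n ε δ) h) ∧
    ENNReal.ofReal (1 - δ) ≤
      (runFor f (learnerStart L n ε δ) (timeBound K n ε δ)).toOuterMeasure
        {c | ∃ h : Cube n → Bool, Evaluates E (c.store 0) (timeBound K n ε δ) h ∧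
          ∀ g ∈ C n, err h f ≤ err g f + ε}

end LocalQueries

/-!
Colour the cube with polynomially many colours so that two points of the same colour are at Hamming
distance more than `2 * k`. For each colour class `A`, run the learner on a target that agrees with
`f` on `A` and has independent random labels off `A`, which are drawn on first use and remembered.
Only labels in `A` require access to `f`, and a query near an example `x` can ask for at most one
of them: that of the only point `y` of `A` within distance `k` of `x`. Given the displacement from
`y` to `x`, the point `y` is uniform in `A`. So the learner may be shown, instead of `x`, the point
with the same displacement from the first point `z` of `A` in a sequence of fresh examples. The
label of `z` is then known, and the learner never has to query `f`.

Random labels off `A` are useless for prediction: a run reads few of them, and the number of the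
other ones on which its hypothesis errs, compared with any fixed competitor, fluctuates by about the
square root of `2 ^ n`, by a second-moment estimate. Accuracy for the mixed target thus forces
accuracy for `f` on `A`, and the hypotheses for the different colours are combined into one. If the
cube has only polynomially many points, this fluctuation is not negligible, but then a table of
polynomially many random examples contains every point.
-/

namespace LocalQueries

open scoped BigOperators symmDiff

/-! ### The expected payoff of a run -/

/-- The values of all variables of a program. -/
abbrev Store : Type := ℕ → Data

/-- The expectation of the payoff `Φ` of the final store of a run of at most `t` steps from a stack
of programs and a store; runs that have not halted by then pay nothing. -/
noncomputable def expectedPayoff {n : ℕ} (f : Cube n → Bool) (Φ : Store → ℝ) :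
    ℕ → List Prog → Store → ℝ
  | 0, [], s => Φ s
  | 0, _ :: _, _ => 0
  | _ + 1, [], s => Φ s
  | t + 1, .assign v e :: r, s => expectedPayoff f Φ t r (Function.update s v (e.eval s))
  | t + 1, .seq p q :: r, s => expectedPayoff f Φ t (p :: q :: r) s
  | t + 1, .cond e p q :: r, s =>
      expectedPayoff f Φ t ((if (e.eval s).isPair then p else q) :: r) s
  | t + 1, .loop e p :: r, s =>
      expectedPayoff f Φ t (if (e.eval s).isPair then p :: .loop e p :: r else r) s
  | t + 1, .flip v :: r, s =>
      𝔼 b, expectedPayoff f Φ t r (Function.update s v (Data.ofBool b))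
  | t + 1, .draw v :: r, s => 𝔼 x : Cube n,
      expectedPayoff f Φ t r (Function.update s v (.cons (Data.ofPoint x) (Data.ofBool (f x))))
  | t + 1, .query v :: r, s =>
      expectedPayoff f Φ t r (Function.update s v (Data.ofBool (f (Data.toPoint n (s v)))))

section expectedPayoff
variable {n : ℕ} {f : Cube n → Bool} {Φ : Store → ℝ}

@[simp]
theorem expectedPayoff_nil (t : ℕ) (s : Store) : expectedPayoff f Φ t [] s = Φ s := by
  cases t <;> rfl

theorem expectedPayoff_nonneg (hΦ : 0 ≤ Φ) (t : ℕ) (todo : List Prog) (s : Store) :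
    0 ≤ expectedPayoff f Φ t todo s := by
  induction t generalizing todo s with
  | zero =>
    rcases todo with _ | _
    exacts [hΦ s, le_rfl]
  | succ t ih =>
    rcases todo with _ | ⟨p, r⟩
    · exact hΦ s
    · cases p <;> simp only [expectedPayoff] <;>
        first | exact ih _ _ | exact Finset.expect_nonneg fun _ _ => ih _ _

theorem expectedPayoff_le_one (hΦ : Φ ≤ 1) (t : ℕ) (todo : List Prog) (s : Store) :
    expectedPayoff f Φ t todo s ≤ 1 := by
  induction t generalizing todo s with
  | zero =>
    rcases todo with _ | _
    exacts [hΦ s, zero_le_one]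
  | succ t ih =>
    rcases todo with _ | ⟨p, r⟩
    · exact hΦ s
    · cases p <;> simp only [expectedPayoff] <;>
        first | exact ih _ _ | exact Finset.expect_le Finset.univ_nonempty fun _ _ => ih _ _

theorem expectedPayoff_mono_time (hΦ : 0 ≤ Φ) (todo : List Prog) (s : Store) :
    Monotone fun t => expectedPayoff f Φ t todo s := by
  refine monotone_nat_of_le_succ fun t => ?_
  induction t generalizing todo s with
  | zero =>
    rcases todo with _ | _
    · exact le_rfl
    · exact expectedPayoff_nonneg hΦ _ _ _
  | succ t ih =>
    rcases todo with _ | ⟨p, r⟩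
    · exact le_rfl
    · cases p <;> rw [expectedPayoff, expectedPayoff] <;>
        first | exact ih _ _ | exact Finset.expect_le_expect fun _ _ => ih _ _

end expectedPayoff

section indicator
variable {α : Type*} {S : Set α} {a : α}

theorem indicator_one_nonneg (S : Set α) : 0 ≤ S.indicator (1 : α → ℝ) :=
  Set.indicator_nonneg fun _ _ => zero_le_one

theorem indicator_one_le_one (S : Set α) : S.indicator (1 : α → ℝ) ≤ 1 :=
  Set.indicator_le' (fun _ _ => le_rfl) fun _ _ => zero_le_one

theorem one_le_indicator_one (ha : a ∈ S) : 1 ≤ S.indicator (1 : α → ℝ) a :=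
  (Set.indicator_of_mem ha (1 : α → ℝ)).ge

end indicator

theorem toOuterMeasure_uniformOfFintype_bind {α γ : Type*} [Fintype α] [Nonempty α]
    {p : α → PMF γ} {S : Set γ} {F : α → ℝ} (hF : 0 ≤ F)
    (h : ∀ x, (p x).toOuterMeasure S = ENNReal.ofReal (F x)) :
    ((PMF.uniformOfFintype α).bind p).toOuterMeasure S = ENNReal.ofReal (𝔼 x, F x) := by
  rw [PMF.toOuterMeasure_bind_apply, tsum_fintype]
  simp only [h, PMF.uniformOfFintype_apply, ← Finset.mul_sum]
  rw [← ENNReal.ofReal_sum_of_nonneg fun x _ => hF x, Fintype.expect_eq_sum_div_card,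
    ENNReal.ofReal_div_of_pos (by exact_mod_cast Fintype.card_pos), ENNReal.ofReal_natCast,
    ENNReal.div_eq_inv_mul]

section runFor
variable {n : ℕ} {f : Cube n → Bool} {c : Config n} {t : ℕ} {S : Set Store}

theorem runFor_succ' (f : Cube n → Bool) (c : Config n) (t : ℕ) :
    runFor f c (t + 1) = (step f c).bind fun c' => runFor f c' t := by
  induction t with
  | zero => simp [runFor]
  | succ t ih => rw [runFor, ih, PMF.bind_bind]; rfl

theorem toOuterMeasure_runFor (f : Cube n → Bool) (c : Config n) (t : ℕ) (S : Set Store) :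
    (runFor f c t).toOuterMeasure {c | c.todo = [] ∧ c.store ∈ S} =
      ENNReal.ofReal (expectedPayoff f (S.indicator 1) t c.todo c.store) := by
  induction t generalizing c with
  | zero =>
    rcases c with ⟨_ | ⟨p, r⟩, s, sample⟩
    · by_cases h : s ∈ S <;> simp [runFor, PMF.toOuterMeasure_pure_apply, h]
    · simp [runFor, PMF.toOuterMeasure_pure_apply, expectedPayoff]
  | succ t ih =>
    have hnonneg := expectedPayoff_nonneg (f := f) (indicator_one_nonneg S) t
    rw [runFor_succ']
    rcases c with ⟨_ | ⟨p, r⟩, s, sample⟩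
    · simp only [step, PMF.pure_bind, ih, expectedPayoff_nil]
    · cases p <;> simp only [step, PMF.pure_bind, PMF.bind_bind, ih, expectedPayoff]
      · exact toOuterMeasure_uniformOfFintype_bind (fun _ => hnonneg _ _) fun x => ih _
      · exact toOuterMeasure_uniformOfFintype_bind (fun _ => hnonneg _ _) fun x => ih _

theorem one_le_expectedPayoff_indicator_iff :
    1 ≤ expectedPayoff f (S.indicator 1) t c.todo c.store ↔
      ∀ c' ∈ (runFor f c t).support, c'.todo = [] ∧ c'.store ∈ S := by
  have h := (runFor f c t).toOuterMeasure_apply_eq_one_iff {c | c.todo = [] ∧ c.store ∈ S}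
  rw [toOuterMeasure_runFor, ENNReal.ofReal_eq_one] at h
  exact (expectedPayoff_le_one (indicator_one_le_one S) _ _ _).ge_iff_eq.trans h

theorem ofReal_le_toOuterMeasure_runFor_iff {p : ℝ}
    (hhalt : ∀ c' ∈ (runFor f c t).support, c'.todo = []) :
    ENNReal.ofReal p ≤ (runFor f c t).toOuterMeasure {c | c.store ∈ S} ↔
      p ≤ expectedPayoff f (S.indicator 1) t c.todo c.store := by
  rw [← ENNReal.ofReal_le_ofReal_iff (expectedPayoff_nonneg (indicator_one_nonneg S) _ _ _),
    ← toOuterMeasure_runFor, PMF.toOuterMeasure_apply_eq_of_inter_support_eq (runFor f c t)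
      (s := {c | c.store ∈ S}) (t := {c | c.todo = [] ∧ c.store ∈ S})]
  ext c'
  simp +contextual [hhalt]

end runFor

/-! ### Weakest preexpectations of programs with bounded loops -/

/-- The number of steps of a program whose loops are tested at most `W` times in a row. -/
def Prog.cost (W : ℕ) : Prog → ℕ
  | .assign _ _ => 1
  | .seq p q => p.cost W + q.cost W + 1
  | .cond _ p q => p.cost W + q.cost W + 1
  | .loop _ p => W * (p.cost W + 1)
  | .flip _ => 1
  | .draw _ => 1
  | .query _ => 1

/-- The preexpectation of the payoff `K` after a loop with test `e` whose body has the
preexpectation transformer `X`; executions with more than `m` tests pay nothing. -/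
noncomputable def loopWp (e : Expr) (X : (Store → ℝ) → Store → ℝ) (K : Store → ℝ) :
    ℕ → Store → ℝ
  | 0 => 0
  | m + 1 => fun s => if (e.eval s).isPair then X (loopWp e X K m) s else K s

/-- The weakest preexpectation, in the sense of McIver and Morgan, of the payoff `K`: the
expectation of `K` at the store after an execution, as a function of the store before it.
Executions in which a loop is tested more than `W` times in a row pay nothing. -/
noncomputable def Prog.wp (W : ℕ) {n : ℕ} (f : Cube n → Bool) :
    Prog → (Store → ℝ) → Store → ℝ
  | .assign v e, K => fun s => K (Function.update s v (e.eval s))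
  | .seq p q, K => p.wp W f (q.wp W f K)
  | .cond e p q, K => fun s => if (e.eval s).isPair then p.wp W f K s else q.wp W f K s
  | .loop e p, K => loopWp e (p.wp W f) K W
  | .flip v, K => fun s => 𝔼 b, K (Function.update s v (Data.ofBool b))
  | .draw v, K => fun s => 𝔼 x : Cube n,
      K (Function.update s v (.cons (Data.ofPoint x) (Data.ofBool (f x))))
  | .query v, K => fun s => K (Function.update s v (Data.ofBool (f (Data.toPoint n (s v)))))

section loopWp
variable {e : Expr} {X Y : (Store → ℝ) → Store → ℝ} {K K' : Store → ℝ}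

theorem loopWp_succ (m : ℕ) (s : Store) : loopWp e X K (m + 1) s =
    if (e.eval s).isPair then X (loopWp e X K m) s else K s := rfl

theorem loopWp_nonneg (hX : ∀ K, 0 ≤ K → 0 ≤ X K) (hK : 0 ≤ K) (m : ℕ) : 0 ≤ loopWp e X K m := by
  induction m with
  | zero => exact le_rfl
  | succ m ih =>
    intro s
    rw [loopWp_succ]
    split_ifs
    exacts [hX _ ih s, hK s]

theorem loopWp_mono_payoff (hX : Monotone X) (m : ℕ) : Monotone fun K => loopWp e X K m := by
  intro K K' hK
  induction m with
  | zero => exact le_rfl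
  | succ m ih =>
    intro s
    simp only [loopWp_succ]
    split_ifs
    exacts [hX ih s, hK s]

theorem loopWp_mono_tests (hX : Monotone X) (hX0 : ∀ K, 0 ≤ K → 0 ≤ X K) (hK : 0 ≤ K) :
    Monotone (loopWp e X K) := by
  refine monotone_nat_of_le_succ fun m => ?_
  induction m with
  | zero => exact loopWp_nonneg hX0 hK 1
  | succ m ih =>
    intro s
    rw [loopWp_succ, loopWp_succ]
    split_ifs
    exacts [hX ih s, le_rfl]

theorem loopWp_mono_body (hX : ∀ K, 0 ≤ K → 0 ≤ X K) (hY : Monotone Y)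
    (hXY : ∀ K, 0 ≤ K → X K ≤ Y K) (hK : 0 ≤ K) (m : ℕ) : loopWp e X K m ≤ loopWp e Y K m := by
  induction m with
  | zero => exact le_rfl
  | succ m ih =>
    intro s
    rw [loopWp_succ, loopWp_succ]
    split_ifs
    exacts [(hXY _ (loopWp_nonneg hX hK m) s).trans (hY ih s), le_rfl]

end loopWp

section wp
variable {n W : ℕ} {f : Cube n → Bool} {p : Prog} {K : Store → ℝ}

theorem wp_mono (W : ℕ) (f : Cube n → Bool) (p : Prog) : Monotone (p.wp W f) := by
  induction p with
  | seq p q ihp ihq => exact ihp.comp ihq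
  | cond e p q ihp ihq =>
    intro K K' hK s
    simp only [Prog.wp]
    split_ifs
    exacts [ihp hK s, ihq hK s]
  | loop e _ ih => exact loopWp_mono_payoff ih W
  | flip v | draw v => exact fun K K' hK s => Finset.expect_le_expect fun _ _ => hK _
  | _ => exact fun K K' hK s => hK _

theorem wp_nonneg (p : Prog) (hK : 0 ≤ K) : 0 ≤ p.wp W f K := by
  induction p generalizing K with
  | seq _ _ ihp ihq => exact ihp (ihq hK)
  | cond e p q ihp ihq =>
    intro s
    simp only [Prog.wp]
    split_ifs
    exacts [ihp hK s, ihq hK s]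
  | loop e _ ih => exact loopWp_nonneg (fun _ => ih) hK W
  | flip v | draw v => exact fun s => Finset.expect_nonneg fun _ _ => hK _
  | assign v e => exact fun s => hK (Function.update s v (e.eval s))
  | query v => exact fun s => hK (Function.update s v (Data.ofBool (f (Data.toPoint n (s v)))))

theorem wp_le_wp_succ (W : ℕ) (p : Prog) (hK : 0 ≤ K) : p.wp W f K ≤ p.wp (W + 1) f K := by
  induction p generalizing K with
  | seq p q ihp ihq => exact (ihp (wp_nonneg q hK)).trans (wp_mono _ f p (ihq hK))
  | cond e p q ihp ihq =>
    intro s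
    simp only [Prog.wp]
    split_ifs
    exacts [ihp hK s, ihq hK s]
  | loop e p ih =>
    exact (loopWp_mono_body (fun _ => wp_nonneg p) (wp_mono _ f p) (fun _ => ih) hK W).trans
      (loopWp_mono_tests (wp_mono _ f p) (fun _ => wp_nonneg p) hK W.le_succ)
  | _ => exact le_rfl

theorem wp_le_expectedPayoff {Φ : Store → ℝ} (hΦ : 0 ≤ Φ) {B : ℕ} {r : List Prog}
    (hK : K ≤ expectedPayoff f Φ B r) :
    p.wp W f K ≤ expectedPayoff f Φ (B + p.cost W) (p :: r) := by
  induction p generalizing K B r with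
  | seq p q ihp ihq =>
    refine (ihp (ihq hK)).trans (le_of_eq ?_)
    rw [Prog.cost, show B + (p.cost W + q.cost W + 1) = (B + q.cost W + p.cost W) + 1 by ring]
    rfl
  | cond e p q ihp ihq =>
    intro s
    rw [Prog.cost, ← add_assoc, expectedPayoff]
    simp only [Prog.wp]
    split_ifs
    · exact (ihp hK s).trans (expectedPayoff_mono_time hΦ _ _ (by omega))
    · exact (ihq hK s).trans (expectedPayoff_mono_time hΦ _ _ (by omega))
  | loop e p ih =>
    suffices ∀ m, loopWp e (p.wp W f) K m ≤
        expectedPayoff f Φ (B + m * (p.cost W + 1)) (.loop e p :: r) from this W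
    intro m
    induction m with
    | zero => exact fun s => expectedPayoff_nonneg hΦ _ _ _
    | succ m ihm =>
      intro s
      rw [show B + (m + 1) * (p.cost W + 1) = (B + m * (p.cost W + 1) + p.cost W) + 1 by ring,
        expectedPayoff, loopWp_succ]
      split_ifs
      · exact ih ihm s
      · exact (hK s).trans (expectedPayoff_mono_time hΦ _ _ (by omega))
  | flip v | draw v => exact fun s => Finset.expect_le_expect fun _ _ => hK _
  | _ => exact fun s => hK _

end wp

/-- The weakest preexpectation of a stack of programs. -/
noncomputable def stackWp (W : ℕ) {n : ℕ} (f : Cube n → Bool) (todo : List Prog)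
    (K : Store → ℝ) : Store → ℝ :=
  todo.foldr (fun p => p.wp W f) K

section stackWp
variable {n W : ℕ} {f : Cube n → Bool} {K : Store → ℝ}

theorem stackWp_cons (p : Prog) (r : List Prog) :
    stackWp W f (p :: r) K = p.wp W f (stackWp W f r K) := rfl

theorem stackWp_nonneg (hK : 0 ≤ K) (todo : List Prog) : 0 ≤ stackWp W f todo K := by
  induction todo with
  | nil => exact hK
  | cons p r ih => exact wp_nonneg p ih

theorem stackWp_le_stackWp_succ (hK : 0 ≤ K) (todo : List Prog) :
    stackWp W f todo K ≤ stackWp (W + 1) f todo K := by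
  induction todo with
  | nil => exact le_rfl
  | cons p r ih => exact (wp_le_wp_succ W p (stackWp_nonneg hK r)).trans (wp_mono _ f p ih)

theorem stackWp_unfold_loop_le (hK : 0 ≤ K) (e : Expr) (p : Prog) (r : List Prog) (s : Store) :
    stackWp W f (if (e.eval s).isPair then p :: .loop e p :: r else r) K s ≤
      stackWp (W + 1) f (.loop e p :: r) K s := by
  have hr := stackWp_nonneg (W := W) (f := f) hK r
  rw [stackWp_cons (.loop e p), Prog.wp, loopWp_succ]
  split_ifs
  · refine (wp_le_wp_succ W p (wp_nonneg _ hr) s).trans (wp_mono _ f p ?_ s)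
    exact (loopWp_mono_body (fun _ => wp_nonneg p) (wp_mono _ f p)
      (fun _ => wp_le_wp_succ W p) hr W).trans
        (loopWp_mono_payoff (wp_mono _ f p) W (stackWp_le_stackWp_succ hK r))
  · exact stackWp_le_stackWp_succ hK r s

end stackWp

/-! ### A functional language compiled to deterministic programs -/

/-- Replace every variable of an expression by `b`. -/
def Expr.at (b : ℕ) : Expr → Expr
  | .var _ => .var b
  | .nil => .nil
  | .cons e e' => .cons (e.at b) (e'.at b)
  | .head e => .head (e.at b)
  | .tail e => .tail (e.at b)

theorem Expr.eval_at (b : ℕ) (e : Expr) (s : Store) :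
    (e.at b).eval s = e.eval fun _ => s b := by
  induction e <;> simp_all only [Expr.at, Expr.eval]

/-- Functions on trees. In `prim e` and `cond e F G` every variable of `e` stands for the argument;
`iter F` iterates `F` a number of times that is a global parameter. -/
inductive Fn : Type
  | prim : Expr → Fn
  | comp : Fn → Fn → Fn
  | pair : Fn → Fn → Fn
  | cond : Expr → Fn → Fn → Fn
  | iter : Fn → Fn

/-- The function denoted by a term when `u` is the number of iterations; `comp F G` is `F` followed
by `G`. -/
def Fn.eval (u : ℕ) : Fn → Data → Data
  | .prim e, d => e.eval fun _ => d
  | .comp F G, d => G.eval u (F.eval u d)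
  | .pair F G, d => .cons (F.eval u d) (G.eval u d)
  | .cond e F G, d => if (e.eval fun _ => d).isPair then F.eval u d else G.eval u d
  | .iter F, d => (F.eval u)^[u] d

/-- The program that replaces the value of variable `b` by its image. It uses only variables from
`b` on and reads the number of iterations from variable `w`. -/
def Fn.compile (w : ℕ) : ℕ → Fn → Prog
  | b, .prim e => .assign b (e.at b)
  | b, .comp F G => .seq (F.compile w b) (G.compile w b)
  | b, .pair F G =>
      .seq (.assign (b + 1) (.var b)) (.seq (F.compile w (b + 1)) (.seq (.assign (b + 2) (.var b))
        (.seq (G.compile w (b + 2)) (.assign b (.cons (.var (b + 1)) (.var (b + 2)))))))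
  | b, .cond e F G => .cond (e.at b) (F.compile w b) (G.compile w b)
  | b, .iter F =>
      .seq (.assign (b + 1) (.var b)) (.seq (.assign b (.var w)) (.seq
        (.loop (.var b) (.seq (.assign b (.tail (.var b))) (F.compile w (b + 1))))
        (.assign b (.var (b + 1)))))

theorem Fn.compile_deterministic (w b : ℕ) (F : Fn) : (F.compile w b).Deterministic := by
  induction F generalizing b <;> simp_all only [Fn.compile, Prog.Deterministic, and_self]

theorem Data.ofNat_zero : Data.ofNat 0 = .nil := rfl

theorem Data.ofNat_succ (m : ℕ) : Data.ofNat (m + 1) = .cons .nil (Data.ofNat m) := rfl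

theorem le_loopWp_of_countdown {c : ℕ} {X : (Store → ℝ) → Store → ℝ} {K : Store → ℝ}
    (I : ℕ → Store → Prop) (v : ℕ → ℝ) (hI : ∀ i s, I i s → s c = Data.ofNat i)
    (hstep : ∀ i s m, I (i + 1) s → (∀ s', I i s' → v i ≤ loopWp (.var c) X K m s') →
      v (i + 1) ≤ X (loopWp (.var c) X K m) s)
    (hend : ∀ s, I 0 s → v 0 ≤ K s) {m i : ℕ} (hi : i < m) {s : Store} (hs : I i s) :
    v i ≤ loopWp (.var c) X K m s := by
  induction m generalizing i s with
  | zero => omega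
  | succ m ih =>
    rw [loopWp_succ, Expr.eval, hI _ _ hs]
    rcases i with _ | i
    · exact hend s hs
    · exact hstep i s m hs fun s' hs' => ih (by omega) hs'

/-- The specification of a compiled function: wherever variable `w` holds the number `u`, the
program `p` replaces the value of variable `b` by its image under `G` and does not change the
variables below `b`. The bound `W` on the loops is part of the specification. -/
def Computes {n : ℕ} (W : ℕ) (f : Cube n → Bool) (u w b : ℕ) (p : Prog) (G : Data → Data) : Prop :=
  ∀ ⦃K : Store → ℝ⦄ ⦃s : Store⦄ ⦃v : ℝ⦄, s w = Data.ofNat u →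
    (∀ s', s' b = G (s b) → (∀ x < b, s' x = s x) → v ≤ K s') → v ≤ p.wp W f K s

section Computes
variable {n W u w b : ℕ} {f : Cube n → Bool} {F G : Fn}

theorem computes_compile_comp (hw : w < b) (hF : Computes W f u w b (F.compile w b) (F.eval u))
    (hG : Computes W f u w b (G.compile w b) (G.eval u)) :
    Computes W f u w b ((F.comp G).compile w b) ((F.comp G).eval u) := by
  refine fun K s v hu h => hF hu fun s₁ hb₁ hlt₁ => hG ((hlt₁ _ hw).trans hu) fun s₂ hb₂ hlt₂ =>
    h _ ?_ fun x hx => (hlt₂ x hx).trans (hlt₁ x hx)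
  rw [hb₂, hb₁, Fn.eval]

theorem computes_compile_pair (hw : w < b)
    (hF : Computes W f u w (b + 1) (F.compile w (b + 1)) (F.eval u))
    (hG : Computes W f u w (b + 2) (G.compile w (b + 2)) (G.eval u)) :
    Computes W f u w b ((F.pair G).compile w b) ((F.pair G).eval u) := by
  intro K s v hu h
  refine hF ((Function.update_of_ne (by omega) _ _).trans hu) fun s₁ hb₁ hlt₁ => ?_
  have hs₁ : ∀ x < b + 1, s₁ x = s x := fun x hx => by
    rw [hlt₁ x hx, Function.update_of_ne hx.ne]
  refine hG ?_ fun s₂ hb₂ hlt₂ => h _ ?_ fun x hx => ?_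
  · rw [Function.update_of_ne (by omega), hs₁ _ (by omega), hu]
  · rw [Function.update_self] at hb₁ hb₂ ⊢
    simp only [Expr.eval, Fn.eval] at hb₁ hb₂ ⊢
    rw [hlt₂ (b + 1) (by omega), Function.update_of_ne (by omega), hb₁, hb₂, hs₁ b (by omega)]
  · rw [Function.update_of_ne hx.ne, hlt₂ x (by omega), Function.update_of_ne (by omega),
      hs₁ x (by omega)]

theorem computes_compile_iter (hw : w < b) (hW : u < W)
    (hF : Computes W f u w (b + 1) (F.compile w (b + 1)) (F.eval u)) :
    Computes W f u w b (F.iter.compile w b) (F.iter.eval u) := by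
  intro K s v hu h
  refine le_loopWp_of_countdown (fun i s' => s' b = Data.ofNat i ∧ (∀ x < b, s' x = s x) ∧
    (F.eval u)^[i] (s' (b + 1)) = (F.eval u)^[u] (s b)) (fun _ => v) (fun i s' h => h.1) ?_ ?_ hW ?_
  · rintro i s₁ m ⟨hb, hlt, hiter⟩ hX
    refine hF ?_ fun s₂ hb₂ hlt₂ => hX _ ⟨?_, fun x hx => ?_, ?_⟩
    · rw [Function.update_of_ne (by omega), hlt _ hw, hu]
    · rw [hlt₂ b (by omega), Function.update_self, Expr.eval, Expr.eval, hb]; rfl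
    · rw [hlt₂ x (by omega), Function.update_of_ne hx.ne, hlt x hx]
    · rw [← hiter, hb₂, Function.update_of_ne (by omega)]; rfl
  · rintro s₁ ⟨-, hlt, hiter⟩
    refine h _ ?_ fun x hx => by rw [Function.update_of_ne hx.ne, hlt x hx]
    rw [Function.update_self]; exact hiter
  · refine ⟨?_, fun x hx => ?_, ?_⟩
    · rw [Function.update_self, Expr.eval, Function.update_of_ne (by omega), hu]
    · rw [Function.update_of_ne hx.ne, Function.update_of_ne (by omega)]
    · rw [Function.update_of_ne (by omega), Function.update_self, Expr.eval]

theorem computes_compile (hw : w < b) (hW : u < W) (F : Fn) :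
    Computes W f u w b (F.compile w b) (F.eval u) := by
  induction F generalizing b with
  | prim e =>
    refine fun K s v _ h => h _ ?_ fun x hx => Function.update_of_ne hx.ne _ _
    rw [Function.update_self, Expr.eval_at]; rfl
  | comp F G ihF ihG => exact computes_compile_comp hw (ihF hw) (ihG hw)
  | pair F G ihF ihG => exact computes_compile_pair hw (ihF (by omega)) (ihG (by omega))
  | cond e F G ihF ihG =>
    intro K s v hu h
    simp only [Fn.compile, Prog.wp, Expr.eval_at]
    split_ifs with he
    · exact ihF hw hu fun s' hb hlt => h s' (by rw [hb, Fn.eval, if_pos he]) hlt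
    · exact ihG hw hu fun s' hb hlt => h s' (by rw [hb, Fn.eval, if_neg he]) hlt
  | iter F ih => exact computes_compile_iter hw hW (ih (by omega))

end Computes

/-- The function that applies `F` as often as the `c`-th power of the number of iterations. -/
def Fn.iterPow (F : Fn) : ℕ → Fn
  | 0 => F
  | c + 1 => .iter (F.iterPow c)

theorem Fn.eval_iterPow (u : ℕ) (F : Fn) (c : ℕ) :
    (F.iterPow c).eval u = (F.eval u)^[u ^ c] := by
  induction c with
  | zero => rfl
  | succ c ih => rw [pow_succ, Function.iterate_mul, ← ih]; rfl

/-- Fold over the list in the first component of the argument: as long as it is not empty, the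
argument is replaced by its image under `F`, which has to remove the first element. The list may
have at most `u ^ c` elements, where `u` is the number of iterations. -/
def Fn.fold (c : ℕ) (F : Fn) : Fn :=
  (Fn.cond (.head (.var 0)) F (.prim (.var 0))).iterPow c

theorem Fn.eval_fold {u c : ℕ} {F : Fn} {α β : Type*} (eα : α → Data) (eβ : β → Data)
    (g : α → β → α) (P : List β → α → Prop) (hP : ∀ a b l, P (b :: l) a → P l (g a b))
    (hF : ∀ a b l d, P (b :: l) a →
      F.eval u (.cons (.cons (eβ b) d) (eα a)) = .cons d (eα (g a b)))
    (l : List β) (hl : l.length ≤ u ^ c) (a : α) (ha : P l a) :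
    (Fn.fold c F).eval u (.cons (Data.ofList (l.map eβ)) (eα a)) =
      .cons .nil (eα (l.foldl g a)) := by
  rw [Fn.fold, Fn.eval_iterPow]
  generalize u ^ c = m at hl
  induction m generalizing l a with
  | zero =>
    obtain rfl : l = [] := List.length_eq_zero_iff.mp (Nat.le_zero.mp hl)
    rfl
  | succ m ih =>
    rw [Function.iterate_succ_apply]
    rcases l with _ | ⟨b, l⟩
    · exact ih [] a ha (Nat.zero_le _)
    · rw [List.foldl_cons, ← ih l _ (hP _ _ _ ha) (Nat.le_of_succ_le_succ hl)]
      exact congrArg _ (hF _ _ _ _ ha)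

theorem Fn.eval_fold_nat {u c : ℕ} {F : Fn} {α : Type*} (eα : α → Data) (g : α → α)
    (hF : ∀ a d, F.eval u (.cons (.cons .nil d) (eα a)) = .cons d (eα (g a)))
    (m : ℕ) (hm : m ≤ u ^ c) (a : α) :
    (Fn.fold c F).eval u (.cons (Data.ofNat m) (eα a)) = .cons .nil (eα (g^[m] a)) := by
  rw [Data.ofNat, ← List.map_replicate (f := fun _ : Unit => Data.nil) (a := ()),
    Fn.eval_fold eα _ (fun a _ => g a) (fun _ _ => True) (fun _ _ _ _ => trivial)
      (fun a _ _ d _ => hF a d) _ (by simpa only [List.length_replicate]) a trivial,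
    List.foldl_const, List.length_replicate]

theorem exists_cost_le_pow (p : Prog) (J : ℕ) : ∃ J', ∀ u, 2 ≤ u → p.cost (u ^ J) ≤ u ^ J' := by
  have hadd {a b x y u : ℕ} (hu : 2 ≤ u) (hx : x ≤ u ^ a) (hy : y ≤ u ^ b) :
      x + y + 1 ≤ u ^ (max a b + 2) := by
    have hx' := hx.trans (Nat.pow_le_pow_right (by omega) (le_max_left a b))
    have hy' := hy.trans (Nat.pow_le_pow_right (by omega) (le_max_right a b))
    have hone : 1 ≤ u ^ max a b := Nat.one_le_pow _ _ (by omega)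
    have hfour : 4 ≤ u ^ 2 := Nat.pow_le_pow_left hu 2
    rw [pow_add]
    nlinarith
  induction p with
  | seq p q ihp ihq | cond e p q ihp ihq =>
    obtain ⟨a, ha⟩ := ihp
    obtain ⟨b, hb⟩ := ihq
    exact ⟨max a b + 2, fun u hu => hadd hu (ha u hu) (hb u hu)⟩
  | loop e p ih =>
    obtain ⟨a, ha⟩ := ih
    refine ⟨J + (max a 0 + 2), fun u hu => ?_⟩
    rw [Prog.cost, pow_add]
    exact Nat.mul_le_mul_left _ (hadd hu (ha u hu) (Nat.zero_le _))
  | _ => exact ⟨0, fun _ _ => le_rfl⟩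

/-! ### Hamming balls -/

section Hamming
variable {n : ℕ}

theorem hammingDist_symmDiff_right (x y z : Cube n) :
    hammingDist (x ∆ z) (y ∆ z) = hammingDist x y :=
  hammingDist_comp (fun i => (· ∆ z i)) fun i => symmDiff_left_injective (z i)

theorem hammingDist_symmDiff_self (x z : Cube n) : hammingDist x (x ∆ z) = hammingDist z ⊥ := by
  rw [← hammingDist_symmDiff_right z ⊥ x, hammingDist_comm, bot_symmDiff, symmDiff_comm]

/-- The point `x` with coordinate number `i` changed. -/
def flipAt (x : Cube n) (i : Fin n) : Cube n := Function.update x i (!x i)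

theorem flipAt_flipAt (x : Cube n) (i : Fin n) : flipAt (flipAt x i) i = x := by
  simp [flipAt]

theorem hammingDist_flipAt_le (x : Cube n) (i : Fin n) : hammingDist x (flipAt x i) ≤ 1 := by
  rw [hammingDist, ← Finset.card_singleton i]
  refine Finset.card_le_card fun j hj => ?_
  have hne : x j ≠ flipAt x i j := (Finset.mem_filter.mp hj).2
  by_contra hji
  exact hne (Function.update_of_ne (by simpa using hji) _ _).symm

theorem exists_hammingDist_flipAt_le {k : ℕ} {x y : Cube n} (hxy : x ≠ y)
    (h : hammingDist x y ≤ k + 1) : ∃ i, hammingDist (flipAt x i) y ≤ k := by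
  obtain ⟨i, hi⟩ := Function.ne_iff.mp hxy
  refine ⟨i, Nat.le_of_lt_succ (lt_of_lt_of_le (Finset.card_lt_card ?_) h)⟩
  have hflip : flipAt x i i = y i := by simpa [flipAt] using Bool.eq_not_of_ne (Ne.symm hi) |>.symm
  rw [Finset.ssubset_iff_of_subset]
  · exact ⟨i, by simpa using hi, by simpa using hflip⟩
  · intro j hj
    have hne : flipAt x i j ≠ y j := (Finset.mem_filter.mp hj).2
    rcases eq_or_ne j i with rfl | hji
    · exact absurd hflip hne
    · exact Finset.mem_filter.mpr ⟨Finset.mem_univ j, by simpa [flipAt, hji] using hne⟩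

/-- A point of the set `A` at distance at most `k` from a point, if there is one. -/
def nearest (A : Cube n → Bool) : ℕ → Cube n → Option (Cube n)
  | 0, x => if A x then some x else none
  | k + 1, x =>
      (nearest A k x).or ((List.finRange n).findSome? fun i => nearest A k (flipAt x i))

theorem nearest_eq_some {A : Cube n → Bool} {k : ℕ} {x y : Cube n} (h : nearest A k x = some y) :
    A y ∧ hammingDist x y ≤ k := by
  induction k generalizing x with
  | zero =>
    obtain ⟨hx, rfl⟩ : A x ∧ x = y := by simpa [nearest] using h
    exact ⟨hx, (hammingDist_self x).le⟩
  | succ k ih =>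
    rcases Option.or_eq_some_iff.mp h with hx | ⟨-, hx⟩
    · exact ⟨(ih hx).1, (ih hx).2.trans k.le_succ⟩
    · obtain ⟨i, -, hi⟩ := List.exists_of_findSome?_eq_some hx
      refine ⟨(ih hi).1, (hammingDist_triangle x (flipAt x i) y).trans ?_⟩
      have := (ih hi).2
      have := hammingDist_flipAt_le x i
      omega

theorem isSome_nearest {A : Cube n → Bool} {k : ℕ} {x y : Cube n} (hy : A y)
    (h : hammingDist x y ≤ k) : (nearest A k x).isSome := by
  induction k generalizing x with
  | zero =>
    obtain rfl : x = y := hammingDist_eq_zero.mp (Nat.le_zero.mp h)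
    simp [nearest, hy]
  | succ k ih =>
    rw [nearest, Option.isSome_or, Bool.or_eq_true, List.findSome?_isSome_iff]
    by_cases hxy : x = y
    · exact Or.inl (ih (by simp [hxy]))
    · obtain ⟨i, hi⟩ := exists_hammingDist_flipAt_le hxy h
      exact Or.inr ⟨i, List.mem_finRange i, ih hi⟩

/-- The ball of radius `k` around the origin. -/
def ball (n k : ℕ) : Finset (Cube n) := Finset.univ.filter fun z => hammingDist z ⊥ ≤ k

theorem mem_ball {k : ℕ} {z : Cube n} : z ∈ ball n k ↔ hammingDist z ⊥ ≤ k := by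
  simp [ball]

theorem ball_succ_subset (n k : ℕ) : ball n (k + 1) ⊆ ball n k ∪
    Finset.univ.biUnion fun i : Fin n => (ball n k).image fun z => flipAt z i := by
  intro z hz
  by_cases hz0 : z = ⊥
  · exact Finset.mem_union_left _ (mem_ball.mpr (by simp [hz0]))
  · obtain ⟨i, hi⟩ := exists_hammingDist_flipAt_le hz0 (mem_ball.mp hz)
    exact Finset.mem_union_right _ (Finset.mem_biUnion.mpr ⟨i, Finset.mem_univ _,
      Finset.mem_image.mpr ⟨flipAt z i, mem_ball.mpr hi, flipAt_flipAt z i⟩⟩)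

theorem card_ball_le (n k : ℕ) : (ball n k).card ≤ (n + 1) ^ k := by
  induction k with
  | zero => exact Finset.card_le_one.mpr fun a ha b hb => by simp_all [ball]
  | succ k ih =>
    calc (ball n (k + 1)).card ≤ _ := Finset.card_le_card (ball_succ_subset n k)
      _ ≤ (ball n k).card + ∑ _i : Fin n, (ball n k).card :=
        (Finset.card_union_le _ _).trans (Nat.add_le_add_left
          (Finset.card_biUnion_le.trans (Finset.sum_le_sum fun _ _ => Finset.card_image_le)) _)
      _ = (n + 1) * (ball n k).card := by simp [add_mul, add_comm]
      _ ≤ (n + 1) ^ (k + 1) := by rw [pow_succ']; exact Nat.mul_le_mul_left _ ih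

end Hamming

/-! ### A colouring of the cube whose colour classes are codes -/

/-- The colour of a point: in base `q` its digits are the power sums of order `0, …, d - 1` of the
positions of the ones, counted from `1`. -/
def color (q d : ℕ) {n : ℕ} (x : Cube n) : ℕ :=
  ∑ i : Fin n, if x i then ∑ j ∈ Finset.range d, ((i + 1) * q) ^ j else 0

theorem eq_zero_of_sum_pow_mul_eq_zero {Q : ℤ} {d : ℕ} {p : ℕ → ℤ} (hp : ∀ j < d, |p j| < Q)
    (h : ∑ j ∈ Finset.range d, Q ^ j * p j = 0) : ∀ j < d, p j = 0 := by
  induction d generalizing p with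
  | zero => intro j hj; omega
  | succ d ih =>
    have hQ : 0 < Q := (abs_nonneg _).trans_lt (hp 0 d.succ_pos)
    have hsplit : p 0 + Q * ∑ j ∈ Finset.range d, Q ^ j * p (j + 1) = 0 := by
      rw [← h, Finset.sum_range_succ', Finset.mul_sum, add_comm]
      simp only [pow_succ', mul_assoc, pow_zero, one_mul]
    have hp0 : p 0 = 0 := Int.eq_zero_of_abs_lt_dvd
      (Dvd.intro _ (neg_eq_of_add_eq_zero_right hsplit).symm |>.trans (by simp)) (hp 0 d.succ_pos)
    have htail := ih (p := fun j => p (j + 1)) (fun j hj => hp _ (by omega)) (by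
      simpa [hp0, hQ.ne'] using hsplit)
    rintro (_ | j) hj
    exacts [hp0, htail j (by omega)]

theorem eq_zero_of_sum_mul_pow_eq_zero {R ι : Type*} [CommRing R] [IsDomain R] [Fintype ι]
    [DecidableEq R] {a s : ι → R} (ha : Function.Injective a) {d : ℕ}
    (hs : (Finset.univ.filter fun i => s i ≠ 0).card ≤ d)
    (h : ∀ j < d, ∑ i, s i * a i ^ j = 0) : s = 0 := by
  set D := Finset.univ.filter fun i => s i ≠ 0 with hD
  let e := D.equivFin.symm
  have hvand : (fun j => s (e j)) = 0 := by
    refine Matrix.eq_zero_of_forall_pow_sum_mul_pow_eq_zero (f := fun j => a (e j))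
      (ha.comp (Subtype.val_injective.comp e.injective)) fun j => ?_
    rw [← h j (j.2.trans_le hs), e.sum_comp fun i : D => s i * a i ^ (j : ℕ),
      Finset.sum_coe_sort D fun i => s i * a i ^ (j : ℕ)]
    exact Finset.sum_subset (Finset.subset_univ D) fun i _ hi => by simp_all
  funext i
  by_contra hi
  have hiD : i ∈ D := by simpa [hD] using hi
  exact hi (by simpa [e] using congrFun hvand (D.equivFin ⟨i, hiD⟩))

/-- The set of the points of colour `a`, as a Boolean function. -/
def colorClass (q d a : ℕ) {n : ℕ} (x : Cube n) : Bool := decide (color q d x = a)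

theorem eq_of_color_eq {q d n : ℕ} (hq : n ^ d < q) {x y : Cube n}
    (hcolor : color q d x = color q d y) (hxy : hammingDist x y ≤ d) : x = y := by
  set s : Fin n → ℤ := fun i => (x i).toInt - (y i).toInt with hs
  have hs0 (i : Fin n) : s i = 0 ↔ x i = y i := by
    simp only [hs]; cases x i <;> cases y i <;> simp
  have habs (i : Fin n) : |s i| ≤ 1 := by
    simp only [hs]; cases x i <;> cases y i <;> simp
  have hsum : ∑ j ∈ Finset.range d, (q : ℤ) ^ j * ∑ i : Fin n, s i * ((i : ℤ) + 1) ^ j = 0 := by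
    rw [← sub_eq_zero.mpr (congrArg (Nat.cast : ℕ → ℤ) hcolor)]
    simp only [color, Nat.cast_sum, ← Finset.sum_sub_distrib, Finset.mul_sum]
    rw [Finset.sum_comm]
    refine Finset.sum_congr rfl fun i _ => ?_
    simp only [hs]
    cases x i <;> cases y i <;> simp [mul_pow, mul_comm]
  have hlt (j : ℕ) (hj : j < d) : |∑ i : Fin n, s i * ((i : ℤ) + 1) ^ j| < q := by
    calc |∑ i : Fin n, s i * ((i : ℤ) + 1) ^ j| ≤ ∑ _i : Fin n, (n : ℤ) ^ j := by
          refine (Finset.abs_sum_le_sum_abs _ _).trans (Finset.sum_le_sum fun i _ => ?_)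
          rw [abs_mul, abs_of_nonneg (by positivity : (0 : ℤ) ≤ ((i : ℤ) + 1) ^ j)]
          refine (mul_le_of_le_one_left (by positivity) (habs i)).trans ?_
          gcongr
          omega
      _ = ((n ^ (j + 1) : ℕ) : ℤ) := by simp [pow_succ']
      _ < q := by
        rcases n.eq_zero_or_pos with rfl | hn
        · simpa using hq.pos
        · exact_mod_cast (Nat.pow_le_pow_right hn hj).trans_lt hq
  have hzero : s = 0 := eq_zero_of_sum_mul_pow_eq_zero
    (a := fun i : Fin n => (i : ℤ) + 1) (fun i j hij => by simpa [Fin.ext_iff] using hij)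
    (by simpa only [hammingDist, ne_eq, hs0] using hxy) (eq_zero_of_sum_pow_mul_eq_zero hlt hsum)
  exact funext fun i => (hs0 i).mp (congrFun hzero i)

theorem sum_range_pow_le (b d : ℕ) : ∑ j ∈ Finset.range d, b ^ j ≤ (b + 1) ^ d := by
  induction d with
  | zero => simp
  | succ d ih =>
    rw [geom_sum_succ, pow_succ]
    nlinarith [Nat.one_le_pow d (b + 1) b.succ_pos]

/-- All numbers that occur in the computation of the colours for `q = u ^ e` are at most `u ^ c`. -/
structure ColorBound (u c e d n : ℕ) : Prop where
  dim_le : n ≤ u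
  mul_le : ∀ i ≤ n, i * u ^ e ≤ u ^ c
  weight_le : ∀ i ≤ n, ∑ j ∈ Finset.range d, (i * u ^ e) ^ j ≤ u ^ c
  color_lt : ∀ x : Cube n, color (u ^ e) d x < u ^ c

theorem colorBound {u n : ℕ} (hu : 2 ≤ u) (hn : n ≤ u) (d : ℕ) :
    ColorBound u ((d + 3) * d + 2) (d + 1) d n := by
  have hmul (i : ℕ) (hi : i ≤ n) : i * u ^ (d + 1) ≤ u ^ (d + 2) := by
    rw [pow_succ' u (d + 1)]; exact Nat.mul_le_mul_right _ (hi.trans hn)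
  have hweight (i : ℕ) (hi : i ≤ n) :
      ∑ j ∈ Finset.range d, (i * u ^ (d + 1)) ^ j ≤ u ^ ((d + 3) * d) := by
    refine (sum_range_pow_le _ d).trans ?_
    rw [pow_mul]
    refine Nat.pow_le_pow_left ?_ d
    calc i * u ^ (d + 1) + 1 ≤ u ^ (d + 2) + u ^ (d + 2) :=
          add_le_add (hmul i hi) (Nat.one_le_pow _ _ (by omega))
      _ ≤ u ^ (d + 3) := by rw [pow_succ u (d + 2), ← mul_two]; gcongr
  refine ⟨hn, fun i hi => (hmul i hi).trans ?_, fun i hi => (hweight i hi).trans ?_, fun x => ?_⟩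
  · exact Nat.pow_le_pow_right (by omega) (by nlinarith)
  · exact Nat.pow_le_pow_right (by omega) (by omega)
  · calc color (u ^ (d + 1)) d x ≤ ∑ _i : Fin n, u ^ ((d + 3) * d) := by
          refine Finset.sum_le_sum fun i _ => ?_
          split_ifs
          exacts [hweight _ (by omega), Nat.zero_le _]
      _ = n * u ^ ((d + 3) * d) := by simp
      _ ≤ u * u ^ ((d + 3) * d) := Nat.mul_le_mul_right _ hn
      _ = u ^ ((d + 3) * d + 1) := by ring
      _ < _ := Nat.pow_lt_pow_right (by omega) (by omega)

/-! ### The functions computed by the learner and by its evaluator -/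

/-- The argument without its first `i` components. -/
def Expr.rest : ℕ → Expr
  | 0 => .var 0
  | i + 1 => .tail (Expr.rest i)

/-- Component `i` of the argument. -/
def Expr.arg (i : ℕ) : Expr := .head (Expr.rest i)

/-- The code of the bit `true`. -/
def Expr.one : Expr := .cons .nil .nil

/-- The code of an optional value. -/
def Data.ofOption {α : Type*} (code : α → Data) : Option α → Data
  | none => .nil
  | some a => .cons (code a) .nil

/-- The code of a labeled point. -/
def Data.ofExample {n : ℕ} (e : Cube n × Bool) : Data :=
  .cons (Data.ofPoint e.1) (Data.ofBool e.2)

/-- The code of a list of labeled points. -/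
def Data.ofTable {n : ℕ} (l : List (Cube n × Bool)) : Data := Data.ofList (l.map Data.ofExample)

section Data

@[simp] theorem Data.head_cons (d d' : Data) : (cons d d').head = d := rfl

@[simp] theorem Data.tail_cons (d d' : Data) : (cons d d').tail = d' := rfl

@[simp] theorem Data.isPair_cons (d d' : Data) : (cons d d').isPair = true := rfl

@[simp] theorem Data.head_nil : nil.head = nil := rfl

@[simp] theorem Data.tail_nil : nil.tail = nil := rfl

@[simp] theorem Data.isPair_nil : nil.isPair = false := rfl

@[simp] theorem Data.ofBool_false : ofBool false = nil := rfl

@[simp] theorem Data.ofBool_true : ofBool true = cons nil nil := rfl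

@[simp] theorem Data.ofOption_none {α : Type*} (code : α → Data) : ofOption code none = nil := rfl

@[simp] theorem Data.ofOption_some {α : Type*} (code : α → Data) (a : α) :
    ofOption code (some a) = cons (code a) nil := rfl

@[simp] theorem Data.isPair_ofBool (b : Bool) : (ofBool b).isPair = b := by cases b <;> rfl

theorem Data.ofPoint_eq {n : ℕ} (x : Cube n) :
    Data.ofPoint x = Data.ofList ((List.finRange n).map fun i => Data.ofBool (x i)) := by
  rw [Data.ofPoint, List.ofFn_eq_map]

theorem Data.ofNat_length {α : Type*} (l : List α) :
    Data.ofNat l.length = Data.ofList (l.map fun _ => .nil) := by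
  rw [Data.ofNat, List.map_const']

theorem Data.iterate_cons_ofNat (p q : ℕ) :
    (Data.cons .nil)^[p] (Data.ofNat q) = Data.ofNat (p + q) := by
  induction p with
  | zero => simp
  | succ p ih => rw [Function.iterate_succ_apply', ih, Nat.add_right_comm, Data.ofNat_succ]

theorem Data.head_iterate_tail_ofList {l : List Data} {i : ℕ} (hi : i < l.length) :
    (Data.tail^[i] (Data.ofList l)).head = l[i] := by
  induction l generalizing i with
  | nil => simp at hi
  | cons d l ih =>
    rcases i with _ | i
    · rfl
    · exact ih (by simpa using hi)

theorem Data.toPoint_ofPoint {n : ℕ} (x : Cube n) : Data.toPoint n (Data.ofPoint x) = x := by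
  funext i
  rw [Data.toPoint, Data.ofPoint, Data.head_iterate_tail_ofList (by simp), List.getElem_ofFn,
    Data.isPair_ofBool]

theorem Data.toPoint_nil (n : ℕ) : Data.toPoint n .nil = ⊥ :=
  funext fun i => congrArg (fun d => d.head.isPair)
    (Function.iterate_fixed (f := Data.tail) (x := .nil) rfl i)

theorem Data.toPoint_iterate_cons {n : ℕ} (i : Fin n) :
    Data.toPoint n ((Data.cons .nil)^[i] (.cons (.cons .nil .nil) .nil)) =
      fun j => decide (j = i) := by
  have h (i j : ℕ) : (Data.tail^[j] ((Data.cons .nil)^[i] (.cons (.cons .nil .nil) .nil))).head =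
      Data.ofBool (decide (j = i)) := by
    induction i generalizing j with
    | zero =>
      rcases j with _ | j
      · rfl
      · exact congrArg Data.head (Function.iterate_fixed (f := Data.tail) (x := .nil) rfl j)
    | succ i ih =>
      rw [Function.iterate_succ_apply']
      rcases j with _ | j
      · rfl
      · simpa [Function.iterate_succ_apply] using ih j
  funext j
  simp only [Data.toPoint, h, Data.isPair_ofBool, Fin.ext_iff]

end Data

section Fn
variable {u : ℕ}

open LocalQueries.Expr (arg rest one)
open LocalQueries.Fn (prim comp pair cond fold)

attribute [local simp] Fn.eval Expr.eval arg rest one Data.ofNat_zero Data.ofNat_succ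

/-- Add `u ^ c` to a unary number. -/
def incFn (c : ℕ) : Fn := (prim (.cons .nil (.var 0))).iterPow c

theorem eval_incFn (c m : ℕ) : (incFn c).eval u (Data.ofNat m) = Data.ofNat (u ^ c + m) := by
  rw [incFn, Fn.eval_iterPow, ← Data.iterate_cons_ofNat]
  rfl

/-- `(p, d) ↦ (nil, d)` with `p` empty trees in front of `d`. -/
def addFn (c : ℕ) : Fn := fold c (prim (.cons (.tail (arg 0)) (.cons .nil (rest 1))))

theorem eval_addFn {c p : ℕ} (hp : p ≤ u ^ c) (d : Data) :
    (addFn c).eval u (.cons (Data.ofNat p) d) = .cons .nil ((Data.cons .nil)^[p] d) :=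
  Fn.eval_fold_nat id (Data.cons .nil) (fun _ _ => rfl) p hp d

/-- `(y, (b, a)) ↦ (nil, (b, y * b + a))`. -/
def mulFn (c : ℕ) : Fn :=
  fold c (pair (prim (.tail (arg 0))) (pair (prim (arg 1))
    (comp (prim (.cons (arg 1) (rest 2))) (comp (addFn c) (prim (rest 1))))))

theorem eval_mulFn {c y b : ℕ} (hy : y ≤ u ^ c) (hb : b ≤ u ^ c) (a : ℕ) :
    (mulFn c).eval u (.cons (Data.ofNat y) (.cons (Data.ofNat b) (Data.ofNat a))) =
      .cons .nil (.cons (Data.ofNat b) (Data.ofNat (y * b + a))) := by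
  rw [mulFn, Fn.eval_fold_nat (fun a => .cons (Data.ofNat b) (Data.ofNat a)) (b + ·)
    (fun a d => by simp [eval_addFn hb, Data.iterate_cons_ofNat]) y hy a, add_left_iterate,
    smul_eq_mul]

/-- `(y, b) ↦ (y * b + 1, b)`. -/
def hornerFn (c : ℕ) : Fn :=
  comp (prim (.cons (arg 0) (.cons (rest 1) .nil)))
    (comp (mulFn c) (prim (.cons (.cons .nil (rest 2)) (arg 1))))

theorem eval_hornerFn {c y b : ℕ} (hy : y ≤ u ^ c) (hb : b ≤ u ^ c) :
    (hornerFn c).eval u (.cons (Data.ofNat y) (Data.ofNat b)) =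
      .cons (Data.ofNat (y * b + 1)) (Data.ofNat b) := by
  have hmul := eval_mulFn hy hb 0
  rw [Data.ofNat_zero] at hmul
  simp [hornerFn, hmul]

/-- `F`, applied `d` times. -/
def Fn.times (F : Fn) : ℕ → Fn
  | 0 => prim (.var 0)
  | d + 1 => comp (F.times d) F

/-- The geometric sum `b ↦ 1 + b + ⋯ + b ^ (d - 1)`, by Horner's rule. -/
def geomFn (c d : ℕ) : Fn :=
  comp (prim (.cons .nil (.var 0))) (comp ((hornerFn c).times d) (prim (arg 0)))

theorem eval_geomFn {c b d : ℕ} (hb : b ≤ u ^ c) (hd : ∑ j ∈ Finset.range d, b ^ j ≤ u ^ c) :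
    (geomFn c d).eval u (Data.ofNat b) = Data.ofNat (∑ j ∈ Finset.range d, b ^ j) := by
  have htimes : ((hornerFn c).times d).eval u (.cons .nil (Data.ofNat b)) =
      .cons (Data.ofNat (∑ j ∈ Finset.range d, b ^ j)) (Data.ofNat b) := by
    induction d with
    | zero => rfl
    | succ d ih =>
      have hd' := (Finset.sum_le_sum_of_subset (Finset.range_subset_range.mpr d.le_succ)).trans hd
      rw [Fn.times, Fn.eval, ih hd', eval_hornerFn hd' hb, geom_sum_succ, mul_comm]
  simp [geomFn, htimes]

/-- Remove the first bit of the list in `(l, (i * q, s))`, replace `i` by `i + 1` and, if the bit is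
`1`, add to `s` the geometric sum with base `(i + 1) * q`; here `q = u ^ e`. -/
def colorStep (c e d : ℕ) : Fn :=
  comp (pair (comp (prim (arg 1)) (incFn e)) (prim (.var 0)))
    (cond (.head (arg 1))
      (pair (prim (.tail (arg 1))) (pair (prim (arg 0))
        (comp (pair (comp (prim (arg 0)) (geomFn c d)) (prim (rest 3)))
          (comp (addFn c) (prim (rest 1))))))
      (prim (.cons (.tail (arg 1)) (.cons (arg 0) (rest 3)))))

theorem eval_colorStep {c e d i : ℕ} (hi : (i + 1) * u ^ e ≤ u ^ c)
    (hw : ∑ j ∈ Finset.range d, ((i + 1) * u ^ e) ^ j ≤ u ^ c) (b : Bool) (l : Data) (s : ℕ) :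
    (colorStep c e d).eval u
        (.cons (.cons (Data.ofBool b) l) (.cons (Data.ofNat (i * u ^ e)) (Data.ofNat s))) =
      .cons l (.cons (Data.ofNat ((i + 1) * u ^ e))
        (Data.ofNat ((if b then ∑ j ∈ Finset.range d, ((i + 1) * u ^ e) ^ j else 0) + s))) := by
  have hinc : u ^ e + i * u ^ e = (i + 1) * u ^ e := by ring
  cases b <;> simp [colorStep, eval_incFn, hinc, eval_geomFn hi hw, eval_addFn hw,
    Data.iterate_cons_ofNat]

/-- The code of a point is mapped to its colour for `q = u ^ e`. -/
def colorFn (c e d : ℕ) : Fn :=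
  comp (prim (.cons (.var 0) (.cons .nil .nil))) (comp (fold 1 (colorStep c e d)) (prim (rest 2)))

theorem eval_colorFn {c e d n : ℕ} (h : ColorBound u c e d n) (x : Cube n) :
    (colorFn c e d).eval u (Data.ofPoint x) = Data.ofNat (color (u ^ e) d x) := by
  let w (i : Fin n) : ℕ := if x i then ∑ j ∈ Finset.range d, ((i + 1) * u ^ e) ^ j else 0
  let g (a : ℕ × ℕ) (i : Fin n) : ℕ × ℕ := (i + 1, w i + a.2)
  have hsum (l : List (Fin n)) (a : ℕ × ℕ) : (l.foldl g a).2 = (l.map w).sum + a.2 := by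
    induction l generalizing a with
    | nil => simp
    | cons i l ih => rw [List.foldl_cons, ih, List.map_cons, List.sum_cons]; ring
  have hfold := Fn.eval_fold (u := u) (c := 1) (F := colorStep c e d)
    (fun a : ℕ × ℕ => .cons (Data.ofNat (a.1 * u ^ e)) (Data.ofNat a.2))
    (fun i => Data.ofBool (x i)) g (fun l a => l.map Fin.val = List.range' a.1 l.length)
    (fun a i l hl => by simp_all [List.range'_succ, g]) (fun a i l d' hl => by
      obtain ⟨m, s⟩ := a
      obtain rfl : (i : ℕ) = m := by simp_all [List.range'_succ]
      exact eval_colorStep (h.mul_le _ i.2) (h.weight_le _ i.2) _ _ _)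
    (List.finRange n) (by simpa using h.dim_le) (0, 0) (by simp [List.range_eq_range'])
  rw [zero_mul, ← Data.ofPoint_eq, Data.ofNat_zero] at hfold
  simp only [colorFn, Fn.eval, Expr.eval]
  rw [hfold]
  simp [hsum, color, w, Fin.sum_univ_def]

/-- Remove an element from each of the lists in `(p, (q, b))`; if `q` is already empty, set `b`. -/
def eqStep : Fn :=
  cond (arg 1) (prim (.cons (.tail (arg 0)) (.cons (.tail (arg 1)) (rest 2))))
    (prim (.cons (.tail (arg 0)) (.cons .nil one)))

/-- `(p, (q, nil))` is mapped to the code of the bit `p = q`. -/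
def eqFn (c : ℕ) : Fn :=
  comp (fold c eqStep) (cond (rest 2) (prim .nil) (cond (arg 1) (prim .nil) (prim one)))

theorem eval_eqFn {c p : ℕ} (hp : p ≤ u ^ c) (q : ℕ) :
    (eqFn c).eval u (.cons (Data.ofNat p) (.cons (Data.ofNat q) .nil)) =
      Data.ofBool (decide (p = q)) := by
  let g (a : ℕ × Bool) : ℕ × Bool := (a.1 - 1, a.1 == 0 || a.2)
  have hiter : g^[p] (q, false) = (q - p, decide (q < p)) := by
    clear hp
    induction p with
    | zero => rfl
    | succ p ih =>
      rw [Function.iterate_succ_apply', ih]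
      refine Prod.ext (Nat.sub_sub _ _ _) (Bool.eq_iff_iff.mpr ?_)
      simp only [g, Bool.or_eq_true, beq_iff_eq, decide_eq_true_eq]
      omega
  have hfold := Fn.eval_fold_nat (u := u) (c := c) (F := eqStep)
    (fun a : ℕ × Bool => .cons (Data.ofNat a.1) (Data.ofBool a.2)) g (fun a d => by
      rcases a with ⟨_ | q, b⟩ <;> simp [eqStep, g]) p hp (q, false)
  rw [hiter] at hfold
  rw [eqFn, Fn.eval, show Data.nil = Data.ofBool false from rfl, hfold]
  rcases lt_trichotomy p q with h | rfl | h
  · obtain ⟨m, hm⟩ : ∃ m, q - p = m + 1 := ⟨q - p - 1, by omega⟩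
    simp [hm, h.ne, h.not_gt]
  · simp
  · simp [h, h.ne']

/-- `(x, (n, a))` is mapped to the code of the test whether `x` has colour `a`. -/
def testFn (c e d : ℕ) : Fn :=
  comp (pair (comp (prim (arg 0)) (colorFn c e d)) (prim (.cons (rest 2) .nil))) (eqFn c)

theorem eval_testFn {c e d n : ℕ} (h : ColorBound u c e d n) (x : Cube n) (a : ℕ) (m : Data) :
    (testFn c e d).eval u (.cons (Data.ofPoint x) (.cons m (Data.ofNat a))) =
      Data.ofBool (colorClass (u ^ e) d a x) := by
  simp [testFn, colorClass, eval_colorFn h, eval_eqFn (h.color_lt x).le]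

/-- Reversal of a list. -/
def revFn : Fn :=
  comp (prim (.cons (.var 0) .nil))
    (comp (fold 1 (prim (.cons (.tail (arg 0)) (.cons (.head (arg 0)) (rest 1))))) (prim (rest 1)))

theorem eval_revFn (l : List Data) (hl : l.length ≤ u) :
    revFn.eval u (Data.ofList l) = Data.ofList l.reverse := by
  have hfold := Fn.eval_fold (u := u) (c := 1)
    (F := prim (.cons (.tail (arg 0)) (.cons (.head (arg 0)) (rest 1)))) Data.ofList id
    (fun a b => b :: a) (fun _ _ => True) (fun _ _ _ _ => trivial) (fun _ _ _ _ _ => rfl) l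
    (by simpa using hl) [] trivial
  rw [List.map_id] at hfold
  simp only [revFn, Fn.eval, Expr.eval]
  rw [show Data.nil = Data.ofList [] from rfl, hfold]
  simp

/-- The parity of three bits, passed to one of two functions. -/
def parityFn (e e' e'' : Expr) (F G : Fn) : Fn :=
  cond e (cond e' (cond e'' F G) (cond e'' G F)) (cond e' (cond e'' G F) (cond e'' F G))

theorem eval_parityFn (e e' e'' : Expr) (F G : Fn) (d : Data) :
    (parityFn e e' e'' F G).eval u d = if xor (xor (e.eval fun _ => d).isPair
      (e'.eval fun _ => d).isPair) (e''.eval fun _ => d).isPair then F.eval u d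
      else G.eval u d := by
  simp only [parityFn, Fn.eval]
  cases (e.eval fun _ => d).isPair <;> cases (e'.eval fun _ => d).isPair <;>
    cases (e''.eval fun _ => d).isPair <;> rfl

/-- Remove an element from each of the lists in `(m, (x, (y, (z, l))))`, and put the sum of the bits
removed from `x`, `y` and `z` in front of `l`. -/
def xorStep : Fn :=
  parityFn (.head (arg 1)) (.head (arg 2)) (.head (arg 3))
    (prim (.cons (.tail (arg 0)) (.cons (.tail (arg 1)) (.cons (.tail (arg 2))
      (.cons (.tail (arg 3)) (.cons one (rest 4)))))))
    (prim (.cons (.tail (arg 0)) (.cons (.tail (arg 1)) (.cons (.tail (arg 2))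
      (.cons (.tail (arg 3)) (.cons .nil (rest 4)))))))

/-- `(n, (x, (y, z)))` is mapped to the sum of the points coded by `x`, `y` and `z`. -/
def xorFn : Fn :=
  comp (prim (.cons (arg 0) (.cons (arg 1) (.cons (arg 2) (.cons (rest 3) .nil)))))
    (comp (fold 1 xorStep) (comp (prim (rest 4)) revFn))

theorem eval_xorFn {n : ℕ} (hn : n ≤ u) (x y z : Data) :
    xorFn.eval u (.cons (Data.ofNat n) (.cons x (.cons y z))) =
      Data.ofPoint (Data.toPoint n x ∆ Data.toPoint n y ∆ Data.toPoint n z) := by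
  let bit (x y z : Data) : Data :=
    Data.ofBool (xor (xor x.head.isPair y.head.isPair) z.head.isPair)
  let g (a : Data × Data × Data × List Data) : Data × Data × Data × List Data :=
    (a.1.tail, a.2.1.tail, a.2.2.1.tail, bit a.1 a.2.1 a.2.2.1 :: a.2.2.2)
  have hiter (i : ℕ) : g^[i] (x, y, z, []) = (Data.tail^[i] x, Data.tail^[i] y, Data.tail^[i] z,
      ((List.range i).map fun i =>
        bit (Data.tail^[i] x) (Data.tail^[i] y) (Data.tail^[i] z)).reverse) := by
    induction i with
    | zero => rfl
    | succ i ih =>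
      rw [Function.iterate_succ_apply', ih]
      simp only [g, ← Function.iterate_succ_apply', List.range_succ, List.map_append,
        List.reverse_append]
      rfl
  have hfold := Fn.eval_fold_nat (u := u) (c := 1) (F := xorStep)
    (fun a : Data × Data × Data × List Data =>
      .cons a.1 (.cons a.2.1 (.cons a.2.2.1 (Data.ofList a.2.2.2)))) g (fun a d => by
        simp only [xorStep, eval_parityFn, g, bit, Data.ofList, arg, rest, Expr.eval,
          Data.head_cons, Data.tail_cons]
        split_ifs with h
        · simp only [h]
          rfl
        · simp only [Bool.eq_false_of_not_eq_true h]
          rfl) n (by simpa using hn) (x, y, z, [])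
  rw [hiter, Data.ofList] at hfold
  simp only [xorFn, Fn.eval, Expr.eval, arg, rest, Data.head, Data.tail, hfold]
  rw [eval_revFn _ (by simpa using hn), List.reverse_reverse, Data.ofPoint]
  refine congrArg _ (List.ext_getElem (by simp) fun i hi hi' => ?_)
  simp [bit, Data.toPoint]

/-- Remove a bit from each of the lists in `(x, (y, b))`; if these bits differ, set `b`. -/
def neStep : Fn :=
  cond (.head (arg 0))
    (cond (.head (arg 1)) (prim (.cons (.tail (arg 0)) (.cons (.tail (arg 1)) (rest 2))))
      (prim (.cons (.tail (arg 0)) (.cons (.tail (arg 1)) one))))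
    (cond (.head (arg 1)) (prim (.cons (.tail (arg 0)) (.cons (.tail (arg 1)) one)))
      (prim (.cons (.tail (arg 0)) (.cons (.tail (arg 1)) (rest 2)))))

/-- The code of the test whether two points, coded as `(x, (y, nil))`, are different. -/
def neFn : Fn := comp (fold 1 neStep) (prim (rest 2))

theorem eval_neFn {n : ℕ} (hn : n ≤ u) (x y : Cube n) :
    neFn.eval u (.cons (Data.ofPoint x) (.cons (Data.ofPoint y) .nil)) =
      Data.ofBool (decide (x ≠ y)) := by
  let g (a : List (Fin n) × Bool) (i : Fin n) : List (Fin n) × Bool :=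
    (a.1.tail, a.2 || x i != y i)
  have hany (l : List (Fin n)) (a : List (Fin n) × Bool) :
      (l.foldl g a).2 = (a.2 || l.any fun i => x i != y i) := by
    induction l generalizing a with
    | nil => simp
    | cons i l ih => rw [List.foldl_cons, ih, List.any_cons, Bool.or_assoc]
  have hfold := Fn.eval_fold (u := u) (c := 1) (F := neStep)
    (fun a : List (Fin n) × Bool =>
      .cons (Data.ofList (a.1.map fun i => Data.ofBool (y i))) (Data.ofBool a.2))
    (fun i => Data.ofBool (x i)) g (fun l a => a.1 = l) (fun a i l ha => by simp [g, ha])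
    (fun a i l d ha => by
      cases hx : x i <;> cases hy : y i <;> simp [neStep, g, ha, hx, hy, Data.ofList])
    (List.finRange n) (by simpa using hn) (List.finRange n, false) rfl
  rw [← Data.ofPoint_eq, ← Data.ofPoint_eq] at hfold
  rw [neFn, Fn.eval, show Data.nil = Data.ofBool false from rfl, hfold, hany]
  refine congrArg Data.ofBool (Bool.eq_iff_iff.mpr ?_)
  simp [Function.ne_iff]

/-- In `(l, (r, x))`, remove the first labeled point from the table `l`, and make its label the
result `r` if `r` is still empty and the point is `x`. -/
def lookupStep : Fn :=
  cond (arg 1) (prim (.cons (.tail (arg 0)) (rest 1)))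
    (comp (pair (comp (prim (.cons (rest 2) (.cons (.head (.head (arg 0))) .nil))) neFn)
        (prim (.var 0)))
      (cond (arg 0) (prim (.cons (.tail (arg 1)) (rest 2)))
        (prim (.cons (.tail (arg 1)) (.cons (.cons (.tail (.head (arg 1))) .nil) (rest 3))))))

/-- A table and a point, `(l, x)`, are mapped to the label of `x` in `l`. -/
def lookupFn (c : ℕ) : Fn :=
  comp (prim (.cons (arg 0) (.cons .nil (rest 1)))) (comp (fold c lookupStep) (prim (arg 1)))

theorem eval_lookupFn {n c : ℕ} (hn : n ≤ u) (l : List (Cube n × Bool)) (hl : l.length ≤ u ^ c)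
    (x : Cube n) : (lookupFn c).eval u (.cons (Data.ofTable l) (Data.ofPoint x)) =
      Data.ofOption Data.ofBool (l.lookup x) := by
  let g (r : Option Bool) (e : Cube n × Bool) : Option Bool :=
    r.or (if x = e.1 then some e.2 else none)
  have hlookup (l : List (Cube n × Bool)) (r : Option Bool) :
      l.foldl g r = r.or (l.lookup x) := by
    induction l generalizing r with
    | nil => simp
    | cons e l ih =>
      rw [List.foldl_cons, ih]
      cases r <;> by_cases hx : x = e.1 <;> simp [g, hx, List.lookup, beq_eq_false_iff_ne.mpr]
  have hfold := Fn.eval_fold (u := u) (c := c) (F := lookupStep)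
    (fun r => .cons (Data.ofOption Data.ofBool r) (Data.ofPoint x)) Data.ofExample g
    (fun _ _ => True) (fun _ _ _ _ => trivial) (fun r e _ d _ => by
      have hne := eval_neFn hn x e.1
      rcases r with _ | b <;> by_cases hx : x = e.1 <;>
        simp_all [lookupStep, g, Data.ofExample]) l hl none trivial
  rw [hlookup, Option.none_or, ← Data.ofTable, Data.ofOption] at hfold
  simp [lookupFn, hfold]

/-- `(p, d)` is mapped to the tail of order `p` of `d`. -/
def dropFn (c : ℕ) : Fn :=
  comp (fold c (prim (.cons (.tail (arg 0)) (.tail (rest 1))))) (prim (rest 1))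

theorem eval_dropFn {c p : ℕ} (hp : p ≤ u ^ c) (d : Data) :
    (dropFn c).eval u (.cons (Data.ofNat p) d) = Data.tail^[p] d := by
  have hfold := Fn.eval_fold_nat (u := u) (c := c)
    (F := prim (.cons (.tail (arg 0)) (.tail (rest 1)))) id Data.tail (fun _ _ => rfl) p hp d
  rw [dropFn, Fn.eval, ← id_eq d, hfold]
  rfl

/-- `(m, (i, (r, (x, (n, a)))))` is mapped to the point `x` with coordinate number `i` changed. -/
def flipFn : Fn :=
  comp (pair (prim (arg 4)) (pair (prim (arg 3))
    (pair (comp (prim (.cons (arg 1) (.cons one .nil))) (comp (addFn 1) (prim (rest 1))))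
      (prim .nil)))) xorFn

theorem eval_flipFn {n : ℕ} (hn : n ≤ u) (x : Cube n) (i : Fin n) (m r a : Data) :
    flipFn.eval u (.cons m (.cons (Data.ofNat i) (.cons r (.cons (Data.ofPoint x)
      (.cons (Data.ofNat n) a))))) = Data.ofPoint (flipAt x i) := by
  have hflip : x ∆ (fun j => decide (j = i)) = flipAt x i := by
    funext j
    rcases eq_or_ne j i with rfl | hji <;> simp [flipAt, *]
  have hi : (i : ℕ) ≤ u ^ 1 := by simpa using i.2.le.trans hn
  simp [flipFn, eval_addFn hi, eval_xorFn hn, Data.toPoint_ofPoint, Data.toPoint_iterate_cons,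
    Data.toPoint_nil, hflip]

/-- Remove an element from the list `m` in `(m, (i, (r, (x, (n, a)))))`, replace `i` by `i + 1` and,
if the result `r` is still empty, replace it by the result of `F` for the point `x` with coordinate
number `i` changed. -/
def nearStep (F : Fn) : Fn :=
  pair (prim (.tail (arg 0))) (pair (prim (.cons .nil (arg 1)))
    (pair (cond (arg 2) (prim (arg 2)) (comp (pair flipFn (prim (rest 4))) F)) (prim (rest 3))))

/-- `(x, (n, a))` is mapped to a point of colour `a` near `x`, if there is one. -/
def nearFn (c e d : ℕ) : ℕ → Fn
  | 0 => comp (pair (testFn c e d) (prim (.var 0)))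
      (cond (arg 0) (prim (.cons (arg 1) .nil)) (prim .nil))
  | k + 1 =>
    comp (pair (prim (arg 1)) (pair (prim .nil) (pair (nearFn c e d k) (prim (.var 0)))))
      (comp (fold 1 (nearStep (nearFn c e d k))) (prim (arg 2)))

theorem eval_fold_nearStep {n : ℕ} (hn : n ≤ u) {F : Fn} {N : Cube n → Option (Cube n)} {a : Data}
    (hF : ∀ x, F.eval u (.cons (Data.ofPoint x) (.cons (Data.ofNat n) a)) =
      Data.ofOption Data.ofPoint (N x)) (x : Cube n) (r : Option (Cube n)) :
    (comp (fold 1 (nearStep F)) (prim (arg 2))).eval u (.cons (Data.ofNat n) (.cons .nil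
      (.cons (Data.ofOption Data.ofPoint r) (.cons (Data.ofPoint x) (.cons (Data.ofNat n) a))))) =
      Data.ofOption Data.ofPoint (r.or ((List.finRange n).findSome? fun i => N (flipAt x i))) := by
  let g (s : ℕ × Option (Cube n)) (i : Fin n) : ℕ × Option (Cube n) :=
    (i + 1, s.2.or (N (flipAt x i)))
  have hfind (l : List (Fin n)) (s : ℕ × Option (Cube n)) :
      (l.foldl g s).2 = s.2.or (l.findSome? fun i => N (flipAt x i)) := by
    induction l generalizing s with
    | nil => simp
    | cons i l ih =>
      rw [List.foldl_cons, ih, List.findSome?_cons, Option.or_assoc]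
      cases N (flipAt x i) <;> simp
  have hfold := Fn.eval_fold (u := u) (c := 1) (F := nearStep F)
    (fun s : ℕ × Option (Cube n) => .cons (Data.ofNat s.1) (.cons (Data.ofOption Data.ofPoint s.2)
      (.cons (Data.ofPoint x) (.cons (Data.ofNat n) a))))
    (fun _ => .nil) g (fun l s => l.map Fin.val = List.range' s.1 l.length)
    (fun s i l hl => by simp_all [List.range'_succ, g]) (fun s i l d hl => by
      obtain ⟨m, r⟩ := s
      obtain rfl : (i : ℕ) = m := by simp_all [List.range'_succ]
      cases r <;> simp [nearStep, g, eval_flipFn hn, hF])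
    (List.finRange n) (by simpa using hn) (0, r) (by simp [List.range_eq_range'])
  rw [← Data.ofNat_length, List.length_finRange, Data.ofNat_zero] at hfold
  simp [Fn.eval, hfold, hfind]

theorem eval_nearFn {c e d n : ℕ} (h : ColorBound u c e d n) (a k : ℕ) (x : Cube n) :
    (nearFn c e d k).eval u (.cons (Data.ofPoint x) (.cons (Data.ofNat n) (Data.ofNat a))) =
      Data.ofOption Data.ofPoint (nearest (colorClass (u ^ e) d a) k x) := by
  induction k generalizing x with
  | zero =>
    cases hx : colorClass (u ^ e) d a x <;> simp [nearFn, eval_testFn h, hx, nearest]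
  | succ k ih =>
    rw [nearest, ← eval_fold_nearStep h.dim_le ih, ← ih x]
    rfl

end Fn

/-! ### A uniform point whose label is known near a sparse set -/

theorem mul_one_sub_pow_le {p : ℝ} (h0 : 0 ≤ p) (h1 : p ≤ 1) (R : ℕ) :
    p * (1 - p) ^ R ≤ 1 / (R + 1) := by
  have hgeom : p * ∑ j ∈ Finset.range (R + 1), (1 - p) ^ j = 1 - (1 - p) ^ (R + 1) := by
    simpa using mul_neg_geom_sum (1 - p) (R + 1)
  have hsum : (R + 1) * (1 - p) ^ R ≤ ∑ j ∈ Finset.range (R + 1), (1 - p) ^ j := by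
    have h := Finset.card_nsmul_le_sum (Finset.range (R + 1)) (fun j => (1 - p) ^ j)
      ((1 - p) ^ R) fun j hj => pow_le_pow_of_le_one (sub_nonneg.mpr h1) (sub_le_self 1 h0)
        (Finset.mem_range_succ_iff.mp hj)
    simpa using h
  rw [le_div_iff₀ (by positivity)]
  calc p * (1 - p) ^ R * (R + 1) = p * ((R + 1) * (1 - p) ^ R) := by ring
    _ ≤ 1 - (1 - p) ^ (R + 1) := hgeom ▸ mul_le_mul_of_nonneg_left hsum h0
    _ ≤ 1 := sub_le_self 1 (pow_nonneg (sub_nonneg.mpr h1) _)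

section expectFirst
variable {α : Type*} [Fintype α] {A : α → Bool}

/-- The expectation of `κ` at the first point of `A` in a sequence of `R` independent uniform
points, or at `none` if there is no point of `A` in the sequence. -/
noncomputable def expectFirst (A : α → Bool) (κ : Option α → ℝ) : ℕ → ℝ
  | 0 => κ none
  | R + 1 => 𝔼 w, if A w then κ (some w) else expectFirst A κ R

theorem expectFirst_mono {κ κ' : Option α → ℝ} (h0 : κ none ≤ κ' none)
    (h : ∀ z, A z → κ (some z) ≤ κ' (some z)) (R : ℕ) :
    expectFirst A κ R ≤ expectFirst A κ' R := by
  induction R with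
  | zero => exact h0
  | succ R ih =>
    refine Finset.expect_le_expect fun w _ => ?_
    split_ifs with hw
    exacts [h w hw, ih]

theorem expectFirst_const_mul (v : ℝ) (κ : Option α → ℝ) (R : ℕ) :
    expectFirst A (fun o => v * κ o) R = v * expectFirst A κ R := by
  induction R with
  | zero => rfl
  | succ R ih => simp only [expectFirst, ih, Finset.mul_expect, mul_ite]

theorem le_expectFirst [Nonempty α] {κ : Option α → ℝ} {v : ℝ} (h : ∀ o, v ≤ κ o) (R : ℕ) :
    v ≤ expectFirst A κ R := by
  induction R with
  | zero => exact h none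
  | succ R ih =>
    refine Finset.le_expect Finset.univ_nonempty fun w _ => ?_
    split_ifs
    exacts [h _, ih]

/-- The probability that a uniform point lies in `A`. -/
noncomputable def density (A : α → Bool) : ℝ := 𝔼 w, if A w then 1 else 0

theorem density_mul_expectFirst [Nonempty α] (F : α → ℝ) (R : ℕ) :
    density A * expectFirst A (fun o => o.elim 0 F) R =
      (𝔼 w, if A w then F w else 0) * (1 - (1 - density A) ^ R) := by
  induction R with
  | zero => simp [expectFirst]
  | succ R ih =>
    set q := expectFirst A (fun o => o.elim 0 F) R with hq
    have hrec : expectFirst A (fun o => o.elim 0 F) (R + 1) =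
        (𝔼 w, if A w then F w else 0) + (q - q * density A) := by
      nth_rw 1 [density, ← Fintype.expect_const (ι := α) q]
      rw [Finset.mul_expect, ← Finset.expect_sub_distrib, ← Finset.expect_add_distrib]
      refine Finset.expect_congr rfl fun w _ => ?_
      split_ifs <;> simp [hq]
    rw [hrec]
    linear_combination (1 - density A) * ih

theorem le_density_mul_expectFirst [Nonempty α] {F : α → ℝ} (hF : F ≤ 1) (R : ℕ) :
    (𝔼 w, if A w then F w else 0) - 1 / (R + 1) ≤
      density A * expectFirst A (fun o => o.elim 0 F) R := by
  have hp0 : 0 ≤ density A := Finset.expect_nonneg fun w _ => by split_ifs <;> norm_num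
  have hp1 : density A ≤ 1 :=
    Finset.expect_le Finset.univ_nonempty fun w _ => by split_ifs <;> norm_num
  have hα : (𝔼 w, if A w then F w else 0) ≤ density A := Finset.expect_le_expect fun w _ => by
    split_ifs
    exacts [hF w, le_rfl]
  have hmiss := mul_le_mul_of_nonneg_right hα (pow_nonneg (sub_nonneg.mpr hp1) R)
  rw [density_mul_expectFirst]
  linarith [mul_one_sub_pow_le hp0 hp1 R]

end expectFirst

section Sparse
variable {n : ℕ} {A : Cube n → Bool} {k : ℕ}

/-- Every ball of radius `k` contains at most one point of `A`. -/
def Sparse (A : Cube n → Bool) (k : ℕ) : Prop :=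
  ∀ x y z, A y → A z → hammingDist x y ≤ k → hammingDist x z ≤ k → y = z

theorem elim_nearest_eq_add_sum (hA : Sparse A k) (x : Cube n) (a : ℝ) (G : Cube n → ℝ) :
    (nearest A k x).elim a (fun y => G (x ∆ y)) = (nearest A k x).elim a (fun _ => 0) +
      ∑ e ∈ ball n k, if A (x ∆ e) then G e else 0 := by
  have hdist {e : Cube n} (he : e ∈ ball n k) : hammingDist x (x ∆ e) ≤ k := by
    rwa [hammingDist_symmDiff_self, ← mem_ball]
  rcases hx : nearest A k x with _ | y
  · have hfar (e : Cube n) (he : e ∈ ball n k) : ¬A (x ∆ e) := fun hAe => by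
      simpa [hx] using isSome_nearest hAe (hdist he)
    simp [Finset.sum_congr rfl fun e he => if_neg (hfar e he)]
  · obtain ⟨hy, hxy⟩ := nearest_eq_some hx
    have hball : x ∆ y ∈ ball n k := by
      rwa [mem_ball, ← hammingDist_symmDiff_self x, symmDiff_symmDiff_cancel_left]
    rw [Finset.sum_eq_single_of_mem _ hball, symmDiff_symmDiff_cancel_left, if_pos hy]
    · simp
    · refine fun e he hne => if_neg fun hAe => hne ?_
      rw [hA x y _ hy hAe hxy (hdist he), symmDiff_symmDiff_cancel_left]

theorem expect_symmDiff (e : Cube n) (F : Cube n → ℝ) : 𝔼 x, F (x ∆ e) = 𝔼 x, F x :=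
  Fintype.expect_bijective _ (symmDiff_left_involutive e).bijective _ _ fun _ => rfl

/-- Given `x ∆ y = e`, both `x` and `x ∆ y ∆ z` are uniform in the translate of `A` by `e`. -/
theorem expect_sub_le_expect_nearest (hA : Sparse A k) {F : Cube n → ℝ} (hF : F ≤ 1) (R : ℕ) :
    𝔼 x, F x - (n + 1) ^ k / (R + 1) ≤ 𝔼 x, (nearest A k x).elim (F x) fun y =>
      expectFirst A (fun o => o.elim 0 fun z => F (x ∆ y ∆ z)) R := by
  set G : Cube n → ℝ := fun e => expectFirst A (fun o => o.elim 0 fun z => F (e ∆ z)) R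
  have hsplit (x : Cube n) : F x = (nearest A k x).elim (F x) (fun _ => 0) +
      ∑ e ∈ ball n k, if A (x ∆ e) then F x else 0 := by
    rw [← elim_nearest_eq_add_sum hA x (F x) fun _ => F x]
    cases nearest A k x <;> rfl
  have hshift (e : Cube n) : (𝔼 x, if A (x ∆ e) then F x else 0) - 1 / (R + 1) ≤
      𝔼 x, if A (x ∆ e) then G e else 0 := by
    have hF' : (𝔼 x, if A (x ∆ e) then F x else 0) = 𝔼 z, if A z then F (e ∆ z) else 0 := by
      rw [← expect_symmDiff e]
      simp only [symmDiff_comm _ e, symmDiff_symmDiff_cancel_left]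
    have hG : (𝔼 x, if A (x ∆ e) then G e else 0) = density A * G e := by
      rw [density, Finset.expect_mul, expect_symmDiff e fun w => if A w then G e else 0]
      simp only [ite_mul, one_mul, zero_mul]
    rw [hF', hG]
    exact le_density_mul_expectFirst (F := fun z => F (e ∆ z)) (fun z => hF _) R
  have hsum := Finset.sum_le_sum fun e (_ : e ∈ ball n k) => hshift e
  have hball : ((ball n k).card : ℝ) * (1 / (R + 1)) ≤ (n + 1) ^ k / (R + 1) := by
    rw [mul_one_div]
    gcongr
    exact_mod_cast card_ball_le n k
  rw [Finset.sum_sub_distrib, Finset.sum_const, nsmul_eq_mul] at hsum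
  rw [Finset.expect_congr rfl fun x _ => hsplit x,
    Finset.expect_congr rfl fun x _ => elim_nearest_eq_add_sum hA x (F x) G,
    Finset.expect_add_distrib, Finset.expect_add_distrib, Finset.expect_sum_comm,
    Finset.expect_sum_comm]
  linarith

end Sparse

/-! ### Runs with simulated examples and queries -/

theorem one_le_of_one_le_expect {α : Type*} [Fintype α] {F : α → ℝ} (hF : F ≤ 1)
    (h : 1 ≤ 𝔼 x, F x) (x : α) : 1 ≤ F x := by
  by_contra! hx
  exact h.not_gt (Finset.expect_lt (fun y _ => hF y) ⟨x, Finset.mem_univ x, hx⟩)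

theorem expect_update {ι β : Type*} [Fintype ι] [DecidableEq ι] [Fintype β] [Nonempty β] (x : ι)
    (H : (ι → β) → ℝ) : 𝔼 b, 𝔼 r, H (Function.update r x b) = 𝔼 r, H r := by
  set e := Equiv.funSplitAt x β
  have hupdate (b : β) (r : ι → β) : Function.update r x b = e.symm (b, (e r).2) := by
    rw [Equiv.eq_symm_apply]
    ext i
    · simp [e]
    · simp [e, i.2]
  simp only [hupdate]
  rw [Fintype.expect_equiv e H (fun p => H (e.symm p)) (by simp), ← Finset.univ_product_univ,
    Finset.expect_product]
  refine Finset.expect_congr rfl fun b _ => ?_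
  rw [Fintype.expect_equiv e _ (fun p => H (e.symm (b, p.2))) fun r => rfl,
    ← Finset.univ_product_univ, Finset.expect_product]
  exact Fintype.expect_const (ι := β) (𝔼 r, H (e.symm (b, r)))

theorem lookup_cons_of_ne {α β : Type*} [BEq α] [LawfulBEq α] {x y : α} (h : x ≠ y) (b : β)
    (l : List (α × β)) : ((y, b) :: l).lookup x = l.lookup x := by
  simp [List.lookup_cons, beq_eq_false_iff_ne.mpr h]

section insertLabel
variable {α β : Type*} [BEq α]

/-- Add a labeled point to a list, unless the list already has a label for the point. -/
def insertLabel (D : List (α × β)) (e : α × β) : List (α × β) :=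
  if (D.lookup e.1).isSome then D else e :: D

theorem length_insertLabel_le (D : List (α × β)) (e : α × β) :
    (insertLabel D e).length ≤ D.length + 1 := by
  rw [insertLabel]; split_ifs <;> simp

variable [LawfulBEq α]

theorem lookup_insertLabel_self (D : List (α × β)) (e : α × β) :
    (insertLabel D e).lookup e.1 = (D.lookup e.1).or (some e.2) := by
  obtain ⟨x, b⟩ := e
  rw [insertLabel]
  cases h : D.lookup x <;> simp [h]

theorem lookup_insertLabel_of_ne {x : α} {e : α × β} (h : x ≠ e.1) (D : List (α × β)) :
    (insertLabel D e).lookup x = D.lookup x := by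
  rw [insertLabel]
  split_ifs
  exacts [rfl, lookup_cons_of_ne h e.2 D]

end insertLabel

/-- The labels chosen so far in a simulated run. -/
abbrev Memo (n : ℕ) : Type := List (Cube n × Bool)

section simulation
variable {n : ℕ} {f A : Cube n → Bool} {k R : ℕ}

/-- The expectation of `κ` at the label of `x` and the updated list of labels; if `x` has no label
in `D`, a random one is chosen. -/
noncomputable def expectLabel (D : Memo n) (x : Cube n) (κ : Bool → Memo n → ℝ) : ℝ :=
  (D.lookup x).elim (𝔼 b, κ b ((x, b) :: D)) fun b => κ b D

/-- The expectation of `κ` at a simulated labeled example: if a uniform point `x` is near a point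
`y` of `A`, it is replaced by `x ∆ y ∆ z`, where `z` is the first point of `A` among `R` further
examples. As the label of `z` is then known, a query near the simulated example asks either for a
known label or for a label outside `A`. -/
noncomputable def expectExample (f A : Cube n → Bool) (k R : ℕ) (D : Memo n)
    (κ : Cube n → Bool → Memo n → ℝ) : ℝ :=
  𝔼 x, (nearest A k x).elim (expectLabel D x (κ x)) fun y =>
    expectFirst A (fun o => o.elim (expectLabel D x (κ x)) fun z =>
      expectLabel (insertLabel D (z, f z)) (x ∆ y ∆ z) (κ (x ∆ y ∆ z))) R

/-- The counterpart of `expectedPayoff` for runs in which examples and queries are simulated. -/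
noncomputable def simulatedPayoff (f A : Cube n → Bool) (k R : ℕ) (Ψ : Store → ℝ) :
    ℕ → List Prog → Store → Memo n → ℝ
  | 0, [], s, _ => Ψ s
  | 0, _ :: _, _, _ => 0
  | _ + 1, [], s, _ => Ψ s
  | t + 1, .assign v e :: r, s, D =>
      simulatedPayoff f A k R Ψ t r (Function.update s v (e.eval s)) D
  | t + 1, .seq p q :: r, s, D => simulatedPayoff f A k R Ψ t (p :: q :: r) s D
  | t + 1, .cond e p q :: r, s, D =>
      simulatedPayoff f A k R Ψ t ((if (e.eval s).isPair then p else q) :: r) s D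
  | t + 1, .loop e p :: r, s, D =>
      simulatedPayoff f A k R Ψ t (if (e.eval s).isPair then p :: .loop e p :: r else r) s D
  | t + 1, .flip v :: r, s, D =>
      𝔼 b, simulatedPayoff f A k R Ψ t r (Function.update s v (Data.ofBool b)) D
  | t + 1, .draw v :: r, s, D => expectExample f A k R D fun x b D' =>
      simulatedPayoff f A k R Ψ t r
        (Function.update s v (.cons (Data.ofPoint x) (Data.ofBool b))) D'
  | t + 1, .query v :: r, s, D => expectLabel D (Data.toPoint n (s v)) fun b D' =>
      simulatedPayoff f A k R Ψ t r (Function.update s v (Data.ofBool b)) D'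

theorem expectLabel_const_mul (v : ℝ) (D : Memo n) (x : Cube n) (κ : Bool → Memo n → ℝ) :
    expectLabel D x (fun b D' => v * κ b D') = v * expectLabel D x κ := by
  rw [expectLabel, expectLabel]
  cases D.lookup x
  exacts [(Finset.mul_expect _ _ v).symm, rfl]

theorem expectExample_const_mul (v : ℝ) (D : Memo n) (κ : Cube n → Bool → Memo n → ℝ) :
    expectExample f A k R D (fun x b D' => v * κ x b D') = v * expectExample f A k R D κ := by
  rw [expectExample, expectExample, Finset.mul_expect]
  refine Finset.expect_congr rfl fun x _ => ?_
  cases nearest A k x with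
  | none => exact expectLabel_const_mul _ _ _ _
  | some y =>
    rw [Option.elim_some, Option.elim_some, ← expectFirst_const_mul]
    congr 1
    funext o
    cases o <;> exact expectLabel_const_mul _ _ _ _

theorem simulatedPayoff_const_mul (v : ℝ) (Ψ : Store → ℝ) (t : ℕ) (todo : List Prog) (s : Store)
    (D : Memo n) : simulatedPayoff f A k R (fun s => v * Ψ s) t todo s D =
      v * simulatedPayoff f A k R Ψ t todo s D := by
  induction t generalizing todo s D with
  | zero => cases todo <;> simp [simulatedPayoff]
  | succ t ih =>
    rcases todo with _ | ⟨p, r⟩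
    · rfl
    · cases p <;>
        simp only [simulatedPayoff, ih, Finset.mul_expect, expectLabel_const_mul,
          expectExample_const_mul]

theorem le_expectLabel {D : Memo n} {x : Cube n} {κ : Bool → Memo n → ℝ} {v : ℝ}
    (hsome : ∀ b, D.lookup x = some b → v ≤ κ b D)
    (hnone : D.lookup x = none → ∀ b, v ≤ κ b ((x, b) :: D)) : v ≤ expectLabel D x κ := by
  rw [expectLabel]
  rcases h : D.lookup x with _ | b
  exacts [Finset.le_expect Finset.univ_nonempty fun b _ => hnone h b, hsome b h]

theorem le_expectExample {D : Memo n} {κ : Cube n → Bool → Memo n → ℝ} {v : ℝ}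
    (h : ∀ x, v ≤ expectLabel D x (κ x))
    (h' : ∀ x z, v ≤ expectLabel (insertLabel D (z, f z)) x (κ x)) :
    v ≤ expectExample f A k R D κ := by
  refine Finset.le_expect Finset.univ_nonempty fun x _ => ?_
  cases nearest A k x with
  | none => exact h x
  | some y => exact le_expectFirst (fun o => o.casesOn (h x) fun z => h' _ z) R

theorem simulatedPayoff_nonneg {Ψ : Store → ℝ} (hΨ : 0 ≤ Ψ) (t : ℕ) (todo : List Prog) (s : Store)
    (D : Memo n) : 0 ≤ simulatedPayoff f A k R Ψ t todo s D := by
  induction t generalizing todo s D with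
  | zero =>
    rcases todo with _ | _
    exacts [hΨ s, le_rfl]
  | succ t ih =>
    rcases todo with _ | ⟨p, r⟩
    · exact hΨ s
    have hlabel (D : Memo n) (x : Cube n) (u : Bool → Store) :
        0 ≤ expectLabel D x fun b D' => simulatedPayoff f A k R Ψ t r (u b) D' :=
      le_expectLabel (fun b _ => ih _ _ _) fun _ b => ih _ _ _
    cases p <;> simp only [simulatedPayoff]
    case flip => exact Finset.expect_nonneg fun _ _ => ih _ _ _
    case draw => exact le_expectExample (fun x => hlabel _ _ _) fun x z => hlabel _ _ _
    case query => exact hlabel _ _ _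
    all_goals exact ih _ _ _

/-- The target functions that agree with all the labels in `D`. -/
def Extends (D : Memo n) (g : Cube n → Bool) : Prop := ∀ x b, D.lookup x = some b → g x = b

theorem Extends.of_cons {D : Memo n} {g : Cube n → Bool} {e : Cube n × Bool}
    (h : Extends (e :: D) g) (he : D.lookup e.1 = none) : Extends D g := by
  intro x b hx
  refine h x b ?_
  rwa [lookup_cons_of_ne (y := e.1) (by rintro rfl; simp [he] at hx)]

theorem Extends.of_insertLabel {D : Memo n} {g : Cube n → Bool} {e : Cube n × Bool}
    (h : Extends (insertLabel D e) g) : Extends D g := by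
  rw [insertLabel] at h
  split_ifs at h with he
  exacts [h, h.of_cons (Option.not_isSome_iff_eq_none.mp he)]

theorem Extends.head {D : Memo n} {g : Cube n → Bool} {x : Cube n} {b : Bool}
    (h : Extends ((x, b) :: D) g) : g x = b :=
  h x b List.lookup_cons_self

theorem exists_extends (D : Memo n) : ∃ g, Extends D g :=
  ⟨fun x => (D.lookup x).getD false, fun x b h => by simp [h]⟩

/-- A simulated run is a possible run for some target function. -/
theorem one_le_simulatedPayoff {S : Set Store} (t : ℕ) (todo : List Prog) (s : Store) (D : Memo n)
    (h : ∀ g, Extends D g → 1 ≤ expectedPayoff g (S.indicator 1) t todo s) :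
    1 ≤ simulatedPayoff f A k R (S.indicator 1) t todo s D := by
  induction t generalizing todo s D with
  | zero =>
    obtain ⟨g, hg⟩ := exists_extends D
    rcases todo with _ | _
    exacts [h g hg, h g hg]
  | succ t ih =>
    rcases todo with _ | ⟨p, r⟩
    · obtain ⟨g, hg⟩ := exists_extends D
      exact h g hg
    have hle (g : Cube n → Bool) := expectedPayoff_le_one (f := g) (indicator_one_le_one S) t r
    have hlabel (D : Memo n) (x : Cube n) (u : Bool → Store) (hu : ∀ g, Extends D g →
        1 ≤ expectedPayoff g (S.indicator 1) t r (u (g x))) :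
        1 ≤ expectLabel D x fun b D' => simulatedPayoff f A k R (S.indicator 1) t r (u b) D' :=
      le_expectLabel (fun b hb => ih _ _ _ fun g hg => hg x b hb ▸ hu g hg)
        fun hx b => ih _ _ _ fun g hg => hg.head ▸ hu g (hg.of_cons hx)
    cases p <;> simp only [expectedPayoff, simulatedPayoff] at h ⊢
    case flip v =>
      exact Finset.le_expect Finset.univ_nonempty fun b _ => ih _ _ _ fun g hg =>
        one_le_of_one_le_expect (fun b => hle g _) (h g hg) b
    case draw v =>
      let u (x : Cube n) (b : Bool) : Store :=
        Function.update s v (.cons (Data.ofPoint x) (Data.ofBool b))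
      have hdraw (g : Cube n → Bool) (hg : Extends D g) :=
        one_le_of_one_le_expect (fun x => hle g (u x (g x))) (h g hg)
      exact le_expectExample (fun x => hlabel D x (u x) fun g hg => hdraw g hg x)
        fun x z => hlabel _ x (u x) fun g hg => hdraw g hg.of_insertLabel x
    case query v => exact hlabel D _ (fun b => Function.update s v (Data.ofBool b)) h
    all_goals exact ih _ _ _ h

end simulation

section labels
variable {n : ℕ} {f A : Cube n → Bool} {k : ℕ} {D : Memo n} {S : List (Cube n)} {x z : Cube n}

/-- The target function that agrees with `f` on `A`, has the labels in the list `D`, and agrees with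
`r` elsewhere. -/
def labels (f A : Cube n → Bool) (D : Memo n) (r : Cube n → Bool) : Cube n → Bool := fun x =>
  if A x then f x else (D.lookup x).getD (r x)

theorem labels_cons (hD : D.lookup x = none) (b : Bool) (r : Cube n → Bool) :
    labels f A ((x, b) :: D) r = labels f A D (Function.update r x b) := by
  funext y
  rw [labels, labels]
  obtain rfl | hy := eq_or_ne y x
  · simp [hD]
  · rw [lookup_cons_of_ne hy, Function.update_of_ne hy]

theorem labels_cons_apply (hx : A x = false) (b : Bool) (r : Cube n → Bool) :
    labels f A ((x, b) :: D) r x = b := by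
  simp [labels, hx]

theorem labels_insertLabel (hz : A z) (r : Cube n → Bool) :
    labels f A (insertLabel D (z, f z)) r = labels f A D r := by
  funext y
  rw [labels, labels]
  split_ifs with hy
  · rfl
  · rw [lookup_insertLabel_of_ne (by rintro rfl; exact hy hz)]

/-- The labels in the list agree with `f` on `A`, and all points of `A` near the sample have one. -/
structure Consistent (f A : Cube n → Bool) (k : ℕ) (D : Memo n) (S : List (Cube n)) : Prop where
  eq_of_mem : ∀ x b, A x → D.lookup x = some b → b = f x
  isSome_of_near : ∀ x ∈ S, ∀ y, A y → hammingDist x y ≤ k → (D.lookup y).isSome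

theorem Consistent.labels_eq (h : Consistent f A k D S) {b : Bool} (hx : D.lookup x = some b)
    (r : Cube n → Bool) : labels f A D r x = b := by
  rw [labels, hx]
  split_ifs with hA
  exacts [(h.eq_of_mem x b hA hx).symm, rfl]

theorem Consistent.cons (h : Consistent f A k D S) (hx : A x = false) (b : Bool) :
    Consistent f A k ((x, b) :: D) S where
  eq_of_mem y c hy hc := by
    rw [lookup_cons_of_ne (by rintro rfl; simp [hx] at hy)] at hc
    exact h.eq_of_mem y c hy hc
  isSome_of_near y hy z hz hd := by
    rw [lookup_cons_of_ne (by rintro rfl; simp [hx] at hz)]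
    exact h.isSome_of_near y hy z hz hd

theorem Consistent.insertLabel (h : Consistent f A k D S) (z : Cube n) :
    Consistent f A k (insertLabel D (z, f z)) S := by
  refine ⟨fun y c hy hc => ?_, fun x hx y hy hd => ?_⟩
  · obtain rfl | hyz := eq_or_ne y z
    · rw [lookup_insertLabel_self D (y, f y)] at hc
      cases hD : D.lookup y with
      | none => simpa [hD, eq_comm] using hc
      | some b => exact h.eq_of_mem y c hy (by simpa [hD] using hc)
    · exact h.eq_of_mem y c hy (lookup_insertLabel_of_ne (e := (z, f z)) hyz D ▸ hc)
  · obtain rfl | hyz := eq_or_ne y z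
    · simp [lookup_insertLabel_self D (y, f y)]
    · rw [lookup_insertLabel_of_ne (e := (z, f z)) hyz]
      exact h.isSome_of_near x hx y hy hd

theorem Consistent.cons_sample (h : Consistent f A k D S)
    (hx : ∀ y, A y → hammingDist x y ≤ k → (D.lookup y).isSome) :
    Consistent f A k D (x :: S) where
  eq_of_mem := h.eq_of_mem
  isSome_of_near := by
    rintro x' (_ | ⟨_, hx'⟩)
    exacts [hx, h.isSome_of_near x' hx']

end labels

section Obeys
variable {n : ℕ} {rule : QueryRule} {g : Cube n → Bool}

/-- All queries in runs from a configuration obey a rule. -/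
def Obeys (rule : QueryRule) (g : Cube n → Bool) (c : Config n) : Prop :=
  ∀ t : ℕ, ∀ c' ∈ (runFor g c t).support, ∀ v r,
    c'.todo = Prog.query v :: r → rule n c'.sample (Data.toPoint n (c'.store v))

theorem Obeys.step {c c' : Config n} (h : Obeys rule g c) (hc : c' ∈ (step g c).support) :
    Obeys rule g c' := by
  intro t c'' hc''
  refine h (t + 1) c'' ?_
  rw [runFor_succ', PMF.mem_support_bind_iff]
  exact ⟨c', hc, hc''⟩

theorem Obeys.draw {v : ℕ} {r : List Prog} {s : Store} {S : List (Cube n)}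
    (h : Obeys rule g ⟨.draw v :: r, s, S⟩) (x : Cube n) :
    Obeys rule g ⟨r, Function.update s v (.cons (Data.ofPoint x) (Data.ofBool (g x))), x :: S⟩ := by
  refine h.step ?_
  rw [LocalQueries.step, PMF.mem_support_bind_iff]
  exact ⟨x, by simp, by simp⟩

end Obeys

section averagePayoff
variable {n : ℕ} {f A : Cube n → Bool} {k R ℓ t : ℕ} {φ : (Cube n → Bool) → Store → ℝ}
  {Ψ : Store → ℝ} {β η : ℝ} {D : Memo n} {S : List (Cube n)}

/-- The expected payoff of a run for a random target function that agrees with `f` on `A` and with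
the labels in `D`; the payoff `φ` may depend on the target. -/
noncomputable def averagePayoff (f A : Cube n → Bool) (φ : (Cube n → Bool) → Store → ℝ) (t : ℕ)
    (todo : List Prog) (s : Store) (D : Memo n) : ℝ :=
  𝔼 r, expectedPayoff (labels f A D r) (φ (labels f A D r)) t todo s

/-- Simulated runs of `t` steps earn as much as runs for a random target function up to `η`, as long
as the number of labels stays below `ℓ` and the queries are local. -/
def Simulates (f A : Cube n → Bool) (k R : ℕ) (φ : (Cube n → Bool) → Store → ℝ) (Ψ : Store → ℝ)
    (ℓ t : ℕ) (η : ℝ) : Prop :=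
  ∀ (todo : List Prog) (s : Store) (S : List (Cube n)) (D : Memo n), D.length + 2 * t ≤ ℓ →
    Consistent f A k D S → (∀ r, Obeys (kLocal k) (labels f A D r) ⟨todo, s, S⟩) →
    averagePayoff f A φ t todo s D ≤ simulatedPayoff f A k R Ψ t todo s D + η

theorem Simulates.expect_le_expectLabel (h : Simulates f A k R φ Ψ ℓ t η) {x : Cube n}
    {r₀ : List Prog} {u : Bool → Store} (hℓ : D.length + 1 + 2 * t ≤ ℓ)
    (hD : Consistent f A k D S) (hx : A x → (D.lookup x).isSome)
    (hobey : ∀ r, Obeys (kLocal k) (labels f A D r) ⟨r₀, u (labels f A D r x), S⟩) :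
    𝔼 r, expectedPayoff (labels f A D r) (φ (labels f A D r)) t r₀ (u (labels f A D r x)) - η ≤
      expectLabel D x fun b D' => simulatedPayoff f A k R Ψ t r₀ (u b) D' := by
  rw [expectLabel]
  rcases hlx : D.lookup x with _ | b
  · have hAx : A x = false := by
      by_contra hAx
      simpa [hlx] using hx (by simpa using hAx)
    have hlab (b : Bool) (r : Cube n → Bool) : labels f A D (Function.update r x b) x = b := by
      rw [← labels_cons hlx, labels_cons_apply hAx]
    have hb (b : Bool) : 𝔼 r, expectedPayoff (labels f A D (Function.update r x b))
        (φ (labels f A D (Function.update r x b))) t r₀ (u b) ≤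
        simulatedPayoff f A k R Ψ t r₀ (u b) ((x, b) :: D) + η := by
      simp only [← labels_cons hlx]
      refine h r₀ (u b) S ((x, b) :: D) (by rw [List.length_cons]; lia) (hD.cons hAx b) fun r => ?_
      have := hobey (Function.update r x b)
      rwa [hlab, ← labels_cons hlx] at this
    have := Finset.expect_le_expect fun b (_ : b ∈ Finset.univ) => hb b
    rw [Finset.expect_add_distrib, Fintype.expect_const] at this
    rw [← expect_update x, Option.elim_none, sub_le_iff_le_add]
    simpa only [hlab] using this
  · simp only [hD.labels_eq hlx, Option.elim_some] at hobey ⊢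
    exact sub_le_iff_le_add.mpr (h r₀ (u b) S D (by lia) hD hobey)

theorem Simulates.averagePayoff_query_le (h : Simulates f A k R φ Ψ ℓ t η) {v : ℕ}
    {r₀ : List Prog} {s : Store} (hℓ : D.length + 2 * (t + 1) ≤ ℓ) (hD : Consistent f A k D S)
    (hobey : ∀ r, Obeys (kLocal k) (labels f A D r) ⟨.query v :: r₀, s, S⟩) :
    averagePayoff f A φ (t + 1) (.query v :: r₀) s D ≤
      simulatedPayoff f A k R Ψ (t + 1) (.query v :: r₀) s D + η := by
  have hx : A (Data.toPoint n (s v)) → (D.lookup (Data.toPoint n (s v))).isSome := fun hAx => by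
    obtain ⟨x, hx, hd⟩ := hobey ⊥ 0 ⟨.query v :: r₀, s, S⟩ (by simp [runFor]) v r₀ rfl
    exact hD.isSome_of_near x hx _ hAx hd
  exact sub_le_iff_le_add.mp <| h.expect_le_expectLabel
    (u := fun b => Function.update s v (Data.ofBool b)) (by lia) hD hx
    fun r => (hobey r).step (by simp [step])

theorem Simulates.expect_le_expectLabel_insertLabel (h : Simulates f A k R φ Ψ ℓ t η)
    (hA : Sparse A k) {x z : Cube n} (hz : A z) (hxz : hammingDist x z ≤ k) {r₀ : List Prog}
    {u : Bool → Store} (hℓ : D.length + 2 * (t + 1) ≤ ℓ) (hD : Consistent f A k D S)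
    (hobey : ∀ r, Obeys (kLocal k) (labels f A D r) ⟨r₀, u (labels f A D r x), x :: S⟩) :
    𝔼 r, expectedPayoff (labels f A D r) (φ (labels f A D r)) t r₀ (u (labels f A D r x)) - η ≤
      expectLabel (insertLabel D (z, f z)) x fun b D' =>
        simulatedPayoff f A k R Ψ t r₀ (u b) D' := by
  have hnear (y : Cube n) (hy : A y) (hxy : hammingDist x y ≤ k) :
      ((insertLabel D (z, f z)).lookup y).isSome := by
    rw [hA x y z hy hz hxy hxz, lookup_insertLabel_self D (z, f z)]
    simp
  have hlen := length_insertLabel_le D (z, f z)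
  have hlabel := h.expect_le_expectLabel (x := x) (r₀ := r₀) (u := u)
    (D := insertLabel D (z, f z)) (by lia) ((hD.insertLabel z).cons_sample hnear)
    (fun hAx => hnear x hAx (by simp)) fun r => by
      rw [labels_insertLabel hz]
      exact hobey r
  simpa only [labels_insertLabel hz] using hlabel

theorem Simulates.averagePayoff_draw_le (h : Simulates f A k R φ Ψ ℓ t η) (hA : Sparse A k)
    (hφ : ∀ g, φ g ≤ 1) (hΨ : 0 ≤ Ψ) (hη : 0 ≤ η) {v : ℕ} {r₀ : List Prog} {s : Store}
    (hℓ : D.length + 2 * (t + 1) ≤ ℓ) (hD : Consistent f A k D S)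
    (hobey : ∀ r, Obeys (kLocal k) (labels f A D r) ⟨.draw v :: r₀, s, S⟩) :
    averagePayoff f A φ (t + 1) (.draw v :: r₀) s D ≤
      simulatedPayoff f A k R Ψ (t + 1) (.draw v :: r₀) s D +
        (η + (n + 1) ^ k / (R + 1)) := by
  let u (x : Cube n) (b : Bool) : Store :=
    Function.update s v (.cons (Data.ofPoint x) (Data.ofBool b))
  let G (x : Cube n) : ℝ := 𝔼 r, expectedPayoff (labels f A D r) (φ (labels f A D r)) t r₀
    (u x (labels f A D r x))
  let F (x : Cube n) : ℝ := max 0 (G x - η)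
  have hF : F ≤ 1 := fun x => max_le zero_le_one <| (sub_le_self _ hη).trans <|
    Finset.expect_le Finset.univ_nonempty fun r _ => expectedPayoff_le_one (hφ _) _ _ _
  have hnonneg (D : Memo n) (x : Cube n) :
      0 ≤ expectLabel D x fun b D' => simulatedPayoff f A k R Ψ t r₀ (u x b) D' :=
    le_expectLabel (fun b _ => simulatedPayoff_nonneg hΨ _ _ _ _)
      fun _ b => simulatedPayoff_nonneg hΨ _ _ _ _
  have hdraw : 𝔼 x, F x - (n + 1) ^ k / (R + 1) ≤
      simulatedPayoff f A k R Ψ (t + 1) (.draw v :: r₀) s D := by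
    refine (expect_sub_le_expect_nearest hA hF R).trans (Finset.expect_le_expect fun x _ => ?_)
    rcases hx : nearest A k x with _ | y
    · have hfar (y : Cube n) (hy : A y) (hd : hammingDist x y ≤ k) : (D.lookup y).isSome := by
        simpa [hx] using isSome_nearest hy hd
      exact max_le (hnonneg D x) (h.expect_le_expectLabel (by lia) (hD.cons_sample hfar)
        (fun hAx => hfar x hAx (by simp)) fun r => (hobey r).draw x)
    · refine expectFirst_mono (hnonneg D x) (fun z hz => max_le (hnonneg _ _) ?_) R
      have hxz : hammingDist (x ∆ y ∆ z) z ≤ k := by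
        rw [hammingDist_comm, symmDiff_comm, hammingDist_symmDiff_self,
          ← hammingDist_symmDiff_self x, symmDiff_symmDiff_cancel_left]
        exact (nearest_eq_some hx).2
      exact h.expect_le_expectLabel_insertLabel hA hz hxz hℓ hD fun r => (hobey r).draw _
  have hGF : 𝔼 x, G x - η ≤ 𝔼 x, F x := by
    rw [← Fintype.expect_const (ι := Cube n) η, ← Finset.expect_sub_distrib]
    exact Finset.expect_le_expect fun x _ => le_max_right _ _
  have hG : averagePayoff f A φ (t + 1) (.draw v :: r₀) s D = 𝔼 x, G x := Finset.expect_comm ..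
  linarith

theorem simulates (hA : Sparse A k) (hφ : ∀ g, φ g ≤ 1) (hΨ : 0 ≤ Ψ) (hβ : 0 ≤ β)
    (h : ∀ s (D : Memo n), D.length ≤ ℓ → 𝔼 r, φ (labels f A D r) s ≤ Ψ s + β) (t : ℕ) :
    Simulates f A k R φ Ψ ℓ t (β + t * ((n + 1) ^ k / (R + 1))) := by
  induction t with
  | zero =>
    rintro (_ | ⟨p, r⟩) s S D hℓ - -
    · simpa [averagePayoff, expectedPayoff, simulatedPayoff] using h s D hℓ
    · simpa [averagePayoff, expectedPayoff, simulatedPayoff] using hβ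
  | succ t ih =>
    intro todo s S D hℓ hD hobey
    have hη : β + t * ((n + 1) ^ k / (R + 1)) ≤
        β + (t + 1 : ℕ) * ((n + 1 : ℝ) ^ k / (R + 1)) := by gcongr; lia
    have hstep {todo' : List Prog} {s' : Store}
        (h : ∀ r, ⟨todo', s', S⟩ ∈ (step (labels f A D r) ⟨todo, s, S⟩).support) :
        averagePayoff f A φ t todo' s' D ≤ simulatedPayoff f A k R Ψ t todo' s' D +
          (β + (t + 1 : ℕ) * ((n + 1) ^ k / (R + 1))) :=
      (ih todo' s' S D (by lia) hD fun r => (hobey r).step (h r)).trans (by gcongr)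
    rcases todo with _ | ⟨p, r₀⟩
    · exact (h s D (by lia)).trans (by
        simp only [simulatedPayoff, ← add_assoc]; exact le_add_of_nonneg_right (by positivity))
    cases p with
    | flip v =>
      have := Finset.expect_le_expect fun b (_ : b ∈ Finset.univ) => hstep (todo' := r₀)
        (s' := Function.update s v (Data.ofBool b)) fun r => by cases b <;> simp [step]
      rw [Finset.expect_add_distrib, Fintype.expect_const] at this
      exact (Finset.expect_comm ..).trans_le this
    | draw v =>
      refine (ih.averagePayoff_draw_le hA hφ hΨ (by positivity) hℓ hD hobey).trans_eq ?_
      push_cast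
      ring
    | query v => exact (ih.averagePayoff_query_le hℓ hD hobey).trans (by gcongr)
    | _ => exact hstep fun r => by simp [step]

end averagePayoff

/-! ### Fluctuation of the errors under random labels -/

/-- A bit as a sign. -/
def sgn (b : Bool) : ℝ := if b then 1 else -1

section sgn
variable {ι : Type*} [Fintype ι] [DecidableEq ι]

theorem expect_sgn_mul_sgn (x y : ι) :
    𝔼 r : ι → Bool, sgn (r x) * sgn (r y) = if x = y then 1 else 0 := by
  split_ifs with h
  · have hsq (b : Bool) : sgn b * sgn b = 1 := by cases b <;> simp [sgn]
    simp only [h, hsq, Fintype.expect_const]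
  · rw [← expect_update x]
    have hsgn : 𝔼 b, sgn b = 0 := by
      simp [sgn, Fintype.expect_eq_sum_div_card, Fintype.sum_bool, -Fintype.univ_bool]
    simp only [Function.update_self, Function.update_of_ne (Ne.symm h), ← Finset.mul_expect,
      ← Finset.expect_mul, hsgn, zero_mul]

theorem expect_sq_expect_mul_sgn_le {s : ι → ℝ} (hs : ∀ x, s x ^ 2 ≤ 1) :
    𝔼 r : ι → Bool, (𝔼 x, s x * sgn (r x)) ^ 2 ≤ 1 / Fintype.card ι := by
  have hterm (x y : ι) : 𝔼 r : ι → Bool, s x * sgn (r x) * (s y * sgn (r y)) =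
      if x = y then s x ^ 2 else 0 := by
    simp only [mul_mul_mul_comm, ← Finset.mul_expect, expect_sgn_mul_sgn]
    split_ifs with h <;> simp [h, sq]
  calc _ = 𝔼 x, 𝔼 y, 𝔼 r : ι → Bool, s x * sgn (r x) * (s y * sgn (r y)) := by
        simp only [sq, Finset.expect_mul_expect]
        rw [Finset.expect_comm]
        exact Finset.expect_congr rfl fun x _ => Finset.expect_comm ..
    _ = 𝔼 x, s x ^ 2 / Fintype.card ι := by
        simp only [hterm]
        refine Finset.expect_congr rfl fun x _ => ?_
        rw [Fintype.expect_eq_sum_div_card, Fintype.sum_ite_eq]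
    _ ≤ 1 / Fintype.card ι := by
        rcases isEmpty_or_nonempty ι
        · simp
        · exact Finset.expect_le Finset.univ_nonempty fun x _ => by gcongr; exact hs x

end sgn

section err
variable {n : ℕ} {f A h c : Cube n → Bool} {D : Memo n} {ε γ : ℝ}

/-- The probability that a uniform point lies in `A` and two functions differ at it. -/
noncomputable def errOn (A h f : Cube n → Bool) : ℝ := 𝔼 x, if A x ∧ h x ≠ f x then 1 else 0

theorem err_eq_expect (h f : Cube n → Bool) : err h f = 𝔼 x, if h x ≠ f x then 1 else 0 := by
  rw [err, Fintype.expect_eq_sum_div_card, Finset.sum_boole]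

theorem expect_isSome_lookup_le (D : Memo n) :
    (𝔼 x, if (D.lookup x).isSome then 1 else 0) ≤ (D.length : ℝ) / 2 ^ n := by
  have hsub : Finset.univ.filter (fun x => (D.lookup x).isSome) ⊆ (D.map Prod.fst).toFinset := by
    intro x
    simp
  rw [Fintype.expect_eq_sum_div_card, Finset.sum_boole]
  simp only [Fintype.card_fun, Fintype.card_bool, Fintype.card_fin, Nat.cast_pow, Nat.cast_ofNat]
  gcongr
  exact (Finset.card_le_card hsub).trans ((List.toFinset_card_le _).trans_eq (List.length_map _))

/-- The label of a point outside `A` without a label in `D` contributes a random sign to the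
difference of the errors of two functions that differ at the point. -/
theorem errOn_sub_errOn_le (f A h c : Cube n → Bool) (D : Memo n) (r : Cube n → Bool) :
    errOn A h f - errOn A c f - D.length / 2 ^ n + (𝔼 x,
      (if A x ∨ (D.lookup x).isSome then 0 else (sgn (c x) - sgn (h x)) / 2) * sgn (r x)) ≤
    err h (labels f A D r) - err c (labels f A D r) := by
  have hbits (a h c f r : Bool) (l : Option Bool) :
      ((if a ∧ h ≠ f then (1 : ℝ) else 0) - if a ∧ c ≠ f then 1 else 0) -
        (if l.isSome then 1 else 0) +
        (if a ∨ l.isSome then 0 else (sgn c - sgn h) / 2) * sgn r ≤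
      (if h ≠ (if a then f else l.getD r) then (1 : ℝ) else 0) -
        if c ≠ (if a then f else l.getD r) then 1 else 0 := by
    cases a
    · rcases l with _ | b
      · cases h <;> cases c <;> cases r <;> norm_num [sgn]
      · cases h <;> cases c <;> cases b <;> simp
    · cases h <;> cases c <;> cases f <;> rcases l with _ | b <;> simp
  have hexp := Finset.expect_le_expect fun x (_ : x ∈ Finset.univ) =>
    hbits (A x) (h x) (c x) (f x) (r x) (D.lookup x)
  rw [Finset.expect_add_distrib, Finset.expect_sub_distrib, Finset.expect_sub_distrib,
    Finset.expect_sub_distrib] at hexp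
  have hD := expect_isSome_lookup_le D
  have herr (g : Cube n → Bool) : err g (labels f A D r) =
      𝔼 x, if g x ≠ (if A x then f x else (D.lookup x).getD (r x)) then 1 else 0 :=
    err_eq_expect g _
  rw [herr, herr, errOn, errOn]
  linarith

theorem expect_indicator_err_le (hγ : 0 < γ) (hD : (D.length : ℝ) ≤ γ * 2 ^ n)
    (hc : errOn A c f + (ε + 2 * γ) < errOn A h f) :
    𝔼 r, {g | err h g ≤ err c g + ε}.indicator 1 (labels f A D r) ≤ 1 / (γ ^ 2 * 2 ^ n) := by
  set σ : Cube n → ℝ := fun x =>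
    if A x ∨ (D.lookup x).isSome then 0 else (sgn (c x) - sgn (h x)) / 2 with hσ
  have hσ1 (x : Cube n) : σ x ^ 2 ≤ 1 := by
    simp only [hσ]
    split_ifs
    · norm_num
    · cases c x <;> cases h x <;> norm_num [sgn]
  have hcheb (r : Cube n → Bool) : {g | err h g ≤ err c g + ε}.indicator 1 (labels f A D r) ≤
      1 / γ ^ 2 * (𝔼 x, σ x * sgn (r x)) ^ 2 := by
    by_cases hr : labels f A D r ∈ {g | err h g ≤ err c g + ε}
    · have hD' : (D.length : ℝ) / 2 ^ n ≤ γ := (div_le_iff₀ (by positivity)).mpr hD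
      have hle : 𝔼 x, σ x * sgn (r x) ≤ -γ := by
        linarith [errOn_sub_errOn_le f A h c D r, hr.out]
      rw [Set.indicator_of_mem hr, Pi.one_apply, one_div_mul_eq_div, one_le_div (by positivity)]
      nlinarith
    · rw [Set.indicator_of_notMem hr]
      positivity
  calc _ ≤ 𝔼 r : Cube n → Bool, 1 / γ ^ 2 * (𝔼 x, σ x * sgn (r x)) ^ 2 :=
        Finset.expect_le_expect fun r _ => hcheb r
    _ ≤ 1 / γ ^ 2 * (1 / Fintype.card (Cube n)) := by
        rw [← Finset.mul_expect]
        gcongr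
        exact expect_sq_expect_mul_sgn_le hσ1
    _ = 1 / (γ ^ 2 * 2 ^ n) := by simp [mul_comm]

/-- The stores whose output is the code of a hypothesis that `E` evaluates in time `T` and whose
error exceeds that of no function in `C` by more than `ε`. -/
def accurateStores (E : Prog) (T : ℕ) (C : Set (Cube n → Bool)) (ε : ℝ) (f : Cube n → Bool) :
    Set Store :=
  {s | ∃ h : Cube n → Bool, Evaluates E (s 0) T h ∧ ∀ c ∈ C, err h f ≤ err c f + ε}

/-- The analogue of `accurateStores` for the error on `A`. -/
def accurateStoresOn (E : Prog) (T : ℕ) (C : Set (Cube n → Bool)) (A : Cube n → Bool) (ε : ℝ)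
    (f : Cube n → Bool) : Set Store :=
  {s | ∃ h : Cube n → Bool, Evaluates E (s 0) T h ∧ ∀ c ∈ C, errOn A h f ≤ errOn A c f + ε}

theorem Evaluates.unique {E : Prog} {d : Data} {T : ℕ} {h h' : Cube n → Bool}
    (hh : Evaluates E d T h) (hh' : Evaluates E d T h') : h = h' := by
  funext x
  obtain ⟨c, hc⟩ := (runFor (fun _ : Cube n => false)
    (start n E [d, Data.ofNat n, Data.ofPoint x]) T).support_nonempty
  rw [← (hh.2 x c hc).2, (hh'.2 x c hc).2]

theorem expect_indicator_accurateStores_le {E : Prog} {T : ℕ} {C : Set (Cube n → Bool)} {s : Store}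
    (hγ : 0 < γ) (hD : (D.length : ℝ) ≤ γ * 2 ^ n)
    (hs : s ∉ accurateStoresOn E T C A (ε + 2 * γ) f) :
    𝔼 r, (accurateStores E T C ε (labels f A D r)).indicator 1 s ≤ 1 / (γ ^ 2 * 2 ^ n) := by
  by_cases hev : ∃ h : Cube n → Bool, Evaluates E (s 0) T h
  · obtain ⟨h, hh⟩ := hev
    obtain ⟨c, hc, hlt⟩ : ∃ c ∈ C, errOn A c f + (ε + 2 * γ) < errOn A h f := by
      by_contra! hno
      exact hs ⟨h, hh, hno⟩
    refine le_trans (Finset.expect_le_expect fun r _ => ?_) (expect_indicator_err_le hγ hD hlt)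
    by_cases hr : s ∈ accurateStores E T C ε (labels f A D r)
    · obtain ⟨h', hh', hle⟩ := id hr
      have hmem : labels f A D r ∈ {g | err h g ≤ err c g + ε} := hh.unique hh' ▸ hle c hc
      rw [Set.indicator_of_mem hr, Set.indicator_of_mem hmem, Pi.one_apply, Pi.one_apply]
    · rw [Set.indicator_of_notMem hr]
      exact indicator_one_nonneg _ _
  · have hs (g : Cube n → Bool) : s ∉ accurateStores E T C ε g := fun ⟨h, hh, _⟩ => hev ⟨h, hh⟩
    simp only [Set.indicator_of_notMem (hs _), Fintype.expect_const]
    positivity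

theorem le_simulatedPayoff_of_learner {C : Set (Cube n → Bool)} {L E : Prog} {k T : ℕ} {δ : ℝ}
    {s₀ : Store} (hA : Sparse A k) (R : ℕ)
    (hobey : ∀ g : Cube n → Bool, Obeys (kLocal k) g ⟨[L], s₀, []⟩)
    (hprob : ∀ g : Cube n → Bool,
      1 - δ ≤ expectedPayoff g ((accurateStores E T C ε g).indicator 1) T [L] s₀)
    (hγ : 0 < γ) (hT : (2 * T : ℝ) ≤ γ * 2 ^ n) :
    1 - δ - 1 / (γ ^ 2 * 2 ^ n) - T * ((n + 1) ^ k / (R + 1)) ≤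
      simulatedPayoff f A k R ((accurateStoresOn E T C A (ε + 2 * γ) f).indicator 1) T [L] s₀
        [] := by
  have hβ : 0 ≤ 1 / (γ ^ 2 * 2 ^ n) := by positivity
  have hsim := simulates (f := f) (R := R) (ℓ := 2 * T) hA
    (φ := fun g => (accurateStores E T C ε g).indicator 1) (fun g => indicator_one_le_one _)
    (indicator_one_nonneg (accurateStoresOn E T C A (ε + 2 * γ) f)) hβ (fun s D hD => ?_) T [L] s₀
    [] [] (by simp) ⟨by simp, by simp⟩ fun r => hobey _
  · have := (Finset.le_expect Finset.univ_nonempty fun r _ => hprob (labels f A [] r)).trans hsim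
    linarith
  · by_cases hs : s ∈ accurateStoresOn E T C A (ε + 2 * γ) f
    · rw [Set.indicator_of_mem hs]
      exact (Finset.expect_le Finset.univ_nonempty fun r _ => indicator_one_le_one _ s).trans
        (le_add_of_nonneg_right hβ)
    · rw [Set.indicator_of_notMem hs, zero_add]
      exact expect_indicator_accurateStores_le hγ (le_trans (by exact_mod_cast hD) hT) hs

end err

/-! ### The simulating program -/

/-- All variables of an expression are smaller than this bound. -/
def Expr.bound : Expr → ℕ
  | .var v => v + 1
  | .nil => 0
  | .cons e e' => max e.bound e'.bound
  | .head e => e.bound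
  | .tail e => e.bound

/-- All variables of a program are smaller than this bound. -/
def Prog.bound : Prog → ℕ
  | .assign v e => max (v + 1) e.bound
  | .seq p q => max p.bound q.bound
  | .cond e p q => max e.bound (max p.bound q.bound)
  | .loop e p => max e.bound p.bound
  | .flip v => v + 1
  | .draw v => v + 1
  | .query v => v + 1

theorem Expr.eval_congr {V : ℕ} {s s' : Store} (h : ∀ v < V, s v = s' v) (e : Expr)
    (he : e.bound ≤ V) : e.eval s = e.eval s' := by
  induction e with
  | var v => exact h v he
  | nil => rfl
  | cons e e' ih ih' =>
    rw [Expr.eval, Expr.eval, ih (le_of_max_le_left he), ih' (le_of_max_le_right he)]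
  | head e ih | tail e ih => rw [Expr.eval, Expr.eval, ih he]

theorem update_congr {V v : ℕ} {s s' : Store} (h : ∀ v < V, s v = s' v) (d : Data) :
    ∀ x < V, Function.update s v d x = Function.update s' v d x := fun x hx => by
  rw [Function.update_apply, Function.update_apply, h x hx]

section expectedPayoff
variable {n V : ℕ} {f : Cube n → Bool} {Φ K : Store → ℝ}

theorem expectedPayoff_le_stackWp (hK₀ : 0 ≤ K) (hK : ∀ s s', (∀ v < V, s v = s' v) → Φ s ≤ K s')
    {t W : ℕ} (hW : t ≤ W) (todo : List Prog) (htodo : ∀ p ∈ todo, p.bound ≤ V) (s s' : Store)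
    (hs : ∀ v < V, s v = s' v) : expectedPayoff f Φ t todo s ≤ stackWp W f todo K s' := by
  induction t generalizing W todo s s' with
  | zero =>
    rcases todo with _ | ⟨p, r⟩
    exacts [hK _ _ hs, stackWp_nonneg hK₀ _ _]
  | succ t ih =>
    rcases todo with _ | ⟨p, r⟩
    · exact hK _ _ hs
    obtain ⟨W, rfl⟩ : ∃ W', W = W' + 1 := ⟨W - 1, by omega⟩
    have hW' : t ≤ W + 1 := by omega
    obtain ⟨hp, hr⟩ := List.forall_mem_cons.mp htodo
    cases p <;> simp only [Prog.bound, max_le_iff] at hp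
    case assign v e =>
      rw [expectedPayoff, Expr.eval_congr hs e hp.2]
      exact ih hW' r hr _ _ (update_congr hs _)
    case seq p q =>
      exact ih hW' (p :: q :: r) (by simp only [List.forall_mem_cons]; exact ⟨hp.1, hp.2, hr⟩)
        _ _ hs
    case cond e p q =>
      simp only [stackWp_cons, Prog.wp, expectedPayoff, Expr.eval_congr hs e hp.1]
      split_ifs
      · exact ih hW' (p :: r) (List.forall_mem_cons.mpr ⟨hp.2.1, hr⟩) _ _ hs
      · exact ih hW' (q :: r) (List.forall_mem_cons.mpr ⟨hp.2.2, hr⟩) _ _ hs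
    case loop e p =>
      rw [expectedPayoff, Expr.eval_congr hs e hp.1]
      refine (ih (W := W) (by omega) _ ?_ s s' hs).trans (stackWp_unfold_loop_le hK₀ e p r s')
      split_ifs
      exacts [List.forall_mem_cons.mpr ⟨hp.2, htodo⟩, hr]
    case query v =>
      rw [stackWp_cons, expectedPayoff, hs v hp]
      exact ih hW' r hr _ _ (update_congr hs _)
    all_goals exact Finset.expect_le_expect fun b _ => ih hW' r hr _ _ (update_congr hs _)

end expectedPayoff

section simulate

open LocalQueries.Expr (var)

/-- The program that looks up the label of the point in variable `V + 7`, choosing it at random if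
there is none yet, and stores it in variable `V + 8`. -/
def labelProg (V l : ℕ) : Prog :=
  .seq (.assign (V + 8) (.cons (var (V + 3)) (var (V + 7)))) (.seq
    ((lookupFn l).compile V (V + 8)) (.cond (var (V + 8))
      (.assign (V + 8) (.head (var (V + 8))))
      (.seq (.flip (V + 8))
        (.assign (V + 3) (.cons (.cons (var (V + 7)) (var (V + 8))) (var (V + 3)))))))

/-- The simulation of the program `query v`. -/
def queryProg (V l v : ℕ) : Prog :=
  .seq (.assign (V + 7) (.cons (var (V + 1)) (.cons (var v) (.cons .nil .nil)))) (.seq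
    (xorFn.compile V (V + 7)) (.seq (labelProg V l) (.assign v (var (V + 8)))))

/-- One round of the search for an example of the current colour: if it succeeds, the example is
stored in variable `V + 9` and the counter of the remaining rounds in variable `V + 10` is reset. -/
def searchBody (V c e d : ℕ) : Prog :=
  .seq (.assign (V + 10) (.tail (var (V + 10)))) (.seq (.draw (V + 11)) (.seq
    (.assign (V + 12) (.cons (.head (var (V + 11))) (.cons (var (V + 1)) (var (V + 2))))) (.seq
    ((testFn c e d).compile V (V + 12)) (.cond (var (V + 12))
      (.seq (.assign (V + 9) (var (V + 11))) (.assign (V + 10) .nil))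
      (.assign (V + 9) .nil)))))

/-- The program that draws examples until one of the current colour is found, at most `u ^ ρ`
times, where `u` is the number of iterations. -/
def searchProg (V c e d ρ : ℕ) : Prog :=
  .seq (.assign (V + 9) .nil) (.seq (.assign (V + 10) .nil) (.seq
    ((incFn ρ).compile V (V + 10)) (.loop (var (V + 10)) (searchBody V c e d))))

/-- The program that records the labeled example in variable `V + 9` unless its point already has
a label. -/
def recordProg (V l : ℕ) : Prog :=
  .seq (.assign (V + 11) (.cons (var (V + 3)) (.head (var (V + 9))))) (.seq
    ((lookupFn l).compile V (V + 11)) (.cond (var (V + 11)) (.assign (V + 11) .nil)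
      (.assign (V + 3) (.cons (var (V + 9)) (var (V + 3))))))

/-- The program that adds the points in the variables `V + 8` and `V + 9` to the one in variable
`V + 7`. -/
def moveProg (V : ℕ) : Prog :=
  .seq (.assign (V + 7) (.cons (var (V + 1)) (.cons (var (V + 7)) (.cons (.head (var (V + 8)))
    (.head (var (V + 9))))))) (xorFn.compile V (V + 7))

/-- The simulation of the program `draw v`. -/
def drawProg (V c e d k ρ l v : ℕ) : Prog :=
  .seq (.draw (V + 7)) (.seq (.assign (V + 7) (.head (var (V + 7)))) (.seq
    (.assign (V + 8) (.cons (var (V + 7)) (.cons (var (V + 1)) (var (V + 2))))) (.seq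
    ((nearFn c e d k).compile V (V + 8)) (.seq
    (.cond (var (V + 8))
      (.seq (searchProg V c e d ρ) (.cond (var (V + 9)) (.seq (recordProg V l) (moveProg V))
        (.assign (V + 9) .nil)))
      (.assign (V + 8) .nil)) (.seq
    (labelProg V l) (.assign v (.cons (var (V + 7)) (var (V + 8)))))))))

/-- The program with examples and queries replaced by their simulations. -/
def Prog.simulate (V c e d k ρ l : ℕ) : Prog → Prog
  | .assign v e => .assign v e
  | .seq p q => .seq (p.simulate V c e d k ρ l) (q.simulate V c e d k ρ l)
  | .cond e' p q => .cond e' (p.simulate V c e d k ρ l) (q.simulate V c e d k ρ l)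
  | .loop e' p => .loop e' (p.simulate V c e d k ρ l)
  | .flip v => .flip v
  | .draw v => drawProg V c e d k ρ l v
  | .query v => queryProg V l v

/-- The store `s` of a simulation: the variables below `V` are those of the store `s₀` of the
simulated program, the next ones hold the number of iterations, the dimension, the colour, the list
of labels, and two values that are not changed. -/
structure SimStore (V u n a : ℕ) (o τ : Data) (D : Memo n) (s₀ s : Store) : Prop where
  low : ∀ v < V, s v = s₀ v
  driver : s V = Data.ofNat u
  dim : s (V + 1) = Data.ofNat n
  col : s (V + 2) = Data.ofNat a
  memo : s (V + 3) = Data.ofTable D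
  out : s (V + 4) = o
  tab : s (V + 5) = τ

section
variable {V u n a c e d k ρ l W : ℕ} {o τ : Data} {D : Memo n} {s₀ s s' : Store}
  {f : Cube n → Bool} {K : Store → ℝ}

theorem SimStore.congr (h : SimStore V u n a o τ D s₀ s) (h' : ∀ v < V + 7, s' v = s v) :
    SimStore V u n a o τ D s₀ s' := by
  constructor
  · intro v hv; rw [h' v (by omega), h.low v hv]
  all_goals rw [h' _ (by omega)]
  exacts [h.driver, h.dim, h.col, h.memo, h.out, h.tab]

theorem SimStore.update_high (h : SimStore V u n a o τ D s₀ s) {v : ℕ} (hv : V + 7 ≤ v)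
    (x : Data) : SimStore V u n a o τ D s₀ (Function.update s v x) :=
  h.congr fun _ hw => Function.update_of_ne (by omega) _ _

theorem SimStore.update_low (h : SimStore V u n a o τ D s₀ s) {v : ℕ} (hv : v < V) (x : Data) :
    SimStore V u n a o τ D (Function.update s₀ v x) (Function.update s v x) := by
  constructor
  · exact update_congr h.low x
  all_goals rw [Function.update_of_ne (by omega)]
  exacts [h.driver, h.dim, h.col, h.memo, h.out, h.tab]

theorem SimStore.update_memo (h : SimStore V u n a o τ D s₀ s) (D' : Memo n) :
    SimStore V u n a o τ D' s₀ (Function.update s (V + 3) (Data.ofTable D')) := by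
  constructor
  case memo => exact Function.update_self _ _ _
  case low => intro v hv; rw [Function.update_of_ne (by omega), h.low v hv]
  all_goals rw [Function.update_of_ne (by omega)]
  exacts [h.driver, h.dim, h.col, h.out, h.tab]

theorem expectLabel_le_wp_labelProg {κ : Bool → Memo n → ℝ} {x : Cube n}
    (hn : n ≤ u) (huW : u < W) (hl : D.length ≤ u ^ l) (hs : SimStore V u n a o τ D s₀ s)
    (hx : s (V + 7) = Data.ofPoint x)
    (hK : ∀ b D' s', D'.length ≤ D.length + 1 → SimStore V u n a o τ D' s₀ s' →
      s' (V + 7) = Data.ofPoint x → s' (V + 8) = Data.ofBool b → κ b D' ≤ K s') :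
    expectLabel D x κ ≤ (labelProg V l).wp W f K s := by
  refine computes_compile (by omega) huW (lookupFn l) ?_ fun s₁ h₁ hlt => ?_
  · simp [hs.driver]
  have hs₁ : SimStore V u n a o τ D s₀ s₁ :=
    (hs.update_high (by omega) _).congr fun v hv => hlt v (by omega)
  have hx₁ : s₁ (V + 7) = Data.ofPoint x := by simp [hlt, hx]
  simp only [Function.update_self, Expr.eval, hs.memo, hx, eval_lookupFn hn D hl x] at h₁
  simp only [Prog.wp, Expr.eval, h₁, expectLabel]
  rcases D.lookup x with _ | b
  · refine Finset.expect_le_expect fun b _ => ?_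
    have hs₂ := hs₁.update_high (v := V + 8) (by omega) (Data.ofBool b)
    have hcons : Data.cons (.cons (Function.update s₁ (V + 8) (Data.ofBool b) (V + 7))
        (Function.update s₁ (V + 8) (Data.ofBool b) (V + 8)))
        (Function.update s₁ (V + 8) (Data.ofBool b) (V + 3)) = Data.ofTable ((x, b) :: D) := by
      rw [hs₂.memo]; simp [hx₁]; rfl
    rw [hcons]
    exact hK b _ _ le_rfl (hs₂.update_memo _) (by simp [hx₁]) (by simp)
  · exact hK b D _ (Nat.le_succ _) (hs₁.update_high (by omega) _) (by simp [hx₁]) (by simp)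

theorem expectLabel_le_wp_queryProg {κ : Bool → Memo n → ℝ} {v : ℕ} (hv : v < V)
    (hn : n ≤ u) (huW : u < W) (hl : D.length ≤ u ^ l) (hs : SimStore V u n a o τ D s₀ s)
    (hK : ∀ b D' s', D'.length ≤ D.length + 1 →
      SimStore V u n a o τ D' (Function.update s₀ v (Data.ofBool b)) s' → κ b D' ≤ K s') :
    expectLabel D (Data.toPoint n (s₀ v)) κ ≤ (queryProg V l v).wp W f K s := by
  refine computes_compile (by omega) huW xorFn ?_ fun s₁ h₁ hlt => ?_
  · simp [hs.driver]
  have hs₁ : SimStore V u n a o τ D s₀ s₁ :=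
    (hs.update_high le_rfl _).congr fun v hv => hlt v (by omega)
  simp only [Function.update_self, Expr.eval, hs.dim, eval_xorFn hn, Data.toPoint_nil, hs.low v hv,
    symmDiff_bot] at h₁
  refine expectLabel_le_wp_labelProg hn huW hl hs₁ h₁ fun b D' s' hD' hs' _ hb => ?_
  simp only [Prog.wp, Expr.eval, hb]
  exact hK b D' _ hD' (hs'.update_low hv _)

theorem expect_le_wp_searchBody {F : Cube n → ℝ} {R : ℕ} (hcol : ColorBound u c e d n)
    (huW : u < W) (hu : s V = Data.ofNat u) (ha : s (V + 2) = Data.ofNat a)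
    (hR : s (V + 10) = Data.ofNat (R + 1))
    (hK : ∀ w s', (∀ v < V + 9, s' v = s v) →
      s' (V + 9) = (if colorClass (u ^ e) d a w then Data.ofExample (w, f w) else .nil) →
      s' (V + 10) = Data.ofNat (if colorClass (u ^ e) d a w then 0 else R) → F w ≤ K s') :
    𝔼 w, F w ≤ (searchBody V c e d).wp W f K s := by
  refine Finset.expect_le_expect fun w _ => ?_
  refine computes_compile (by omega) huW (testFn c e d) (by simp [hu]) fun s₁ h₁ hlt => ?_
  have htest : s₁ (V + 12) = Data.ofBool (colorClass (u ^ e) d a w) := by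
    rw [h₁, ← eval_testFn hcol w a (s (V + 1))]
    simp [Expr.eval, ha]
  have hlow (v) (hv : v < V + 9) : s₁ v = s v := by
    simp (disch := omega) [hlt, Function.update_of_ne]
  have hcount : s₁ (V + 10) = Data.ofNat R := by simp [hlt, Expr.eval, hR, Data.ofNat_succ]
  have hexample : s₁ (V + 11) = Data.ofExample (w, f w) := by simp [hlt, Data.ofExample]
  simp only [Prog.wp, Expr.eval, htest, Data.isPair_ofBool]
  split_ifs with hw <;> refine hK w _ (fun v hv => ?_) ?_ ?_
  any_goals simp (disch := omega) [hw, hlow, hcount, hexample, Function.update_of_ne]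
  rfl

theorem expectFirst_le_loopWp_searchBody {κ : Option (Cube n) → ℝ} {R m : ℕ} (hm : R < m)
    (hcol : ColorBound u c e d n) (huW : u < W) (hu : s V = Data.ofNat u)
    (ha : s (V + 2) = Data.ofNat a) (hnil : s (V + 9) = .nil) (hR : s (V + 10) = Data.ofNat R)
    (hK : ∀ (z : Option (Cube n)) s', (∀ v < V + 9, s' v = s v) →
      s' (V + 9) = z.elim .nil (fun z => Data.ofExample (z, f z)) → κ z ≤ K s') :
    expectFirst (colorClass (u ^ e) d a) κ R ≤
      loopWp (var (V + 10)) ((searchBody V c e d).wp W f) K m s := by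
  induction R generalizing m s with
  | zero =>
    obtain ⟨m, rfl⟩ := Nat.exists_eq_succ_of_ne_zero hm.ne'
    simp only [loopWp_succ, Expr.eval, hR, Data.ofNat_zero]
    exact hK none s (fun _ _ => rfl) hnil
  | succ R ih =>
    obtain ⟨m, rfl⟩ : ∃ m', m = m' + 2 := ⟨m - 2, by omega⟩
    simp only [loopWp_succ _ s, Expr.eval, hR, Data.ofNat_succ]
    refine expect_le_wp_searchBody hcol huW hu ha hR fun w s' hlow hexample hcount => ?_
    split_ifs at hexample hcount ⊢ with hw
    · simp only [loopWp_succ, Expr.eval, hcount, Data.ofNat_zero]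
      exact hK (some w) s' hlow hexample
    · exact ih (by omega) (by rw [hlow V (by omega), hu]) (by rw [hlow _ (by omega), ha]) hexample
        hcount fun z s'' hlow' => hK z s'' fun v hv => (hlow' v hv).trans (hlow v hv)

theorem expectFirst_le_wp_searchProg {κ : Option (Cube n) → ℝ}
    (hcol : ColorBound u c e d n) (huW : u < W) (hρ : u ^ ρ < W) (hu : s V = Data.ofNat u)
    (ha : s (V + 2) = Data.ofNat a)
    (hK : ∀ (z : Option (Cube n)) s', (∀ v < V + 9, s' v = s v) →
      s' (V + 9) = z.elim .nil (fun z => Data.ofExample (z, f z)) → κ z ≤ K s') :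
    expectFirst (colorClass (u ^ e) d a) κ (u ^ ρ) ≤ (searchProg V c e d ρ).wp W f K s := by
  refine computes_compile (by omega) huW (incFn ρ) (by simp [hu]) fun s₁ h₁ hlt => ?_
  have hlow (v) (hv : v < V + 9) : s₁ v = s v := by
    simp (disch := omega) [hlt, Function.update_of_ne]
  refine expectFirst_le_loopWp_searchBody hρ hcol huW (by rw [hlow V (by omega), hu])
    (by rw [hlow _ (by omega), ha]) (by simp [hlt, Expr.eval]) ?_
    fun z s' hlow' => hK z s' fun v hv => (hlow' v hv).trans (hlow v hv)
  rw [h₁, Function.update_self, Expr.eval, ← Data.ofNat_zero, eval_incFn, add_zero]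

theorem le_wp_recordProg {v : ℝ} {z : Cube n} {b : Bool} (hn : n ≤ u) (huW : u < W)
    (hl : D.length ≤ u ^ l) (hs : SimStore V u n a o τ D s₀ s)
    (hz : s (V + 9) = Data.ofExample (z, b))
    (hK : ∀ s', SimStore V u n a o τ (insertLabel D (z, b)) s₀ s' → s' (V + 7) = s (V + 7) →
      s' (V + 8) = s (V + 8) → s' (V + 9) = s (V + 9) → v ≤ K s') :
    v ≤ (recordProg V l).wp W f K s := by
  refine computes_compile (by omega) huW (lookupFn l) (by simp [hs.driver]) fun s₁ h₁ hlt => ?_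
  have hs₁ : SimStore V u n a o τ D s₀ s₁ := (hs.update_high (v := V + 11) (by omega) _).congr
    fun v hv => hlt v (by omega)
  simp only [Function.update_self, Expr.eval, hs.memo, hz, Data.ofExample, Data.head_cons,
    eval_lookupFn hn D hl z] at h₁
  simp only [Prog.wp, Expr.eval, h₁]
  rcases hlookup : D.lookup z with _ | b'
  · have hinsert : insertLabel D (z, b) = (z, b) :: D := by simp [insertLabel, hlookup]
    have hcons : Data.cons (s₁ (V + 9)) (s₁ (V + 3)) = Data.ofTable (insertLabel D (z, b)) := by
      rw [hinsert, hs₁.memo, hlt _ (by omega), Function.update_of_ne (by omega), hz]; rfl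
    simp only [Data.ofOption_none, Data.isPair_nil, Bool.false_eq_true, if_false, hcons]
    exact hK _ (hs₁.update_memo _) (by simp [hlt]) (by simp [hlt]) (by simp [hlt])
  · have hinsert : insertLabel D (z, b) = D := by simp [insertLabel, hlookup]
    exact hK _ (by rw [hinsert]; exact hs₁.update_high (by omega) _) (by simp [hlt])
      (by simp [hlt]) (by simp [hlt])

theorem le_wp_moveProg {v : ℝ} {x y z : Cube n} {b : Bool} (hn : n ≤ u) (huW : u < W)
    (hs : SimStore V u n a o τ D s₀ s) (hx : s (V + 7) = Data.ofPoint x)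
    (hy : s (V + 8) = .cons (Data.ofPoint y) .nil) (hz : s (V + 9) = Data.ofExample (z, b))
    (hK : ∀ s', SimStore V u n a o τ D s₀ s' → s' (V + 7) = Data.ofPoint (x ∆ y ∆ z) →
      v ≤ K s') : v ≤ (moveProg V).wp W f K s := by
  refine computes_compile (by omega) huW xorFn (by simp [hs.driver]) fun s₁ h₁ hlt =>
    hK s₁ ((hs.update_high le_rfl _).congr fun v hv => hlt v (by omega)) ?_
  simp only [h₁, Function.update_self, Expr.eval, hs.dim, hx, hy, hz, Data.ofExample,
    Data.head_cons, eval_xorFn hn, Data.toPoint_ofPoint]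

theorem expectExample_le_wp_drawProg {κ : Cube n → Bool → Memo n → ℝ} {v : ℕ} (hv : v < V)
    (hcol : ColorBound u c e d n) (huW : u < W) (hρ : u ^ ρ < W) (hl : D.length + 1 ≤ u ^ l)
    (hs : SimStore V u n a o τ D s₀ s)
    (hK : ∀ x b D' s', D'.length ≤ D.length + 2 → SimStore V u n a o τ D'
      (Function.update s₀ v (.cons (Data.ofPoint x) (Data.ofBool b))) s' → κ x b D' ≤ K s') :
    expectExample f (colorClass (u ^ e) d a) k (u ^ ρ) D κ ≤
      (drawProg V c e d k ρ l v).wp W f K s := by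
  have hn := hcol.dim_le
  refine Finset.expect_le_expect fun x _ => ?_
  refine computes_compile (by omega) huW (nearFn c e d k) (by simp [hs.driver])
    fun s₁ h₁ hlt => ?_
  have hs₁ : SimStore V u n a o τ D s₀ s₁ := hs.congr fun v hv => by
    simp (disch := omega) [hlt, Function.update_of_ne]
  have hx₁ : s₁ (V + 7) = Data.ofPoint x := by simp [hlt, Expr.eval]
  have hnear : s₁ (V + 8) = Data.ofOption Data.ofPoint (nearest (colorClass (u ^ e) d a) k x) := by
    rw [h₁, ← eval_nearFn hcol, ← hs.dim, ← hs.col]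
    simp [Expr.eval]
  have hlabel (x' : Cube n) (D' : Memo n) (s₂ : Store) (hD' : D'.length ≤ D.length + 1)
      (hs₂ : SimStore V u n a o τ D' s₀ s₂) (hx₂ : s₂ (V + 7) = Data.ofPoint x') :
      expectLabel D' x' (κ x') ≤ (labelProg V l).wp W f
        (fun s => K (Function.update s v (Data.cons (s (V + 7)) (s (V + 8))))) s₂ := by
    refine expectLabel_le_wp_labelProg hn huW (by omega) hs₂ hx₂ fun b D'' s₃ hD'' hs₃ h7 h8 => ?_
    rw [h7, h8]
    exact hK x' b D'' _ (by omega) (hs₃.update_low hv _)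
  simp only [Prog.wp, Expr.eval, hnear]
  generalize nearest (colorClass (u ^ e) d a) k x = o at hnear ⊢
  rcases o with _ | y
  · exact hlabel x D _ (by omega) (hs₁.update_high (by omega) _) (by simp [hx₁])
  refine expectFirst_le_wp_searchProg hcol huW hρ hs₁.driver hs₁.col fun z s₂ hlow h9 => ?_
  have hs₂ := hs₁.congr fun v hv => hlow v (by omega)
  have hx₂ := (hlow (V + 7) (by omega)).trans hx₁
  have hy₂ := (hlow (V + 8) (by omega)).trans hnear
  simp only [h9]
  rcases z with _ | z
  · exact hlabel x D _ (by omega) (hs₂.update_high (by omega) _) (by simp [hx₂])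
  · refine le_wp_recordProg hn huW (by omega) hs₂ h9 fun s₃ hs₃ h7 h8 h9' => ?_
    exact le_wp_moveProg hn huW hs₃ (h7.trans hx₂) (h8.trans hy₂) (h9'.trans h9)
      fun s₄ hs₄ hx₄ => hlabel _ _ s₄ (length_insertLabel_le D _) hs₄ hx₄

theorem simulatedPayoff_le_stackWp {Ψ : Store → ℝ} (hcol : ColorBound u c e d n) {W₀ : ℕ}
    (huW : u < W₀) (hρ : u ^ ρ < W₀) (hK₀ : 0 ≤ K)
    (hK : ∀ s₀ D s, SimStore V u n a o τ D s₀ s → Ψ s₀ ≤ K s) {t W : ℕ} (hW : W₀ + t ≤ W)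
    (todo : List Prog) (htodo : ∀ p ∈ todo, p.bound ≤ V) (s₀ s : Store) (D : Memo n)
    (hD : D.length + 2 * t ≤ u ^ l) (hs : SimStore V u n a o τ D s₀ s) :
    simulatedPayoff f (colorClass (u ^ e) d a) k (u ^ ρ) Ψ t todo s₀ D ≤
      stackWp W f (todo.map (Prog.simulate V c e d k ρ l)) K s := by
  induction t generalizing W todo s₀ s D with
  | zero =>
    rcases todo with _ | ⟨p, r⟩
    exacts [hK _ _ _ hs, stackWp_nonneg hK₀ _ _]
  | succ t ih =>
    rcases todo with _ | ⟨p, r⟩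
    · exact hK _ _ _ hs
    obtain ⟨W, rfl⟩ : ∃ W', W = W' + 1 := ⟨W - 1, by omega⟩
    have hW' : W₀ + t ≤ W + 1 := by omega
    have hD' : D.length + 2 * t ≤ u ^ l := by omega
    obtain ⟨hp, hr⟩ := List.forall_mem_cons.mp htodo
    cases p <;> simp only [Prog.bound, max_le_iff] at hp
    case assign v e' =>
      rw [simulatedPayoff, ← Expr.eval_congr hs.low e' hp.2]
      exact ih hW' r hr _ _ D hD' (hs.update_low hp.1 _)
    case seq p q =>
      exact ih hW' (p :: q :: r) (by simp only [List.forall_mem_cons]; exact ⟨hp.1, hp.2, hr⟩)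
        _ _ D hD' hs
    case cond e' p q =>
      simp only [List.map_cons, Prog.simulate, stackWp_cons, Prog.wp, simulatedPayoff,
        Expr.eval_congr hs.low e' hp.1]
      split_ifs
      · exact ih hW' (p :: r) (List.forall_mem_cons.mpr ⟨hp.2.1, hr⟩) _ _ D hD' hs
      · exact ih hW' (q :: r) (List.forall_mem_cons.mpr ⟨hp.2.2, hr⟩) _ _ D hD' hs
    case loop e' p =>
      rw [simulatedPayoff, ← Expr.eval_congr hs.low e' hp.1]
      refine le_trans ?_ (stackWp_unfold_loop_le hK₀ e' (p.simulate V c e d k ρ l) _ s)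
      have htodo' : ∀ q ∈ (if (e'.eval s).isPair then p :: .loop e' p :: r else r),
          q.bound ≤ V := by
        split_ifs
        exacts [List.forall_mem_cons.mpr ⟨hp.2, htodo⟩, hr]
      refine (ih (W := W) (by omega) _ htodo' s₀ s D hD' hs).trans_eq ?_
      congr 1
      split_ifs <;> rfl
    case flip v =>
      exact Finset.expect_le_expect fun b _ => ih hW' r hr _ _ D hD' (hs.update_low hp _)
    case draw v =>
      exact expectExample_le_wp_drawProg hp hcol (by omega) (by omega) (by omega) hs
        fun x b D' s' hl' hs' => ih hW' r hr _ _ D' (by omega) hs'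
    case query v =>
      exact expectLabel_le_wp_queryProg hp hcol.dim_le (by omega) (by omega) hs
        fun b D' s' hl' hs' => ih hW' r hr _ _ D' (by omega) hs'

end

end simulate

/-! ### The learner without queries -/

/-- Programs that make no queries. -/
def Prog.QueryFree : Prog → Prop
  | .seq p q => p.QueryFree ∧ q.QueryFree
  | .cond _ p q => p.QueryFree ∧ q.QueryFree
  | .loop _ p => p.QueryFree
  | .query _ => False
  | _ => True

theorem Prog.Deterministic.queryFree {p : Prog} (h : p.Deterministic) : p.QueryFree := by
  induction p with
  | seq p q ihp ihq => exact ⟨ihp h.1, ihq h.2⟩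
  | cond e p q ihp ihq => exact ⟨ihp h.1, ihq h.2⟩
  | loop e p ih => exact ih h
  | query v => exact h
  | _ => trivial

theorem queryFree_of_mem_support_step {n : ℕ} {f : Cube n → Bool} {c c' : Config n}
    (h : ∀ p ∈ c.todo, p.QueryFree) (hc : c' ∈ (step f c).support) :
    ∀ p ∈ c'.todo, p.QueryFree := by
  obtain ⟨_ | ⟨p, r⟩, s, S⟩ := c
  · obtain rfl : c' = ⟨[], s, S⟩ := by simpa [step] using hc
    exact h
  obtain ⟨hp, hr⟩ := List.forall_mem_cons.mp h
  cases p <;> simp only [step, PMF.mem_support_bind_iff, PMF.support_pure,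
    Set.mem_singleton_iff] at hc
  case seq p q =>
    subst hc
    simp only [List.forall_mem_cons]
    exact ⟨hp.1, hp.2, hr⟩
  case cond e p q =>
    subst hc
    refine List.forall_mem_cons.mpr ⟨?_, hr⟩
    split_ifs
    exacts [hp.1, hp.2]
  case loop e p =>
    subst hc
    dsimp only
    split_ifs
    exacts [List.forall_mem_cons.mpr ⟨hp, h⟩, hr]
  case query v => exact hp.elim
  case assign v e => subst hc; exact hr
  all_goals obtain ⟨_, -, rfl⟩ := hc; exact hr

theorem obeys_of_queryFree {n : ℕ} (rule : QueryRule) (f : Cube n → Bool) (c : Config n)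
    (h : ∀ p ∈ c.todo, p.QueryFree) : Obeys rule f c := by
  intro t
  induction t generalizing c with
  | zero =>
    intro c' hc' v r hr
    obtain rfl : c' = c := by simpa [runFor] using hc'
    exact (h (.query v) (by simp [hr])).elim
  | succ t ih =>
    intro c'' hc''
    rw [runFor_succ', PMF.mem_support_bind_iff] at hc''
    obtain ⟨c', hc', hc''⟩ := hc''
    exact ih c' (queryFree_of_mem_support_step h hc') c'' hc''

theorem Fn.compile_queryFree (w b : ℕ) (F : Fn) : (F.compile w b).QueryFree :=
  (F.compile_deterministic w b).queryFree

theorem Prog.simulate_queryFree (V c e d k ρ l : ℕ) (p : Prog) :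
    (p.simulate V c e d k ρ l).QueryFree := by
  induction p <;> simp_all [Prog.simulate, Prog.QueryFree, drawProg, queryProg, labelProg,
    searchProg, searchBody, recordProg, moveProg, Fn.compile_queryFree]

section learner

open LocalQueries.Expr (var)

/-- The program that sets the variables below `m` to `nil`. -/
def clearProg : ℕ → Prog
  | 0 => .assign 0 (var 0)
  | m + 1 => .seq (clearProg m) (.assign m .nil)

/-- The program that sets variable `V` to the sum of the three inputs and two, and variable `V + 1`
to the first input. -/
def initProg (V : ℕ) : Prog :=
  .seq (.assign V (.cons .nil (.cons .nil .nil))) (.seq ((incFn 1).compile 0 V)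
    (.seq ((incFn 1).compile 1 V) (.seq ((incFn 1).compile 2 V) (.assign (V + 1) (var 0)))))

/-- One round of the collection of examples: the counter in variable `V + 6` goes down and an
example is put in front of the list in variable `V + 5`. -/
def tableBody (V : ℕ) : Prog :=
  .seq (.assign (V + 6) (.tail (var (V + 6)))) (.seq (.draw (V + 7))
    (.assign (V + 5) (.cons (var (V + 7)) (var (V + 5)))))

/-- The program that collects `u ^ l` random examples in variable `V + 5`, where `u` is the number
in variable `V`. -/
def tableProg (V l : ℕ) : Prog :=
  .seq (.assign (V + 5) .nil) (.seq (.assign (V + 6) .nil) (.seq ((incFn l).compile V (V + 6))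
    (.loop (var (V + 6)) (tableBody V))))

/-- The program that prepares the store for a simulation of a learner whose inputs are the
dimension and twice the number `u ^ γ`. -/
def inputProg (V γ : ℕ) : Prog :=
  .seq (.assign (V + 7) .nil) (.seq ((incFn γ).compile V (V + 7)) (.seq (clearProg V)
    (.seq (.assign 0 (var (V + 1))) (.seq (.assign 1 (var (V + 7))) (.assign 2 (var (V + 7)))))))

/-- The program that simulates `L` for the current colour and puts its hypothesis in front of the
list in variable `V + 4`. -/
def colorProg (V c e d k ρ l γ : ℕ) (L : Prog) : Prog :=
  .seq (inputProg V γ) (.seq (L.simulate V c e d k ρ l)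
    (.seq (.assign (V + 4) (.cons (var 0) (var (V + 4)))) (.assign (V + 3) .nil)))

/-- The program that simulates `L` for all `u ^ c` colours. -/
def colorsProg (V c e d k ρ l γ : ℕ) (L : Prog) : Prog :=
  .seq (.assign (V + 7) .nil) (.seq ((incFn c).compile V (V + 7)) (.seq
    (.assign (V + 2) (var (V + 7))) (.seq (.assign (V + 3) .nil) (.seq (.assign (V + 4) .nil)
      (.loop (var (V + 2)) (.seq (.assign (V + 2) (.tail (var (V + 2))))
        (colorProg V c e d k ρ l γ L)))))))

/-- The learner that uses random examples only. Its hypothesis consists of the number `u`, a table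
of examples and the list of the hypotheses for the colours. -/
def learnerProg (V c e d k ρ l γ : ℕ) (L : Prog) : Prog :=
  .seq (initProg V) (.seq (tableProg V l) (.seq (colorsProg V c e d k ρ l γ L)
    (.assign 0 (.cons (var V) (.cons (var (V + 5)) (var (V + 4)))))))

theorem clearProg_queryFree (m : ℕ) : (clearProg m).QueryFree := by
  induction m <;> simp_all [clearProg, Prog.QueryFree]

theorem learnerProg_queryFree (V c e d k ρ l γ : ℕ) (L : Prog) :
    (learnerProg V c e d k ρ l γ L).QueryFree := by
  simp [learnerProg, initProg, tableProg, tableBody, colorsProg, colorProg, inputProg,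
    Prog.QueryFree, Fn.compile_queryFree, clearProg_queryFree, Prog.simulate_queryFree]

/-- The table of the labels of a list of points. -/
def labelTable {n : ℕ} (f : Cube n → Bool) (xs : List (Cube n)) : Memo n :=
  xs.map fun x => (x, f x)

theorem lookup_labelTable {n : ℕ} (f : Cube n → Bool) (xs : List (Cube n)) (x : Cube n) :
    (labelTable f xs).lookup x = if x ∈ xs then some (f x) else none := by
  induction xs with
  | nil => rfl
  | cons y xs ih =>
    rw [labelTable, List.map_cons, List.lookup_cons, ← labelTable, ih]
    by_cases h : x = y
    · simp [h]
    · simp [h, beq_false_of_ne h]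

/-- The expectation of `F` at a list with `m` more random points than `xs`. -/
noncomputable def expectSample {n : ℕ} (F : List (Cube n) → ℝ) : ℕ → List (Cube n) → ℝ
  | 0, xs => F xs
  | m + 1, xs => 𝔼 x, expectSample F m (x :: xs)

/-- The initial store of a learner in dimension `n` whose other two inputs are `m`. -/
def learnerStore (n m : ℕ) : Store := fun v =>
  [Data.ofNat n, Data.ofNat m, Data.ofNat m].getD v .nil

variable {V u n a c e d k ρ l γ W W₀ T : ℕ} {f : Cube n → Bool} {L : Prog} {K : Store → ℝ}
  {s s₀ : Store} {o τ : Data} {D : Memo n} {p v : ℝ}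

theorem wp_clearProg (m : ℕ) :
    (clearProg m).wp W f K s = K fun v => if v < m then .nil else s v := by
  induction m generalizing K with
  | zero => simp [clearProg, Prog.wp, Expr.eval]
  | succ m ih =>
    simp only [clearProg, Prog.wp, ih]
    congr 1
    funext v
    rcases eq_or_ne v m with rfl | hv
    · simp [Expr.eval]
    · simp [hv, hv.le_iff_lt]

theorem le_wp_initProg {b : ℕ} (hV : 3 ≤ V) (ha : a < W) (hb : b < W) (hc : c < W)
    (h0 : s 0 = Data.ofNat a) (h1 : s 1 = Data.ofNat b) (h2 : s 2 = Data.ofNat c)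
    (hK : ∀ s', s' V = Data.ofNat (a + b + c + 2) → s' (V + 1) = Data.ofNat a → v ≤ K s') :
    v ≤ (initProg V).wp W f K s := by
  refine computes_compile (u := a) (by omega) ha (incFn 1) ?_ fun s₁ h₁ hlt₁ => ?_
  · simp (disch := omega) [h0, Function.update_of_ne]
  refine computes_compile (u := b) (by omega) hb (incFn 1) ?_ fun s₂ h₂ hlt₂ => ?_
  · simp (disch := omega) [h1, hlt₁, Function.update_of_ne]
  refine computes_compile (u := c) (by omega) hc (incFn 1) ?_ fun s₃ h₃ hlt₃ => ?_
  · simp (disch := omega) [h2, hlt₁, hlt₂, Function.update_of_ne]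
  have htwo : Function.update s V (Expr.eval s (.cons .nil (.cons .nil .nil))) V =
      Data.ofNat 2 := Function.update_self _ _ _
  rw [htwo, eval_incFn] at h₁
  rw [h₁, eval_incFn] at h₂
  rw [h₂, eval_incFn] at h₃
  refine hK _ ?_ ?_
  · rw [Function.update_of_ne (by omega), h₃]
    congr 1
    ring
  · simp (disch := omega) [Expr.eval, h0, hlt₁, hlt₂, hlt₃, Function.update_of_ne]

theorem expectSample_le_loopWp_tableBody {F : List (Cube n) → ℝ} {i m : ℕ} {xs : List (Cube n)}
    (hi : i < m) (hs : s (V + 5) = Data.ofTable (labelTable f xs))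
    (hcount : s (V + 6) = Data.ofNat i)
    (hK : ∀ ys s', ys.length = i + xs.length → (∀ v < V + 5, s' v = s v) →
      s' (V + 5) = Data.ofTable (labelTable f ys) → F ys ≤ K s') :
    expectSample F i xs ≤ loopWp (var (V + 6)) ((tableBody V).wp W f) K m s := by
  induction i generalizing m xs s with
  | zero =>
    obtain ⟨m, rfl⟩ := Nat.exists_eq_succ_of_ne_zero hi.ne'
    simp only [loopWp_succ, Expr.eval, hcount, Data.ofNat_zero]
    exact hK xs s (zero_add _).symm (fun _ _ => rfl) hs
  | succ i ih =>
    obtain ⟨m, rfl⟩ := Nat.exists_eq_succ_of_ne_zero (Nat.ne_zero_of_lt hi)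
    simp only [loopWp_succ, Expr.eval, hcount, Data.ofNat_succ]
    refine Finset.expect_le_expect fun x _ => ih (by omega) ?_ ?_
      fun ys s' hys hlow => hK ys s' (by rw [hys, List.length_cons]; omega) fun v hv => ?_
    · simp [Expr.eval, hs]
      rfl
    · simp [Expr.eval, hcount, Data.ofNat_succ]
    · rw [hlow v hv]
      simp (disch := omega) [Function.update_of_ne]

theorem expectSample_le_wp_tableProg {F : List (Cube n) → ℝ} (huW : u < W) (hl : u ^ l < W)
    (hu : s V = Data.ofNat u)
    (hK : ∀ xs s', xs.length = u ^ l → (∀ v < V + 5, s' v = s v) →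
      s' (V + 5) = Data.ofTable (labelTable f xs) → F xs ≤ K s') :
    expectSample F (u ^ l) [] ≤ (tableProg V l).wp W f K s := by
  refine computes_compile (by omega) huW (incFn l) (by simp [hu]) fun s₁ h₁ hlt => ?_
  refine expectSample_le_loopWp_tableBody hl (by simp [hlt, Expr.eval]; rfl) ?_
    fun ys s' hys hlow => hK ys s' hys fun v hv => ?_
  · rw [h₁, Function.update_self, Expr.eval, ← Data.ofNat_zero, eval_incFn, add_zero]
  · rw [hlow v hv]
    simp (disch := omega) [hlt, Function.update_of_ne]

theorem le_wp_inputProg (hV : 3 ≤ V) (huW : u < W) (hs : SimStore V u n a o τ D s₀ s)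
    (hK : ∀ s', SimStore V u n a o τ D (learnerStore n (u ^ γ)) s' → v ≤ K s') :
    v ≤ (inputProg V γ).wp W f K s := by
  refine computes_compile (by omega) huW (incFn γ) (by simp [hs.driver]) fun s₁ h₁ hlt => ?_
  rw [Function.update_self, Expr.eval, ← Data.ofNat_zero, eval_incFn, add_zero] at h₁
  have hs₁ := (hs.update_high le_rfl _).congr hlt
  simp only [Prog.wp, wp_clearProg]
  set s₂ : Store := fun v => if v < V then .nil else s₁ v with hs₂
  have hhigh (v) (hv : V ≤ v) : s₂ v = s₁ v := if_neg (by omega)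
  have hclear : SimStore V u n a o τ D s₂ s₂ := by
    constructor
    · exact fun _ _ => rfl
    all_goals rw [hhigh _ (by omega)]
    exacts [hs₁.driver, hs₁.dim, hs₁.col, hs₁.memo, hs₁.out, hs₁.tab]
  have hin (d₀ d₁ d₂) := ((hclear.update_low (v := 0) (by omega) d₀).update_low (v := 1)
    (by omega) d₁).update_low (v := 2) (by omega) d₂
  refine hK _ { hin _ _ _ with low := fun v hv => ?_ }
  rcases v with _ | _ | _ | v
  · simp [Expr.eval, learnerStore, hclear.dim]
  · simp [Expr.eval, learnerStore, hhigh, h₁]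
  · simp [Expr.eval, learnerStore, hhigh, h₁]
  · simp [hs₂, hv, learnerStore]

theorem le_wp_colorProg {P : Data → Prop} (hV : 3 ≤ V) (hL : L.bound ≤ V)
    (hcol : ColorBound u c e d n) (huW : u < W₀) (hρ : u ^ ρ < W₀) (hW : W₀ + T ≤ W)
    (hT : 2 * T ≤ u ^ l)
    (hp : p ≤ simulatedPayoff f (colorClass (u ^ e) d a) k (u ^ ρ)
      ({s | P (s 0)}.indicator 1) T [L] (learnerStore n (u ^ γ)) [])
    (hs : SimStore V u n a o τ [] s₀ s) (hv : 0 ≤ v) (hK₀ : 0 ≤ K)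
    (hK : ∀ h s', P h → SimStore V u n a (.cons h o) τ [] s' s' → v ≤ K s') :
    p * v ≤ (colorProg V c e d k ρ l γ L).wp W f K s := by
  refine le_wp_inputProg hV (by omega) hs fun s₁ hs₁ => ?_
  refine le_trans ?_ (simulatedPayoff_le_stackWp (l := l)
    (K := (Prog.seq (.assign (V + 4) (.cons (var 0) (var (V + 4))))
      (.assign (V + 3) .nil)).wp W f K)
    (Ψ := fun s => v * {s : Store | P (s 0)}.indicator 1 s) hcol huW hρ (wp_nonneg _ hK₀)
    (fun s₂ D s₃ hs₃ => ?_) hW [L] (by simpa using hL) _ _ [] (by simpa using hT) hs₁)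
  · rw [simulatedPayoff_const_mul, mul_comm]
    exact mul_le_mul_of_nonneg_left hp hv
  · by_cases hP : s₂ ∈ {s : Store | P (s 0)}
    · rw [Set.indicator_of_mem hP, Pi.one_apply, mul_one]
      refine hK (s₂ 0) _ hP ⟨fun _ _ => rfl, ?_, ?_, ?_, Function.update_self _ _ _, ?_, ?_⟩
      all_goals simp [Expr.eval, hs₃.driver, hs₃.dim, hs₃.col, hs₃.out, hs₃.tab,
        hs₃.low 0 (by omega)]
    · rw [Set.indicator_of_notMem hP, mul_zero]
      exact hK₀ _

theorem le_wp_colorsProg {P : ℕ → Data → Prop} (hV : 3 ≤ V) (hL : L.bound ≤ V)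
    (hcol : ColorBound u c e d n) (huW : u < W₀) (hρ : u ^ ρ < W₀) (hc : u ^ c < W₀)
    (hW : W₀ + T ≤ W) (hT : 2 * T ≤ u ^ l) (hp₀ : 0 ≤ p)
    (hp : ∀ a, p ≤ simulatedPayoff f (colorClass (u ^ e) d a) k (u ^ ρ)
      ({s | P a (s 0)}.indicator 1) T [L] (learnerStore n (u ^ γ)) [])
    (hdriver : s V = Data.ofNat u) (hdim : s (V + 1) = Data.ofNat n) (htab : s (V + 5) = τ)
    (hv : 0 ≤ v) (hK₀ : 0 ≤ K)
    (hK : ∀ (hyps : List Data) s', hyps.length = u ^ c →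
      (∀ j (hj : j < hyps.length), P j hyps[j]) → s' V = Data.ofNat u →
      s' (V + 4) = Data.ofList hyps → s' (V + 5) = τ → v ≤ K s') :
    p ^ (u ^ c) * v ≤ (colorsProg V c e d k ρ l γ L).wp W f K s := by
  refine computes_compile (u := u) (by omega) (by omega) (incFn c) (by simp [hdriver])
    fun s₁ h₁ hlt => ?_
  rw [Function.update_self, Expr.eval, ← Data.ofNat_zero, eval_incFn, add_zero] at h₁
  refine le_loopWp_of_countdown (I := fun i s => ∃ (hyps : List Data) (s₀ : Store),
    SimStore V u n i (Data.ofList hyps) τ [] s₀ s ∧ hyps.length + i = u ^ c ∧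
      ∀ j (hj : j < hyps.length), P (i + j) hyps[j])
    (v := fun i => p ^ i * v) (fun i s ⟨_, _, hs, _⟩ => hs.col) ?_ ?_ (show u ^ c < W by omega) ?_
  · rintro i s m ⟨hyps, s₀, hs, hlen, hP⟩ ih
    have hs' : SimStore V u n i (Data.ofList hyps) τ [] s₀
        (Function.update s (V + 2) (Expr.eval s (.tail (var (V + 2))))) := by
      constructor
      · exact fun v hv => by rw [Function.update_of_ne (by omega), hs.low v hv]
      all_goals simp [Expr.eval, hs.driver, hs.dim, hs.col, hs.memo, hs.out, hs.tab,
        Data.ofNat_succ]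
    refine (by ring : p ^ (i + 1) * v = p * (p ^ i * v)).trans_le <|
      le_wp_colorProg (v := p ^ i * v) hV hL hcol huW hρ hW hT (hp i) hs' (by positivity)
        (loopWp_nonneg (fun _ => wp_nonneg _) hK₀ _) fun h s₂ hh hs₂ =>
          ih s₂ ⟨h :: hyps, s₂, hs₂, ?_, ?_⟩
    · rw [List.length_cons]
      omega
    · rintro (_ | j) hj
      · exact hh
      · rw [← Nat.succ_add_eq_add_succ]
        exact hP j (Nat.lt_of_succ_lt_succ hj)
  · rintro s ⟨hyps, s₀, hs, hlen, hP⟩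
    rw [pow_zero, one_mul]
    exact hK hyps s hlen (by simpa using hP) hs.driver hs.out hs.tab
  · refine ⟨[], _, ⟨fun _ _ => rfl, ?_, ?_, ?_, ?_, ?_, ?_⟩, by simp, by simp⟩
    any_goals simp [Expr.eval, hlt, hdriver, hdim, htab, h₁]
    all_goals rfl

theorem expectSample_le_wp_learnerProg {n₁ n₂ : ℕ} {P : ℕ → Data → Prop}
    {F : List (Cube n) → ℝ} (hV : 3 ≤ V) (hL : L.bound ≤ V) (hu : u = n + n₁ + n₂ + 2)
    (hcol : ColorBound u c e d n) (huW : u < W₀) (hρ : u ^ ρ < W₀) (hc : u ^ c < W₀)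
    (hl : u ^ l < W₀) (hW : W₀ + T ≤ W) (hT : 2 * T ≤ u ^ l) (hp₀ : 0 ≤ p)
    (hp : ∀ a, p ≤ simulatedPayoff f (colorClass (u ^ e) d a) k (u ^ ρ)
      ({s | P a (s 0)}.indicator 1) T [L] (learnerStore n (u ^ γ)) [])
    (h0 : s 0 = Data.ofNat n) (h1 : s 1 = Data.ofNat n₁) (h2 : s 2 = Data.ofNat n₂)
    (hF : 0 ≤ F) (hK₀ : 0 ≤ K)
    (hK : ∀ (xs : List (Cube n)) (hyps : List Data) s', hyps.length = u ^ c →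
      (∀ j (hj : j < hyps.length), P j hyps[j]) → xs.length = u ^ l → s' 0 = .cons (Data.ofNat u)
        (.cons (Data.ofTable (labelTable f xs)) (Data.ofList hyps)) → F xs ≤ K s') :
    expectSample (fun xs => p ^ (u ^ c) * F xs) (u ^ l) [] ≤
      (learnerProg V c e d k ρ l γ L).wp W f K s := by
  refine le_wp_initProg hV (by omega) (by omega) (by omega) h0 h1 h2 fun s₁ hdriver hdim => ?_
  rw [← hu] at hdriver
  refine expectSample_le_wp_tableProg (u := u) (by omega) (by omega) hdriver
    fun xs s₂ hxs hlow htab => ?_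
  refine le_wp_colorsProg hV hL hcol huW hρ hc hW hT hp₀ hp (by rw [hlow _ (by omega), hdriver])
    (by rw [hlow _ (by omega), hdim]) htab (hF xs) (wp_nonneg _ hK₀)
    fun hyps s₃ hlen hP hdriver₃ hout htab₃ => hK xs hyps _ hlen hP hxs ?_
  simp only [Function.update_self, Expr.eval, hdriver₃, hout, htab₃]

end learner

section expectSample
variable {n : ℕ}

theorem le_expectSample {F : List (Cube n) → ℝ} {v : ℝ} (h : ∀ xs, v ≤ F xs) (m : ℕ)
    (xs : List (Cube n)) : v ≤ expectSample F m xs := by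
  induction m generalizing xs with
  | zero => exact h xs
  | succ m ih => exact Finset.le_expect Finset.univ_nonempty fun x _ => ih _

theorem expect_sum_notMem_cons (xs : List (Cube n)) :
    (𝔼 x, ∑ y, if y ∈ x :: xs then (0 : ℝ) else 1) =
      (1 - 1 / 2 ^ n) * ∑ y, if y ∈ xs then 0 else 1 := by
  have hcons (x : Cube n) : (∑ y, if y ∈ x :: xs then (0 : ℝ) else 1) =
      (∑ y, if y ∈ xs then (0 : ℝ) else 1) - if x ∈ xs then 0 else 1 := by
    rw [← Fintype.sum_ite_eq' x fun y => if y ∈ xs then (0 : ℝ) else 1, ← Finset.sum_sub_distrib]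
    refine Finset.sum_congr rfl fun y _ => ?_
    by_cases hyx : y = x <;> by_cases hy : y ∈ xs <;> simp [hyx, hy]
  simp only [hcons, Finset.expect_sub_distrib, Fintype.expect_const]
  rw [Fintype.expect_eq_sum_div_card, Fintype.card_fun, Fintype.card_bool, Fintype.card_fin]
  push_cast
  ring

/-- Union bound: a fixed point is missed with probability `(1 - 1 / 2 ^ n) ^ m`. -/
theorem one_sub_le_expectSample_forall_mem (m : ℕ) (xs : List (Cube n)) :
    1 - (1 - 1 / 2 ^ n) ^ m * (∑ y, if y ∈ xs then 0 else 1) ≤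
      expectSample (fun xs => if ∀ x, x ∈ xs then 1 else 0) m xs := by
  induction m generalizing xs with
  | zero =>
    rw [expectSample, pow_zero, one_mul]
    split_ifs with h
    · simp [h]
    · obtain ⟨x, hx⟩ := not_forall.mp h
      have hle := Finset.single_le_sum (f := fun y => if y ∈ xs then (0 : ℝ) else 1)
        (fun y _ => by split_ifs <;> norm_num) (Finset.mem_univ x)
      simp only [hx, if_false] at hle
      linarith
  | succ m ih =>
    refine le_trans (le_of_eq ?_) (Finset.expect_le_expect fun x _ => ih (x :: xs))
    rw [Finset.expect_sub_distrib, ← Finset.mul_expect, expect_sum_notMem_cons,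
      Fintype.expect_const]
    ring

theorem one_sub_inv_le_expectSample_forall_mem {u c : ℕ} (hu : 0 < u) (hn : 2 ^ n ≤ u ^ c) :
    1 - 1 / (u : ℝ) ≤
      expectSample (n := n) (fun xs => if ∀ x, x ∈ xs then 1 else 0) (u ^ (2 * c + 1)) [] := by
  refine le_trans ?_ (one_sub_le_expectSample_forall_mem _ _)
  have hN : (1 : ℝ) ≤ 2 ^ n := one_le_pow₀ one_le_two
  have hNu : (2 : ℝ) ^ n ≤ u ^ c := by exact_mod_cast hn
  have hdecay := mul_one_sub_pow_le (p := 1 / (2 : ℝ) ^ n) (by positivity)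
    (div_le_one_of_le₀ hN (by positivity)) (u ^ (2 * c + 1))
  have hmiss : (1 - 1 / (2 : ℝ) ^ n) ^ u ^ (2 * c + 1) * 2 ^ n ≤ 1 / u := by
    calc (1 - 1 / (2 : ℝ) ^ n) ^ u ^ (2 * c + 1) * 2 ^ n
        = (2 ^ n) ^ 2 * (1 / 2 ^ n * (1 - 1 / (2 : ℝ) ^ n) ^ u ^ (2 * c + 1)) := by field_simp
      _ ≤ (2 ^ n) ^ 2 * (1 / ((u ^ (2 * c + 1) : ℕ) + 1)) := by gcongr
      _ ≤ (u ^ c) ^ 2 * (1 / u ^ (2 * c + 1)) := by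
        push_cast
        gcongr
        linarith
      _ = 1 / u := by
        rw [pow_succ (u : ℝ) (2 * c), ← pow_mul, mul_comm c 2]
        field_simp
  have hcard : (∑ y : Cube n, if y ∈ [] then (0 : ℝ) else 1) = 2 ^ n := by simp
  rw [hcard]
  linarith

end expectSample

/-! ### The evaluator -/

section evaluator

open LocalQueries.Expr (var)

/-- The program that evaluates the hypothesis for the colour of the point. The three inputs are in
the variables `0`, `1`, `2`, as at the start, and variable `V` holds the number `u`. -/
def colorEvalProg (V c e d : ℕ) (E : Prog) : Prog :=
  .seq (.assign (V + 1) (var 2)) (.seq ((colorFn c e d).compile V (V + 1)) (.seq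
    (.assign (V + 1) (.cons (var (V + 1)) (.tail (.tail (var 0))))) (.seq
      ((dropFn c).compile V (V + 1)) (.seq (.assign 0 (.head (var (V + 1)))) E))))

/-- The evaluator for the hypotheses of `learnerProg`: a point in the table gets the label from the
table, any other point gets the value of the hypothesis for its colour. -/
def evalProg (V c e d l : ℕ) (E : Prog) : Prog :=
  .seq (.assign V (.head (var 0))) (.seq (.assign (V + 1) (.cons (.head (.tail (var 0))) (var 2)))
    (.seq ((lookupFn l).compile V (V + 1)) (.cond (var (V + 1)) (.assign 0 (.head (var (V + 1))))
      (colorEvalProg V c e d E))))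

variable {V u n c e d l W T : ℕ} {E : Prog} {xs : List (Cube n)} {hyps : List Data} {s : Store}

theorem evalProg_deterministic (hE : E.Deterministic) :
    (evalProg V c e d l E).Deterministic := by
  simp only [evalProg, colorEvalProg, Prog.Deterministic, Fn.compile_deterministic, hE, and_self]

theorem Evaluates.mono {T' : ℕ} {D : Data} {h : Cube n → Bool} (hE : Evaluates E D T h)
    (hT : T ≤ T') : Evaluates E D T' h :=
  ⟨hE.1, fun x => (one_le_expectedPayoff_indicator_iff (S := {s | (s 0).isPair = h x})).mp <|
    (one_le_expectedPayoff_indicator_iff.mpr (hE.2 x)).trans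
      (expectedPayoff_mono_time (indicator_one_nonneg _) _ _ hT)⟩

theorem one_le_wp_of_evaluates {D : Data} {h : Cube n → Bool} {x : Cube n} (hE : E.bound ≤ V)
    (hV : 0 < V) (hT : T ≤ W) (hev : Evaluates E D T h)
    (hs : ∀ v < V, s v = [D, Data.ofNat n, Data.ofPoint x].getD v .nil) :
    1 ≤ E.wp W (fun _ : Cube n => false) ({s | (s 0).isPair = h x}.indicator 1) s := by
  refine (one_le_expectedPayoff_indicator_iff (S := {s | (s 0).isPair = h x})).mpr (hev.2 x)
    |>.trans (expectedPayoff_le_stackWp (V := V) (indicator_one_nonneg _) (fun s s' hss => ?_) hT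
      [E] (by simpa using hE) _ _ fun v hv => (hs v hv).symm)
  simp [Set.indicator, hss 0 hV]

theorem one_le_wp_colorEvalProg {D₀ D₁ : Data} {h : ℕ → Cube n → Bool} {x : Cube n} (hV : 3 ≤ V)
    (hE : E.bound ≤ V) (hcol : ColorBound u c e d n) (huW : u < W) (hT : T ≤ W)
    (hhyps : hyps.length = u ^ c)
    (hev : ∀ j (hj : j < hyps.length), Evaluates E hyps[j] T (h j))
    (hs : ∀ v < V, s v = [.cons D₀ (.cons D₁ (Data.ofList hyps)), Data.ofNat n,
      Data.ofPoint x].getD v .nil) (hsV : s V = Data.ofNat u) :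
    1 ≤ (colorEvalProg V c e d E).wp W (fun _ : Cube n => false)
      ({s | (s 0).isPair = h (color (u ^ e) d x) x}.indicator 1) s := by
  have hlt : color (u ^ e) d x < hyps.length := hhyps ▸ hcol.color_lt x
  refine computes_compile (u := u) (by omega) huW (colorFn c e d) (by simpa using hsV)
    fun s₁ h₁ hlow₁ => ?_
  rw [Function.update_self, Expr.eval, hs 2 (by omega)] at h₁
  refine computes_compile (u := u) (by omega) huW (dropFn c) (by simp [hlow₁, hsV])
    fun s₂ h₂ hlow₂ => ?_
  refine one_le_wp_of_evaluates (E := E) (D := hyps[color (u ^ e) d x]) (x := x) hE (by omega) hT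
    (hev _ hlt) fun v hv => ?_
  rcases eq_or_ne v 0 with rfl | hv₀
  · rw [Function.update_self, Expr.eval, Expr.eval, h₂, Function.update_self]
    simp only [Expr.eval, h₁]
    rw [hlow₁ 0 (by omega), Function.update_of_ne (by omega), hs 0 (by omega)]
    simp only [List.getD_cons_zero, List.getD_cons_succ, Data.tail]
    rw [eval_colorFn hcol, eval_dropFn (hcol.color_lt x).le, Data.head_iterate_tail_ofList hlt]
  · rw [Function.update_of_ne hv₀, hlow₂ v (by omega), Function.update_of_ne (by omega),
      hlow₁ v (by omega), Function.update_of_ne (by omega), hs v hv]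
    obtain ⟨v, rfl⟩ := Nat.exists_eq_succ_of_ne_zero hv₀
    rfl

theorem evaluates_evalProg {f : Cube n → Bool} {h : ℕ → Cube n → Bool} (hV : 3 ≤ V)
    (hE : E.bound ≤ V) (hcol : ColorBound u c e d n) (huW : u < W) (hT : T ≤ W)
    (hxs : xs.length ≤ u ^ l) (hhyps : hyps.length = u ^ c)
    (hev : ∀ j (hj : j < hyps.length), Evaluates E hyps[j] T (h j)) :
    Evaluates (evalProg V c e d l E)
      (.cons (Data.ofNat u) (.cons (Data.ofTable (labelTable f xs)) (Data.ofList hyps)))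
      ((evalProg V c e d l E).cost W)
      fun x => if x ∈ xs then f x else h (color (u ^ e) d x) x := by
  have hdet := (hev _ (hhyps ▸ hcol.color_lt fun _ => false)).1
  refine ⟨evalProg_deterministic hdet, fun x => ?_⟩
  set b : Bool := if x ∈ xs then f x else h (color (u ^ e) d x) x with hb
  refine (one_le_expectedPayoff_indicator_iff (S := {s | (s 0).isPair = b})).mp ?_
  rw [← zero_add ((evalProg V c e d l E).cost W)]
  refine le_trans ?_ (wp_le_expectedPayoff (r := []) (indicator_one_nonneg {s | (s 0).isPair = b})
    (fun s => (expectedPayoff_nil _ s).ge) _)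
  refine computes_compile (u := u) (by omega) huW (lookupFn l) (by simp [start, Expr.eval])
    fun s₁ h₁ hlow => ?_
  have hs₁ (v) (hv : v < V) : s₁ v = [Data.cons (Data.ofNat u) (.cons
      (Data.ofTable (labelTable f xs)) (Data.ofList hyps)), Data.ofNat n,
      Data.ofPoint x].getD v .nil := by
    rw [hlow v (by omega), Function.update_of_ne (by omega), Function.update_of_ne (by omega)]
    rfl
  have hlookup : s₁ (V + 1) = Data.ofOption Data.ofBool (if x ∈ xs then some (f x) else none) := by
    rw [h₁, Function.update_self, ← lookup_labelTable, ← eval_lookupFn hcol.dim_le (c := l) _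
      (by simpa [labelTable] using hxs)]
    simp only [Expr.eval]
    rw [Function.update_of_ne (by omega), Function.update_of_ne (by omega)]
    rfl
  simp only [Prog.wp, Expr.eval, hlookup]
  by_cases hx : x ∈ xs
  · simp only [hx, if_true] at hb ⊢
    refine one_le_indicator_one ?_
    cases hf : f x <;> simp [hb, hf, Data.ofOption, Data.ofBool]
  · simp only [hx, if_false] at hb ⊢
    rw [hb]
    exact one_le_wp_colorEvalProg hV hE hcol huW hT hhyps hev hs₁
      (by simp [hlow, start, Expr.eval])

end evaluator

/-! ### The reduction -/

theorem efficientlyAgnosticallyLearnable_iff {rule : QueryRule} {C : ConceptClass} :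
    EfficientlyAgnosticallyLearnable rule C ↔ ∃ (L E : Prog) (K : ℕ), ∀ (n : ℕ) (ε δ : ℝ),
      0 < ε → 0 < δ → ∀ f : Cube n → Bool, Obeys rule f (learnerStart L n ε δ) ∧
        1 ≤ expectedPayoff f ({s | ∃ h : Cube n → Bool,
          Evaluates E (s 0) (timeBound K n ε δ) h}.indicator 1) (timeBound K n ε δ) [L]
          (learnerStart L n ε δ).store ∧
        1 - δ ≤ expectedPayoff f ((accurateStores E (timeBound K n ε δ) (C n) ε f).indicator 1)
          (timeBound K n ε δ) [L] (learnerStart L n ε δ).store := by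
  refine exists_congr fun L => exists_congr fun E => exists_congr fun K => forall_congr' fun n =>
    forall_congr' fun ε => forall_congr' fun δ => forall_congr' fun _ => forall_congr' fun _ =>
    forall_congr' fun f => and_congr_right fun _ => ?_
  rw [show [L] = (learnerStart L n ε δ).todo from rfl, one_le_expectedPayoff_indicator_iff]
  exact and_congr_right fun hhalt =>
    ofReal_le_toOuterMeasure_runFor_iff (S := accurateStores E (timeBound K n ε δ) (C n) ε f)
      fun c hc => (hhalt c hc).1

theorem sum_errOn {n M : ℕ} {col : Cube n → ℕ} (hcol : ∀ x, col x < M) (h : ℕ → Cube n → Bool)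
    (f : Cube n → Bool) :
    ∑ a ∈ Finset.range M, errOn (fun y => decide (col y = a)) (h a) f =
      err (fun x => h (col x) x) f := by
  simp only [errOn, err_eq_expect, ← Finset.expect_sum_comm]
  refine Finset.expect_congr rfl fun x _ => ?_
  rw [Finset.sum_eq_single_of_mem (col x) (Finset.mem_range.mpr (hcol x))]
  · simp
  · intro a _ ha
    simp [ha.symm]

theorem err_le_of_errOn_le {n M : ℕ} {col : Cube n → ℕ} (hcol : ∀ x, col x < M)
    {h : ℕ → Cube n → Bool} {f g h' : Cube n → Bool} {η : ℝ}
    (hh : ∀ a < M, errOn (fun y => decide (col y = a)) (h a) f ≤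
      errOn (fun y => decide (col y = a)) g f + η)
    (hh' : ∀ x, h' x = f x ∨ h' x = h (col x) x) : err h' f ≤ err g f + M * η := by
  calc err h' f ≤ err (fun x => h (col x) x) f := by
        simp only [err_eq_expect]
        refine Finset.expect_le_expect fun x _ => ?_
        rcases hh' x with hx | hx <;> rw [hx]
        split_ifs <;> simp_all
    _ ≤ ∑ a ∈ Finset.range M, (errOn (fun y => decide (col y = a)) g f + η) := by
        rw [← sum_errOn hcol]
        exact Finset.sum_le_sum fun a ha => hh a (Finset.mem_range.mp ha)
    _ = err g f + M * η := by
        rw [Finset.sum_add_distrib, sum_errOn hcol fun _ => g, Finset.sum_const, Finset.card_range,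
          nsmul_eq_mul]

theorem sparse_colorClass {q k n : ℕ} (hq : n ^ (2 * k) < q) (a : ℕ) :
    Sparse (colorClass (n := n) q (2 * k) a) k := by
  intro x y z hy hz hxy hxz
  simp only [colorClass, decide_eq_true_eq] at hy hz
  refine eq_of_color_eq hq (hy.trans hz.symm) ((hammingDist_triangle_left y z x).trans ?_)
  omega

theorem timeBound_le_pow {K n u γ : ℕ} {ε : ℝ} (hu : 2 ≤ u) (hn : n ≤ u) (hγ : 1 ≤ γ)
    (hε : ⌈1 / ε⌉₊ = u ^ γ) : timeBound K n ε ε ≤ u ^ (K + (γ + 2) * K) := by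
  have hself : u ≤ u ^ γ := Nat.le_self_pow (by omega) u
  have hsq : 4 ≤ u ^ 2 := Nat.pow_le_pow_left hu 2
  rw [timeBound, hε, pow_add, pow_mul]
  refine Nat.mul_le_mul ?_ (Nat.pow_le_pow_left ?_ K)
  · exact Nat.lt_two_pow_self.le.trans (Nat.pow_le_pow_left hu K)
  · calc n + u ^ γ + u ^ γ + 1 ≤ u ^ γ * 4 := by omega
      _ ≤ u ^ γ * u ^ 2 := Nat.mul_le_mul_left _ hsq
      _ = u ^ (γ + 2) := (pow_add ..).symm

theorem pow_le_timeBound {u n J : ℕ} {ε δ : ℝ} (hu : u = n + ⌈1 / ε⌉₊ + ⌈1 / δ⌉₊ + 2) :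
    u ^ J ≤ timeBound (2 ^ J) n ε δ := by
  set m := n + ⌈1 / ε⌉₊ + ⌈1 / δ⌉₊
  calc u ^ J ≤ (2 * (m + 1)) ^ J := Nat.pow_le_pow_left (by omega) J
    _ = 2 ^ J * (m + 1) ^ J := mul_pow ..
    _ ≤ 2 ^ J * (m + 1) ^ 2 ^ J :=
      Nat.mul_le_mul_left _ (Nat.pow_le_pow_right (by omega) Nat.lt_two_pow_self.le)

theorem mul_pow_div_le {n u k t γ T : ℕ} (hn : n < u) (hT : T ≤ u ^ t) :
    (T : ℝ) * ((n + 1) ^ k / ((u ^ (t + k + γ) : ℕ) + 1)) ≤ 1 / (u : ℝ) ^ γ := by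
  have hu : (0 : ℝ) < u := by exact_mod_cast (by omega)
  have hnu : (n + 1 : ℝ) ≤ u := by exact_mod_cast hn
  have hTu : (T : ℝ) ≤ (u : ℝ) ^ t := by exact_mod_cast hT
  calc (T : ℝ) * ((n + 1) ^ k / ((u ^ (t + k + γ) : ℕ) + 1)) ≤
        (u : ℝ) ^ t * ((u : ℝ) ^ k / (u : ℝ) ^ (t + k + γ)) := by
        push_cast
        gcongr
        linarith
    _ = 1 / (u : ℝ) ^ γ := by
        rw [pow_add, pow_add]
        field_simp

theorem le_simulatedPayoff_of_pow_le_two_pow {n u k t γ T : ℕ} {C : Set (Cube n → Bool)}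
    {L E : Prog} {f : Cube n → Bool} {η : ℝ} {s₀ : Store} (hu : 2 ≤ u) (hn : n < u)
    (hη : η = 1 / (u : ℝ) ^ γ) (hT : T ≤ u ^ t) (hN : u ^ (3 * γ + t + 1) ≤ 2 ^ n)
    (hobey : ∀ g : Cube n → Bool, Obeys (kLocal k) g ⟨[L], s₀, []⟩)
    (hprob : ∀ g : Cube n → Bool,
      1 - η ≤ expectedPayoff g ((accurateStores E T C η g).indicator 1) T [L] s₀) (a : ℕ) :
    1 - 3 * η ≤ simulatedPayoff f (colorClass (u ^ (2 * k + 1)) (2 * k) a) k (u ^ (t + k + γ))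
      ((accurateStoresOn E T C (colorClass (u ^ (2 * k + 1)) (2 * k) a) (3 * η) f).indicator 1)
      T [L] s₀ [] := by
  have hu₂ : (2 : ℝ) ≤ u := by exact_mod_cast hu
  have hu₁ : (1 : ℝ) ≤ u := by linarith
  have hη₀ : 0 < η := by rw [hη]; positivity
  have hηu : η * (u : ℝ) ^ γ = 1 := by rw [hη]; field_simp
  have hTu : (T : ℝ) ≤ (u : ℝ) ^ t := by exact_mod_cast hT
  have hNu : (u : ℝ) ^ (3 * γ + t + 1) ≤ 2 ^ n := by exact_mod_cast hN
  have hbudget : (2 * T : ℝ) ≤ η * 2 ^ n := by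
    calc (2 * T : ℝ) ≤ u * (u : ℝ) ^ t := by gcongr
      _ = η * (u : ℝ) ^ (γ + t + 1) := by
        rw [pow_succ, pow_add, ← mul_assoc, ← mul_assoc, hηu]; ring
      _ ≤ η * 2 ^ n := by
        gcongr
        exact (pow_le_pow_right₀ hu₁ (by omega)).trans hNu
  have hfluctuation : 1 / (η ^ 2 * 2 ^ n) ≤ η := by
    rw [div_le_iff₀ (by positivity)]
    calc (1 : ℝ) = η ^ 3 * (u : ℝ) ^ (3 * γ) := by
          rw [mul_comm 3 γ, pow_mul, ← mul_pow, hηu, one_pow]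
      _ ≤ η ^ 3 * 2 ^ n := by
          gcongr
          exact (pow_le_pow_right₀ hu₁ (by omega)).trans hNu
      _ = η * (η ^ 2 * 2 ^ n) := by ring
  have hq : n ^ (2 * k) < u ^ (2 * k + 1) :=
    (Nat.pow_le_pow_left hn.le _).trans_lt (Nat.pow_lt_pow_right (by omega) (by omega))
  have hlearner := le_simulatedPayoff_of_learner (f := f) (sparse_colorClass (k := k) hq a)
    (u ^ (t + k + γ)) hobey hprob hη₀ hbudget
  rw [show η + 2 * η = 3 * η by ring] at hlearner
  have hmiss := mul_pow_div_le (k := k) (γ := γ) hn hT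
  rw [← hη] at hmiss
  linarith

/-- An exponent `c` such that points of the cube get colours below `u ^ c`, for colourings that
separate points at Hamming distance at most `2 * k`; see `colorBound`. -/
def colorExponent (k : ℕ) : ℕ := (2 * k + 3) * (2 * k) + 2

/-- The learner is asked for accuracy and confidence `1 / u ^ accuracyExponent k`, so that its
losses, summed over all colours, stay below `1 / u`. -/
def accuracyExponent (k : ℕ) : ℕ := colorExponent k + 3

/-- Cubes with at most `u ^ dimExponent k t` points are learned point by point. Here and below,
`u ^ t` bounds the running time of the learner. -/
def dimExponent (k t : ℕ) : ℕ := 3 * accuracyExponent k + t + 1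

/-- Each random example is drawn from `u ^ trialExponent k t` candidates. -/
def trialExponent (k t : ℕ) : ℕ := t + k + accuracyExponent k

/-- The table that is drawn at the start contains `u ^ tableExponent k t` examples. -/
def tableExponent (k t : ℕ) : ℕ := 2 * dimExponent k t + 1

/-- The loop bounds that do not depend on the running time of the learner are below
`u ^ loopExponent k t`. -/
def loopExponent (k t : ℕ) : ℕ := trialExponent k t + tableExponent k t + colorExponent k + 2

/-- The learner from random examples built from a learner `L` with local queries. The registers of
`L` and of its evaluator `E` are left free. -/
def reducedLearner (k t : ℕ) (L E : Prog) : Prog :=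
  learnerProg (3 + L.bound + E.bound) (colorExponent k) (2 * k + 1) (2 * k) k (trialExponent k t)
    (tableExponent k t) (accuracyExponent k) L

/-- The evaluator of the hypotheses of `reducedLearner k t L E`. -/
def reducedEvaluator (k t : ℕ) (L E : Prog) : Prog :=
  evalProg (3 + L.bound + E.bound) (colorExponent k) (2 * k + 1) (2 * k) (tableExponent k t) E

/-- A bound, polynomial in `u`, on the running times of `reducedLearner` and `reducedEvaluator`. -/
def reductionTime (k t : ℕ) (L E : Prog) (u : ℕ) : ℕ :=
  (reducedLearner k t L E).cost (u ^ (loopExponent k t + 1)) +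
    (reducedEvaluator k t L E).cost (u ^ (loopExponent k t + 1))

theorem exists_reductionTime_le_pow (k t : ℕ) (L E : Prog) :
    ∃ J, ∀ u, 2 ≤ u → reductionTime k t L E u ≤ u ^ J := by
  obtain ⟨J, hJ⟩ := exists_cost_le_pow ((reducedLearner k t L E).seq (reducedEvaluator k t L E))
    (loopExponent k t + 1)
  exact ⟨J, fun u hu => (Nat.le_succ _).trans (hJ u hu)⟩

theorem reducedLearner_queryFree (k t : ℕ) (L E : Prog) : (reducedLearner k t L E).QueryFree :=
  learnerProg_queryFree ..

section reduction

variable {k n u t T B : ℕ} {C : Set (Cube n → Bool)} {L E : Prog} {f : Cube n → Bool} {ε δ p : ℝ}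

theorem two_mul_le_pow_tableExponent (hu : 2 ≤ u) (hT : T ≤ u ^ t) :
    2 * T ≤ u ^ tableExponent k t := by
  calc 2 * T ≤ u * u ^ t := Nat.mul_le_mul hu hT
    _ = u ^ (t + 1) := (pow_succ' ..).symm
    _ ≤ u ^ tableExponent k t :=
      Nat.pow_le_pow_right (by omega) (by unfold tableExponent dimExponent; omega)

theorem pow_loopExponent_add_le (hu : 2 ≤ u) (hT : T ≤ u ^ t) :
    u ^ loopExponent k t + T ≤ u ^ (loopExponent k t + 1) := by
  have hT' : T ≤ u ^ loopExponent k t :=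
    hT.trans (Nat.pow_le_pow_right (by omega) (by unfold loopExponent trialExponent; omega))
  calc u ^ loopExponent k t + T ≤ u ^ loopExponent k t * 2 := by omega
    _ ≤ u ^ loopExponent k t * u := Nat.mul_le_mul_left _ hu
    _ = u ^ (loopExponent k t + 1) := (pow_succ ..).symm

theorem expectSample_le_expectedPayoff_reducedLearner {G : ℕ → Set (Cube n → Bool)} {Q : Set Store}
    {F : List (Cube n) → ℝ} (hu : u = n + ⌈1 / ε⌉₊ + ⌈1 / δ⌉₊ + 2) (hT : T ≤ u ^ t)
    (hB : reductionTime k t L E u ≤ B)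
    (hp₀ : 0 ≤ p)
    (hp : ∀ a, p ≤ simulatedPayoff f (colorClass (u ^ (2 * k + 1)) (2 * k) a) k
      (u ^ trialExponent k t) ({s | ∃ h, Evaluates E (s 0) T h ∧ h ∈ G a}.indicator 1) T [L]
      (learnerStore n (u ^ accuracyExponent k)) [])
    (hF : 0 ≤ F)
    (hQ : ∀ xs (h : ℕ → Cube n → Bool) s, (∀ a < u ^ colorExponent k, h a ∈ G a) →
      Evaluates (reducedEvaluator k t L E) (s 0) B
        (fun x => if x ∈ xs then f x else h (color (u ^ (2 * k + 1)) (2 * k) x) x) →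
      F xs ≤ Q.indicator 1 s) :
    expectSample (fun xs => p ^ (u ^ colorExponent k) * F xs) (u ^ tableExponent k t) [] ≤
      expectedPayoff f (Q.indicator 1) B [reducedLearner k t L E]
        (learnerStart (reducedLearner k t L E) n ε δ).store := by
  have hu₂ : 2 ≤ u := by omega
  have hQ₀ := indicator_one_nonneg Q
  have hlt {i : ℕ} (hi : i < loopExponent k t) : u ^ i < u ^ loopExponent k t :=
    Nat.pow_lt_pow_right hu₂ hi
  have hloop : loopExponent k t = trialExponent k t + tableExponent k t + colorExponent k + 2 := rfl
  have hu₁ : u < u ^ loopExponent k t := by simpa only [pow_one] using hlt (i := 1) (by omega)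
  have hW := pow_loopExponent_add_le (k := k) hu₂ hT
  have hcol := colorBound hu₂ (show n ≤ u by omega) (2 * k)
  rw [reductionTime] at hB
  have hcostL : 0 + (reducedLearner k t L E).cost (u ^ (loopExponent k t + 1)) ≤ B := by omega
  have hcostE : (reducedEvaluator k t L E).cost (u ^ (loopExponent k t + 1)) ≤ B := by omega
  refine le_trans ?_ ((wp_le_expectedPayoff (r := []) hQ₀ (fun s => (expectedPayoff_nil _ s).ge)
    _).trans (expectedPayoff_mono_time hQ₀ _ _ hcostL))
  refine expectSample_le_wp_learnerProg (P := fun a d => ∃ h, Evaluates E d T h ∧ h ∈ G a)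
    (by omega) (by omega) hu hcol hu₁ (hlt (by omega)) (hlt (by omega)) (hlt (by omega)) hW
    (two_mul_le_pow_tableExponent hu₂ hT) hp₀ hp rfl rfl rfl hF hQ₀
    fun xs hyps s hlen hhyps hxs hs => ?_
  have hchoose (a : ℕ) :
      ∃ h : Cube n → Bool, ∀ ha : a < hyps.length, Evaluates E hyps[a] T h ∧ h ∈ G a := by
    by_cases ha : a < hyps.length
    · exact (hhyps a ha).imp fun _ hh _ => hh
    · exact ⟨f, fun h => (ha h).elim⟩
  choose h hh using hchoose
  refine hQ xs h s (fun a ha => (hh a (hlen ▸ ha)).2) ?_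
  rw [hs]
  exact (evaluates_evalProg (by omega) (by omega) hcol (by omega) (by omega) hxs.le hlen
    fun a ha => (hh a ha).1).mono hcostE

theorem one_le_expectedPayoff_reducedLearner (hu : u = n + ⌈1 / ε⌉₊ + ⌈1 / δ⌉₊ + 2)
    (hT : T ≤ u ^ t) (hB : reductionTime k t L E u ≤ B)
    (hhalt : ∀ g : Cube n → Bool,
      1 ≤ expectedPayoff g ({s | ∃ h : Cube n → Bool, Evaluates E (s 0) T h}.indicator 1) T [L]
        (learnerStore n (u ^ accuracyExponent k))) :
    1 ≤ expectedPayoff f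
      ({s | ∃ h : Cube n → Bool, Evaluates (reducedEvaluator k t L E) (s 0) B h}.indicator 1) B
      [reducedLearner k t L E] (learnerStart (reducedLearner k t L E) n ε δ).store := by
  refine le_trans ?_ (expectSample_le_expectedPayoff_reducedLearner (p := 1) (F := 1)
    (G := fun _ => Set.univ) hu hT hB zero_le_one (fun a => ?_) zero_le_one
    fun xs h s _ hs => one_le_indicator_one ⟨_, hs⟩)
  · exact le_expectSample (fun _ => by simp) _ _
  · simpa only [Set.mem_univ, and_true] using one_le_simulatedPayoff T [L] _ [] fun g _ => hhalt g

theorem le_expectedPayoff_reducedLearner_of_two_pow_le (hε : 0 < ε)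
    (hu : u = n + ⌈1 / ε⌉₊ + ⌈1 / δ⌉₊ + 2) (hT : T ≤ u ^ t)
    (hB : reductionTime k t L E u ≤ B)
    (hhalt : ∀ g : Cube n → Bool,
      1 ≤ expectedPayoff g ({s | ∃ h : Cube n → Bool, Evaluates E (s 0) T h}.indicator 1) T [L]
        (learnerStore n (u ^ accuracyExponent k)))
    (hn : 2 ^ n ≤ u ^ dimExponent k t) :
    1 - 1 / (u : ℝ) ≤ expectedPayoff f
      ((accurateStores (reducedEvaluator k t L E) B C ε f).indicator 1) B
      [reducedLearner k t L E] (learnerStart (reducedLearner k t L E) n ε δ).store := by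
  refine (one_sub_inv_le_expectSample_forall_mem (by omega) hn).trans ?_
  have hrun := expectSample_le_expectedPayoff_reducedLearner (p := 1) (f := f)
    (Q := accurateStores (reducedEvaluator k t L E) B C ε f)
    (F := fun xs => if ∀ x, x ∈ xs then 1 else 0) (G := fun _ => Set.univ) hu hT hB zero_le_one
    (fun a => ?_) (fun xs => by positivity) fun xs h s _ hs => ?_
  · simpa only [one_pow, one_mul, tableExponent] using hrun
  · simpa only [Set.mem_univ, and_true] using one_le_simulatedPayoff T [L] _ [] fun g _ => hhalt g
  · split_ifs with hxs
    · simp only [hxs, if_true] at hs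
      refine one_le_indicator_one ⟨f, hs, fun c _ => ?_⟩
      rw [show err f f = 0 by simp [err]]
      exact add_nonneg (div_nonneg (Nat.cast_nonneg _) (Nat.cast_nonneg _)) hε.le
    · exact indicator_one_nonneg _ _

theorem pow_colorExponent_mul_le {η : ℝ} (hu : 2 ≤ u)
    (hη : η = 1 / (u : ℝ) ^ accuracyExponent k) :
    (u : ℝ) ^ colorExponent k * (3 * η) ≤ 1 / u := by
  have hu₂ : (2 : ℝ) ≤ u := by exact_mod_cast hu
  calc (u : ℝ) ^ colorExponent k * (3 * η) = 3 / u ^ 2 * (1 / u) := by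
        rw [hη, accuracyExponent, pow_add]
        field_simp
    _ ≤ 1 * (1 / u) := by
        gcongr
        rw [div_le_one (by positivity)]
        nlinarith
    _ = 1 / u := one_mul _

theorem le_expectedPayoff_reducedLearner_of_le_two_pow {η : ℝ}
    (hη : η = 1 / (u : ℝ) ^ accuracyExponent k) (huε : 1 / (u : ℝ) ≤ ε)
    (hu : u = n + ⌈1 / ε⌉₊ + ⌈1 / δ⌉₊ + 2) (hT : T ≤ u ^ t)
    (hB : reductionTime k t L E u ≤ B)
    (hobey : ∀ g : Cube n → Bool,
      Obeys (kLocal k) g ⟨[L], learnerStore n (u ^ accuracyExponent k), []⟩)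
    (hprob : ∀ g : Cube n → Bool, 1 - η ≤ expectedPayoff g
      ((accurateStores E T C η g).indicator 1) T [L] (learnerStore n (u ^ accuracyExponent k)))
    (hn : u ^ dimExponent k t ≤ 2 ^ n) :
    1 - 1 / (u : ℝ) ≤ expectedPayoff f
      ((accurateStores (reducedEvaluator k t L E) B C ε f).indicator 1) B
      [reducedLearner k t L E] (learnerStart (reducedLearner k t L E) n ε δ).store := by
  have hu₂ : 2 ≤ u := by omega
  have hu₁ : (1 : ℝ) ≤ u := by exact_mod_cast (by omega)
  have hloss := pow_colorExponent_mul_le hu₂ hη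
  have hη₁ : 3 * η ≤ 1 :=
    calc 3 * η ≤ (u : ℝ) ^ colorExponent k * (3 * η) :=
          le_mul_of_one_le_left (by rw [hη]; positivity) (one_le_pow₀ hu₁)
      _ ≤ 1 := hloss.trans (div_le_one_of_le₀ hu₁ (by positivity))
  have hcol : ColorBound u (colorExponent k) (2 * k + 1) (2 * k) n :=
    colorBound hu₂ (by omega) (2 * k)
  refine le_trans ?_ (expectSample_le_expectedPayoff_reducedLearner (p := 1 - 3 * η) (F := 1)
    (G := fun a => {h | ∀ c ∈ C, errOn (colorClass (u ^ (2 * k + 1)) (2 * k) a) h f ≤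
      errOn (colorClass (u ^ (2 * k + 1)) (2 * k) a) c f + 3 * η}) hu hT hB (by linarith)
    (le_simulatedPayoff_of_pow_le_two_pow hu₂ (by omega) hη hT hn hobey hprob) zero_le_one
    fun xs h s hh hs => one_le_indicator_one ⟨_, hs, fun c hc => ?_⟩)
  · refine le_expectSample (fun _ => ?_) _ _
    have hbernoulli := one_add_mul_le_pow (show -2 ≤ -(3 * η) by linarith) (u ^ colorExponent k)
    rw [Pi.one_apply, mul_one, sub_eq_add_neg 1 (3 * η)]
    push_cast at hbernoulli
    linarith
  · refine (err_le_of_errOn_le hcol.color_lt (fun a ha => hh a ha c hc) fun x => ?_).trans ?_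
    · exact (em (x ∈ xs)).imp (if_pos ·) (if_neg ·)
    · push_cast
      linarith

theorem reducedLearner_guarantee {η : ℝ} (hε : 0 < ε) (hδ : 0 < δ)
    (hu : u = n + ⌈1 / ε⌉₊ + ⌈1 / δ⌉₊ + 2) (hη : η = 1 / (u : ℝ) ^ accuracyExponent k)
    (hT : T ≤ u ^ t) (hB : reductionTime k t L E u ≤ B)
    (hL : ∀ g : Cube n → Bool,
      Obeys (kLocal k) g ⟨[L], learnerStore n (u ^ accuracyExponent k), []⟩ ∧
      1 ≤ expectedPayoff g ({s | ∃ h : Cube n → Bool, Evaluates E (s 0) T h}.indicator 1) T [L]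
        (learnerStore n (u ^ accuracyExponent k)) ∧
      1 - η ≤ expectedPayoff g ((accurateStores E T C η g).indicator 1) T [L]
        (learnerStore n (u ^ accuracyExponent k))) :
    Obeys noQueries f (learnerStart (reducedLearner k t L E) n ε δ) ∧
      1 ≤ expectedPayoff f
        ({s | ∃ h : Cube n → Bool, Evaluates (reducedEvaluator k t L E) (s 0) B h}.indicator 1) B
        [reducedLearner k t L E] (learnerStart (reducedLearner k t L E) n ε δ).store ∧
      1 - δ ≤ expectedPayoff f ((accurateStores (reducedEvaluator k t L E) B C ε f).indicator 1) B
        [reducedLearner k t L E] (learnerStart (reducedLearner k t L E) n ε δ).store := by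
  have hu₀ : (0 : ℝ) < u := by exact_mod_cast (by omega)
  have huε : 1 / (u : ℝ) ≤ ε :=
    (one_div_le hu₀ hε).mpr ((Nat.le_ceil _).trans (by exact_mod_cast (by omega)))
  have huδ : 1 / (u : ℝ) ≤ δ :=
    (one_div_le hu₀ hδ).mpr ((Nat.le_ceil _).trans (by exact_mod_cast (by omega)))
  have hhalt := fun g => (hL g).2.1
  refine ⟨obeys_of_queryFree _ _ _ fun p hp => ?_,
    one_le_expectedPayoff_reducedLearner hu hT hB hhalt, (sub_le_sub_left huδ 1).trans ?_⟩
  · rw [List.mem_singleton.mp hp]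
    exact reducedLearner_queryFree ..
  · rcases le_total (2 ^ n) (u ^ dimExponent k t) with hn | hn
    · exact le_expectedPayoff_reducedLearner_of_two_pow_le hε hu hT hB hhalt hn
    · exact le_expectedPayoff_reducedLearner_of_le_two_pow hη huε hu hT hB (fun g => (hL g).1)
        (fun g => (hL g).2.2) hn

end reduction

theorem ceil_one_div_one_div_pow (u γ : ℕ) : ⌈1 / (1 / (u : ℝ) ^ γ)⌉₊ = u ^ γ := by
  rw [one_div_one_div, ← Nat.cast_pow, Nat.ceil_natCast]

theorem learnerStart_one_div_pow (L : Prog) (n u γ : ℕ) :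
    learnerStart L n (1 / (u : ℝ) ^ γ) (1 / (u : ℝ) ^ γ) = ⟨[L], learnerStore n (u ^ γ), []⟩ := by
  rw [learnerStart, ceil_one_div_one_div_pow]
  rfl

end LocalQueries

theorem mainTheorem4 (k : ℕ) (C : LocalQueries.ConceptClass)
    (hC : LocalQueries.EfficientlyAgnosticallyLearnable (LocalQueries.kLocal k) C) :
    LocalQueries.EfficientlyAgnosticallyLearnable LocalQueries.noQueries C := by
  rw [LocalQueries.efficientlyAgnosticallyLearnable_iff] at hC ⊢
  obtain ⟨L, E, K, hLE⟩ := hC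
  let γ := LocalQueries.accuracyExponent k
  let t := K + (γ + 2) * K
  obtain ⟨J, hJ⟩ := LocalQueries.exists_reductionTime_le_pow k t L E
  refine ⟨LocalQueries.reducedLearner k t L E, LocalQueries.reducedEvaluator k t L E, 2 ^ J,
    fun n ε δ hε hδ f => ?_⟩
  obtain ⟨u, hu⟩ : ∃ u, u = n + ⌈1 / ε⌉₊ + ⌈1 / δ⌉₊ + 2 := ⟨_, rfl⟩
  have hu₂ : 2 ≤ u := by omega
  have hη : 0 < 1 / (u : ℝ) ^ γ := by positivity
  have hT : LocalQueries.timeBound K n (1 / (u : ℝ) ^ γ) (1 / (u : ℝ) ^ γ) ≤ u ^ t :=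
    LocalQueries.timeBound_le_pow hu₂ (by omega) (Nat.succ_le_succ (Nat.zero_le _))
      (LocalQueries.ceil_one_div_one_div_pow u γ)
  refine LocalQueries.reducedLearner_guarantee hε hδ hu rfl hT
    ((hJ u hu₂).trans (LocalQueries.pow_le_timeBound hu)) fun g => ?_
  simpa only [LocalQueries.learnerStart_one_div_pow] using hLE n _ _ hη hη g
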